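/- Let $n\ge 0$, $r=2n+1$, and for $q\in\mathbb C\setminus\{0\}$ put $\beta=-(q+q^{-1})$. An open link pattern is a non-crossing configuration of $r$ points $1,\dots,r$ on a line, each point being either joined to another one by a (closed) arch in the upper half-plane or joined to infinity by an open arch (no open arch starts below a closed arch). On the span of the open link patterns the following operators act: - $e_i$, $1\le i\le r-1$: glue whatever is attached to $i$ and $i+1$, and create a little arch joining $i$ and $i+1$. The factor is $\beta$ if $i,i+1$ were joined to each other; if both carried open arches it is $\beta$ for $i$ odd and $2$ for $i$ even; otherwise it is $1$ (if exactly one of the two points was open, the former partner of the other becomes open). - $e_r$: if the point $r$ is open, multiply by $\beta$; otherwise cut the arch at $r$ into two open arches. - $s$: $s\pi=\pi$ if the point $1$ is open, and $s\pi=-\pi+\pi'$ otherwise, where $\pi'$ is obtained from $\pi$ by cutting the arch at $1$ into two open arches. If $r\ge3$, put $e_1'=s e_1 s$. Put $R_i(x)=\dfrac{(qx-q^{-1})+(x-1)e_i}{q-q^{-1}x}$, and let $R_1'(x)$ be the same expression with $e_1'$ in place of $e_i$. The level-one $C_r$ $q$KZ system for a vector $\Psi=\sum_\pi\Psi_\pi\,\pi$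 with polynomial entries $\Psi_\pi\in\mathbb C[w_1,\dots,w_r]$ is $$R_i(w_{i+1}/w_i)\Psi=\tau_i\Psi\ (1\le i\le r-1),\qquad w_r^{-m_r}R_r(1/w_r^2)\Psi=\tau_r\Psi,\qquad (q^6w_1w_2)^{-m_1}R_1'(q^6w_1w_2)\Psi=\tau_1'\Psi$$ (the last equation only if $r\ge3$), where $\tau_i$ exchanges $w_i$ and $w_{i+1}$, $\tau_r$ is $w_r\to1/w_r$, $\tau_1'$ exchanges $w_2$ and $1/(q^6w_1)$, and $m_i$ is the degree of $\Psi$ in $w_i$, i.e. the maximum of the degrees of its entries. Let $\pi_0$ be the pattern with all arches open. There is a family $(\Psi^{(q)})_{q\ne0}$ of vectors of polynomials with the following properties. 1. For every $q\neq0$, $\Psi=\Psi^{(q)}$ solves the system, and also satisfies $(q^3w_1)^{-m_1}\,s\Psi(w_1,\dots,w_r)=\Psi\big(\tfrac1{q^6w_1},w_2,\dots,w_r\big)$. It has degree $2n$ in each variable, in particular $m_1=m_r=2n$. Its base entry is $$\Psi_{\pi_0}=\prod_{1\le i<j\le 2n+1}(qw_i-q^{-1}w_j),$$ which is homogeneous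 of total degree $n(2n+1)$. 2. The other entries are obtained from $\Psi_{\pi_0}$ in a triangular way: there is a total order on the patterns, independent of $q$, with least element $\pi_0$, and for every $\pi\ne\pi_0$ there are $i\in\{1,\dots,r\}$ and $\sigma<\pi$, independent of $q$, such that for all $q\ne0$ $$\Psi_\pi=\frac{(q-q^{-1}x_i)\,c_i^{-1}\,\tau_i\Psi_\sigma-(qx_i-q^{-1})\Psi_\sigma}{x_i-1}-\sum_{\rho<\pi}(e_i)_{\sigma\rho}\Psi_\rho ,$$ where $x_i=w_{i+1}/w_i$, $c_i=1$ for $i<r$, $x_r=1/w_r^2$, $c_r=w_r^{-m_r}$, and $e_i\rho=\sum_\sigma(e_i)_{\sigma\rho}\,\sigma$. 3. The solution is minimal, and unique up to a scalar: if $q\neq0$ and $q^2\ne-1$, every nonzero polynomial solution $\Phi$ of the system has degree at least $2n$ in each variable and its base entry $\Phi_{\pi_0}$ has total degree at least $n(2n+1)$; and every polynomial solution of degree at most $2n$ in $w_r$ is a scalar multiple of $\Psi^{(q)}$. 4. In the rational limit all entries have degree $n(2n+1)$: for every $\pi$ there is a polynomial $P_\pi(z_1,\dots,z_r,A)$, homogeneous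 of degree $n(2n+1)$ (or zero), such that for all $A,z_1,\dots,z_r\in\mathbb C$, when $q=-e^{-\hbar A/2}$ and $w_i=e^{-\hbar z_i}$, one has $\hbar^{-n(2n+1)}\,\Psi^{(q)}_\pi(w_1,\dots,w_r)\to P_\pi(z_1,\dots,z_r,A)$ as $\hbar\to0$, $\hbar\ne 0$; moreover $P_{\pi_0}=\prod_{i<j}(A+z_i-z_j)$. -/

import Mathlib

open scoped Topology

/-- An open link pattern on `r` points of a line (numbered from `0` here), encoded by the
involution `p` which exchanges the two ends of every closed arch and fixes the points carrying
an open arch (a half-line to infinity). The arches are drawn in the upper half-plane without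
crossings: a point `c` strictly below a closed arch `{a, p a}` is not open, and its partner is
below the same arch. -/
def OpenLinkPattern (r : ℕ) : Type :=
  {p : Fin r → Fin r // (∀ x, p (p x) = x) ∧
    ∀ a c, a < c → c < p a → p c ≠ c ∧ a < p c ∧ p c < p a}

namespace OpenLinkPattern

instance (r : ℕ) : DecidableEq (OpenLinkPattern r) :=
  inferInstanceAs (DecidableEq {p : Fin r → Fin r // (∀ x, p (p x) = x) ∧
    ∀ a c, a < c → c < p a → p c ≠ c ∧ a < p c ∧ p c < p a})

instance (r : ℕ) : Fintype (OpenLinkPattern r) :=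
  inferInstanceAs (Fintype {p : Fin r → Fin r // (∀ x, p (p x) = x) ∧
    ∀ a c, a < c → c < p a → p c ≠ c ∧ a < p c ∧ p c < p a})

/-- The pattern all of whose arches are open. -/
def allOpen (r : ℕ) : OpenLinkPattern r :=
  ⟨fun x => x, fun _ => rfl, fun _ _ h1 h2 => absurd (h1.trans h2) (lt_irrefl _)⟩

/-- Glue whatever is attached to the points `i` and `j`, and create a little arch `{i, j}`.
If `i` and `j` both carry open arches (or are joined to each other), everything else is
unchanged; if exactly one of them is open, the former partner of the other becomes open;
otherwise the two former partners are joined. -/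
def joinFun {r : ℕ} (p : Fin r → Fin r) (i j x : Fin r) : Fin r :=
  if x = i then j
  else if x = j then i
  else if p x = i then (if p j = j then x else p j)
  else if p x = j then (if p i = i then x else p i)
  else p x

theorem joinFun_valid {r : ℕ} (p : Fin r → Fin r) (h1 : ∀ x, p (p x) = x)
    (h2 : ∀ a c, a < c → c < p a → p c ≠ c ∧ a < p c ∧ p c < p a)
    (i j : Fin r) (hij : j.val = i.val + 1) :
    (∀ x, joinFun p i j (joinFun p i j x) = x) ∧
    ∀ a c, a < c → c < joinFun p i j a →
      joinFun p i j c ≠ c ∧ a < joinFun p i j c ∧ joinFun p i j c < joinFun p i j a := by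
  constructor
  · intro x
    simp only [joinFun]
    grind
  · intro a c hac hca
    have e1 := h1 i
    have e2 := h1 j
    have e3 := h1 a
    have e4 := h1 c
    have k1 := h2 a c hac
    have k2 := h2 i c
    have k3 := h2 j c
    have k4 := h2 (p i) c
    have k5 := h2 (p j) c
    have k6 := h2 a i
    have k7 := h2 a j
    have k8 := h2 i j
    have k9 := h2 (p j) i
    have k10 := h2 (p c) i
    have k11 := h2 (p c) j
    have k12 := h2 c i
    have k13 := h2 c j
    have k14 := h2 i (p j)
    have k15 := h2 j (p i)
    have k16 := h2 j (p c)
    have k17 := h2 i (p c)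
    have k18 := h2 (p i) (p c)
    have k19 := h2 (p j) (p c)
    clear h1 h2
    unfold joinFun at *
    split_ifs at * <;> grind

/-- The pattern obtained by gluing the arches at the neighbouring points `i` and `j = i + 1`
and creating the little arch `{i, j}`. -/
def join {r : ℕ} (π : OpenLinkPattern r) (i j : Fin r) (hij : j.val = i.val + 1) :
    OpenLinkPattern r :=
  ⟨joinFun π.1 i j, joinFun_valid π.1 π.2.1 π.2.2 i j hij⟩

/-- Cut the closed arch at `x` (if there is one) into two open arches. -/
def cutFun {r : ℕ} (p : Fin r → Fin r) (x y : Fin r) : Fin r :=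
  if y = x ∨ y = p x then y else p y

theorem cutFun_valid {r : ℕ} (p : Fin r → Fin r) (h1 : ∀ x, p (p x) = x)
    (h2 : ∀ a c, a < c → c < p a → p c ≠ c ∧ a < p c ∧ p c < p a)
    (x : Fin r) (hx : (∀ a, x ≤ a) ∨ ∀ a, a ≤ x) :
    (∀ y, cutFun p x (cutFun p x y) = y) ∧
    ∀ a c, a < c → c < cutFun p x a →
      cutFun p x c ≠ c ∧ a < cutFun p x c ∧ cutFun p x c < cutFun p x a := by
  constructor
  · intro y
    simp only [cutFun]
    grind
  · intro a c hac hca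
    have e1 := h1 x
    have e2 := h1 a
    have e3 := h1 c
    have k1 := h2 a c hac
    have k2 := h2 a (p x)
    have k3 := h2 a x
    have hb : (x ≤ a ∧ x ≤ p a ∧ x ≤ c ∧ x ≤ p c) ∨ (a ≤ x ∧ p a ≤ x ∧ c ≤ x ∧ p c ≤ x) := by
      rcases hx with hx | hx
      · exact Or.inl ⟨hx _, hx _, hx _, hx _⟩
      · exact Or.inr ⟨hx _, hx _, hx _, hx _⟩
    clear h1 h2 hx
    unfold cutFun at *
    split_ifs at * <;> grind

/-- Cut the closed arch (if any) at the first point into two open arches. -/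
def cutFirst {n : ℕ} (π : OpenLinkPattern (2 * n + 1)) : OpenLinkPattern (2 * n + 1) :=
  ⟨cutFun π.1 0, cutFun_valid π.1 π.2.1 π.2.2 0 (Or.inl fun a => Fin.zero_le a)⟩

/-- Cut the closed arch (if any) at the last point into two open arches. -/
def cutLast {n : ℕ} (π : OpenLinkPattern (2 * n + 1)) : OpenLinkPattern (2 * n + 1) :=
  ⟨cutFun π.1 (Fin.last (2 * n)),
    cutFun_valid π.1 π.2.1 π.2.2 (Fin.last (2 * n)) (Or.inr fun a => Fin.le_last a)⟩

end OpenLinkPattern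

namespace CqKZ

open OpenLinkPattern

/-- Square matrices indexed by the open link patterns on `2 n + 1` points. -/
abbrev Op (n : ℕ) (K : Type) : Type :=
  Matrix (OpenLinkPattern (2 * n + 1)) (OpenLinkPattern (2 * n + 1)) K

section Operators

variable {K : Type} [Field K]

/-- The weight produced when the generator with (one-based) index `i.val + 1 ≤ 2 n` acts on `π`:
a closed loop gives `β`; two open arches connected to each other at infinity give `β` if the
one-based index is odd, and `2` if it is even; otherwise the weight is `1`. -/
def bulkWeight {n : ℕ} (β : K) (i : Fin (2 * n)) (π : OpenLinkPattern (2 * n + 1)) : K :=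
  if π.1 i.castSucc = i.succ then β
  else if π.1 i.castSucc = i.castSucc ∧ π.1 i.succ = i.succ then
    (if Even i.val then β else 2)
  else 1

/-- The generators `e_1, …, e_{r-1}` of `CTL(β)` (`r = 2 n + 1`): column `π` of the matrix is the
image of the pattern `π`; `i : Fin (2 n)` stands for the one-based index `i.val + 1`. -/
def bulkE (n : ℕ) (β : K) (i : Fin (2 * n)) : Op n K := fun σ π =>
  if σ = π.join i.castSucc i.succ (by simp) then bulkWeight β i π else 0

/-- The boundary generator `e_r`, `r = 2 n + 1`: it connects the last point to infinity; if this
point is already open this creates a loop, of weight `β` since `r` is odd. -/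
def lastE (n : ℕ) (β : K) : Op n K := fun σ π =>
  if σ = π.cutLast then (if π.1 (Fin.last (2 * n)) = Fin.last (2 * n) then β else 1) else 0

/-- The involution `s`: `s π = π` if the first point is open, and `s π = - π + π'` otherwise,
with `π'` obtained from `π` by cutting the closed arch at the first point. -/
def sOp (n : ℕ) (K : Type) [Field K] : Op n K := fun σ π =>
  if π.1 0 = 0 then (if σ = π then 1 else 0)
  else (if σ = π.cutFirst then 1 else 0) - (if σ = π then 1 else 0)

/-- `R(x) = ((q x - q⁻¹) + (x - 1) e) / (q - q⁻¹ x)`. -/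
def RMat {n : ℕ} (q : K) (e : Op n K) (x : K) : Op n K :=
  (q - q⁻¹ * x)⁻¹ • ((q * x - q⁻¹) • (1 : Op n K) + (x - 1) • e)

end Operators

/-- A vector of polynomials in `w_1, …, w_r`, `r = 2 n + 1`, indexed by open link patterns. -/
abbrev PolyVec (n : ℕ) : Type :=
  OpenLinkPattern (2 * n + 1) → MvPolynomial (Fin (2 * n + 1)) ℂ

/-- The field of rational functions `ℂ(w_1, …, w_r)`, `r = 2 n + 1`. -/
abbrev RatFun (n : ℕ) : Type := FractionRing (MvPolynomial (Fin (2 * n + 1)) ℂ)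

noncomputable section

/-- The spectral parameters as rational functions. -/
def w (n : ℕ) (i : Fin (2 * n + 1)) : RatFun n :=
  algebraMap (MvPolynomial (Fin (2 * n + 1)) ℂ) (RatFun n) (MvPolynomial.X i)

/-- A constant as a rational function. -/
def const (n : ℕ) (c : ℂ) : RatFun n := algebraMap ℂ (RatFun n) c

/-- `Ψ` with the rational functions `v` substituted for the spectral parameters. -/
def evalAt {n : ℕ} (Ψ : PolyVec n) (v : Fin (2 * n + 1) → RatFun n) :
    OpenLinkPattern (2 * n + 1) → RatFun n :=
  fun π => MvPolynomial.aeval v (Ψ π)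

/-- The degree of the vector `Ψ` in one spectral parameter. -/
def degIn {n : ℕ} (i : Fin (2 * n + 1)) (Ψ : PolyVec n) : ℕ :=
  Finset.univ.sup fun π => (Ψ π).degreeOf i

/-- The loop weight `β = -(q + q⁻¹)`. -/
def loopWeight {K : Type} [Field K] (q : K) : K := -(q + q⁻¹)

/-- The generators of `CTL(β)` over the field of rational functions: `gen n q i` is `e_{i+1}`,
the last one being the boundary generator. -/
def gen (n : ℕ) (q : ℂ) : Fin (2 * n + 1) → Op n (RatFun n) :=
  Fin.lastCases (lastE n (loopWeight (const n q))) (bulkE n (loopWeight (const n q)))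

/-- The argument of the `R`-matrix of each generator: `w_{i+1} / w_i` for `i < r`, and
`1 / w_r ^ 2` for the last one. -/
def arg (n : ℕ) : Fin (2 * n + 1) → RatFun n :=
  Fin.lastCases (1 / w n (Fin.last (2 * n)) ^ 2) (fun i => w n i.succ / w n i.castSucc)

/-- The reflections of the spectral parameters: `w_i ↔ w_{i+1}` for `i < r`, and
`w_r → 1 / w_r` for the last one. -/
def reflectedPoint (n : ℕ) : Fin (2 * n + 1) → Fin (2 * n + 1) → RatFun n :=
  Fin.lastCases (Function.update (w n) (Fin.last (2 * n)) (1 / w n (Fin.last (2 * n))))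
    (fun i => w n ∘ Equiv.swap i.castSucc i.succ)

/-- The factor in front of the `R`-matrix of each generator, `m` being the degree in `w_r`: `1`
for `i < r`, and `w_r ^ (-m)` for the last one. -/
def prefactor (n m : ℕ) : Fin (2 * n + 1) → RatFun n :=
  Fin.lastCases ((w n (Fin.last (2 * n)) ^ m)⁻¹) (fun _ => 1)

/-- The extra operator `e_1' = s e_1 s` (where `i` is the first index). -/
def extraE (n : ℕ) (q : ℂ) (i : Fin (2 * n)) : Op n (RatFun n) :=
  sOp n (RatFun n) * bulkE n (loopWeight (const n q)) i * sOp n (RatFun n)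

/-- The level one `C_r` `q`KZ system, `r = 2 n + 1`. -/
structure IsSolution {n : ℕ} (q : ℂ) (Ψ : PolyVec n) : Prop where
  /-- `R_i(w_{i+1} / w_i) Ψ = τ_i Ψ` for `i < r`, and `w_r ^ (-m_r) R_r(1 / w_r ^ 2) Ψ = τ_r Ψ`. -/
  reflection : ∀ i : Fin (2 * n + 1),
    prefactor n (degIn (Fin.last (2 * n)) Ψ) i •
        (RMat (const n q) (gen n q i) (arg n i)).mulVec (evalAt Ψ (w n)) =
      evalAt Ψ (reflectedPoint n i)
  /-- `(q ^ 6 w_1 w_2) ^ (-m_1) R_1'(q ^ 6 w_1 w_2) Ψ = τ_1' Ψ`, where `τ_1'` exchanges `w_2` and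
  `1 / (q ^ 6 w_1)`. There is no such equation if `r = 1`. -/
  affine : ∀ i : Fin (2 * n), i.val = 0 →
    ((const n q ^ 6 * w n i.castSucc * w n i.succ) ^ degIn 0 Ψ)⁻¹ •
        (RMat (const n q) (extraE n q i)
          (const n q ^ 6 * w n i.castSucc * w n i.succ)).mulVec (evalAt Ψ (w n)) =
      evalAt Ψ (Function.update
        (Function.update (w n) i.castSucc (1 / (const n q ^ 6 * w n i.succ)))
        i.succ (1 / (const n q ^ 6 * w n i.castSucc)))

/-- The recast affinization relation
`(q ^ 3 w_1) ^ (-m_1) s Ψ(w_1, …, w_r) = Ψ(1 / (q ^ 6 w_1), w_2, …, w_r)`. -/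
def AffineReflection {n : ℕ} (q : ℂ) (Ψ : PolyVec n) : Prop :=
  ((const n q ^ 3 * w n 0) ^ degIn 0 Ψ)⁻¹ • (sOp n (RatFun n)).mulVec (evalAt Ψ (w n)) =
    evalAt Ψ (Function.update (w n) 0 (1 / (const n q ^ 6 * w n 0)))

/-- The base entry `∏_{i < j} (q w_i - q⁻¹ w_j)`. -/
def baseEntry (n : ℕ) (q : ℂ) : MvPolynomial (Fin (2 * n + 1)) ℂ :=
  ∏ i : Fin (2 * n + 1), ∏ j ∈ Finset.Ioi i,
    (MvPolynomial.C q * MvPolynomial.X i - MvPolynomial.C q⁻¹ * MvPolynomial.X j)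

/-- The entry `Ψ_π` is given in terms of the entries `Ψ_ρ` with `ord ρ < ord π` by the formula
obtained by solving the `σ`-component of the equation of the generator `e_i` for `Ψ_π`. -/
def EntryFromEarlier {n : ℕ} (q : ℂ) (Ψ : PolyVec n) (ord : OpenLinkPattern (2 * n + 1) → ℕ)
    (i : Fin (2 * n + 1)) (σ π : OpenLinkPattern (2 * n + 1)) : Prop :=
  evalAt Ψ (w n) π =
    ((const n q - (const n q)⁻¹ * arg n i) *
          ((prefactor n (degIn (Fin.last (2 * n)) Ψ) i)⁻¹ * evalAt Ψ (reflectedPoint n i) σ)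
        - (const n q * arg n i - (const n q)⁻¹) * evalAt Ψ (w n) σ) / (arg n i - 1)
      - ∑ ρ with ord ρ < ord π, gen n q i σ ρ * evalAt Ψ (w n) ρ

end

end CqKZ

/-!
Multiplying the reflection equations by their denominators turns them into linear equations on the
space `Box n` of polynomials of degree at most `2 n` in each variable. Write `T_i` for the
Demazure–Lusztig operators `heckeT`, which satisfy the relations of the Hecke algebra of type `C`
with eigenvalues `q` and `-q⁻¹`. Then `Ψ` solves the equations for `e_1, …, e_r` if and only if
`T_i Ψ = (q + e_i) Ψ` (`SolvesHecke`, `reflection_iff_solvesHecke`).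

*Triangularity.* Order the patterns by the weighted number of right ends of their closed arches.
Every pattern but `π₀` occurs with coefficient `1` in a row of some `e_i` that involves otherwise
only smaller patterns, and the row is that of a smaller pattern (`exists_predecessor`). So a
solution is determined by its entry at `π₀`. No `e_i` with `i < r` produces `π₀`, so this entry is a
common eigenvector of `T_1, …, T_{r-1}`; for `q² ≠ -1` such polynomials are divisible by the base
entry (`baseEntry_dvd`). Minimality and uniqueness follow (`IsSolution.minimal`,
`IsSolution.exists_eq_smul`).

*Existence.* Let `q = κ²`. Replacing each closed arch by a singlet and each open arch by a vector
that depends on the parity of its position embeds the patterns in a spin chain of length `r`, on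
which the `e_i` act locally (`bulkSpin_spinVec`, `lastSpin_spinVec`, `eq_zero_of_sum_spinVec`); the
operator `s` becomes the reversal of the first spin (`spinVec_flipFirst`). In the whole spin chain a
solution is easy to write down: the base entry is the component with all spins up, and the braid
relations of type `C` allow the other components to be generated from it by the `T_i`
(`spinPoly`, `heckeT_spinPoly`). For real `κ` the operators `e_i` on the spin chain are self-adjoint
for a positive form, so the orthogonal projection to the span of the patterns again solves the
equations (`gram_isUnit_det`, `projection_solvesHecke`). For `1 < q < 2` it is not zero: at the
point `(a₀, q² a₀, a₁, q² a₁, …, q⁻¹)` the spin vector is proportional to that of the pattern with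
arches `{1, 2}, {3, 4}, …`, and it does not vanish there, because the reflections would carry the
zero to a point where the base entry is not zero (`pairing_pairedPattern_ne_zero`). By divisibility
the entry of the projection at `π₀` is a multiple of the base entry, and it can be normalised.

By triangularity the entries are Laurent polynomials in `q`, and identities between Laurent
polynomials that hold for `1 < q < 2` hold for all `q ≠ 0` (`IsLaurent.eq_zero`,
`exists_solution`).

*The affine equation.* Reversing the first spin of `spinPoly` amounts to the substitution
`w_1 → 1 / (q⁶ w_1)` (`spinPoly_flipFirst`). This reduces to a formula for `T_1 ⋯ T_r` applied to
the base entry, which is a partial fraction identity (`tailSum_eq`). Transferred to the patterns, it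
is the relation for `s`. As `s² = 1`, conjugating the equation for `e_1` by `s` gives the one for
`e_1'` (`affine_equation`).

*The rational limit.* On setting `q = - e^{-hA/2}` and `w_i = e^{-h z_i}`, a Laurent polynomial in
`q` with polynomial coefficients in `w` has an expansion in `h` whose coefficient of order `k` is a
homogeneous polynomial of degree `k` in `z` and `A`. The base entry has order `n (2 n + 1)`. The
triangular recursion multiplies and divides by functions with simple zeros in `h`, so it preserves
the order where the divisors do not degenerate, that is, outside the zero locus of a polynomial in
`z`. As the coefficients are polynomials, the coefficients of smaller order vanish identically
(`HasHomogeneousExpansion.exists_limit`, `exists_rational_limit`).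
-/

namespace CqKZ
open OpenLinkPattern MvPolynomial

noncomputable section

/-! ### Reflections and divided differences on polynomials of bounded degree -/

lemma mem_restrictDegree_iff_degreeOf {σ : Type} (f : MvPolynomial σ ℂ) (d : ℕ) :
    f ∈ restrictDegree σ ℂ d ↔ ∀ i, f.degreeOf i ≤ d := by
  simp only [mem_restrictDegree, degreeOf_le_iff]
  exact ⟨fun h i s hs => h s hs i, fun h s hs i => h i s hs⟩

/-- The substitution `X_i → 1 / (c² X_i)` followed by multiplication by `(c X_i) ^ d`, as a linear
map on polynomials. It has this meaning only on polynomials of degree at most `d` in `X_i`; above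
this degree the truncated subtraction gives junk. -/
def inversion {σ : Type} [DecidableEq σ] (d : ℕ) (i : σ) (c : ℂ) :
    MvPolynomial σ ℂ →ₗ[ℂ] MvPolynomial σ ℂ :=
  (basisMonomials σ ℂ).constr ℂ fun s =>
    monomial (s.update i (d - s i)) (c ^ d * (c ^ (2 * s i))⁻¹)

lemma inversion_monomial {σ : Type} [DecidableEq σ] (d : ℕ) (i : σ) (c a : ℂ) (s : σ →₀ ℕ) :
    inversion d i c (monomial s a) =
      monomial (s.update i (d - s i)) (a * (c ^ d * (c ^ (2 * s i))⁻¹)) := by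
  have h : monomial s a = a • basisMonomials σ ℂ s := by
    simp [smul_monomial]
  rw [h, map_smul, inversion, Module.Basis.constr_basis, smul_monomial, smul_eq_mul]

lemma aeval_inversion {σ : Type} [Fintype σ] [DecidableEq σ] {K : Type} [Field K] [Algebra ℂ K]
    {d : ℕ} {i : σ} {c : ℂ} (hc : c ≠ 0) {v : σ → K} (hv : v i ≠ 0)
    {f : MvPolynomial σ ℂ} (hf : f.degreeOf i ≤ d) :
    aeval v (inversion d i c f) = (algebraMap ℂ K c * v i) ^ d *
      aeval (Function.update v i (1 / (algebraMap ℂ K c ^ 2 * v i))) f := by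
  have hc' : algebraMap ℂ K c ≠ 0 := by simpa using hc
  conv_lhs => rw [f.as_sum]
  conv_rhs => rw [f.as_sum]
  rw [map_sum, map_sum, map_sum, Finset.mul_sum]
  refine Finset.sum_congr rfl fun s hs => ?_
  have hsi : s i ≤ d := degreeOf_le_iff.1 hf s hs
  rw [inversion_monomial, aeval_monomial, aeval_monomial,
    Finsupp.prod_fintype _ _ (fun _ => pow_zero _), Finsupp.prod_fintype _ _ (fun _ => pow_zero _),
    ← Finset.mul_prod_erase _ _ (Finset.mem_univ i),
    ← Finset.mul_prod_erase _ _ (Finset.mem_univ i)]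
  have e : ∀ x ∈ Finset.univ.erase i, v x ^ (s.update i (d - s i)) x =
      Function.update v i (1 / (algebraMap ℂ K c ^ 2 * v i)) x ^ s x := by
    intro x hx
    have hx' := (Finset.mem_erase.1 hx).1
    simp [Function.update_of_ne hx']
  rw [Finset.prod_congr rfl e]
  obtain ⟨k, rfl⟩ := Nat.exists_eq_add_of_le hsi
  simp only [Finsupp.coe_update, Function.update_self, map_mul, map_pow, map_inv₀, one_div,
    Nat.add_sub_cancel_left]
  generalize (∏ x ∈ Finset.univ.erase i, _ : K) = p
  generalize algebraMap ℂ K c = c' at hc' ⊢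
  rw [inv_pow, mul_pow (c' ^ 2), ← pow_mul]
  field_simp
  ring

/-- Polynomials in `w_1, …, w_r`, `r = 2 n + 1`, of degree at most `2 n` in each variable. -/
abbrev Box (n : ℕ) : Submodule ℂ (MvPolynomial (Fin (2 * n + 1)) ℂ) :=
  restrictDegree (Fin (2 * n + 1)) ℂ (2 * n)

lemma degreeOf_le_of_mem_box {n : ℕ} (f : Box n) (i : Fin (2 * n + 1)) :
    f.1.degreeOf i ≤ 2 * n :=
  (mem_restrictDegree_iff_degreeOf f.1 _).1 f.2 i

lemma degreeOf_rename_equiv {σ : Type} (e : Equiv.Perm σ) (f : MvPolynomial σ ℂ) (i : σ) :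
    (rename e f).degreeOf i = f.degreeOf (e.symm i) := by
  have := degreeOf_rename_of_injective (p := f) e.injective (e.symm i)
  simpa using this

lemma rename_swap_mem_box {n : ℕ} (i j : Fin (2 * n + 1)) (f : MvPolynomial (Fin (2 * n + 1)) ℂ)
    (hf : f ∈ Box n) : rename (Equiv.swap i j) f ∈ Box n := by
  rw [mem_restrictDegree_iff_degreeOf] at hf ⊢
  intro k
  rw [degreeOf_rename_equiv]
  exact hf _

lemma inversion_mem_box {n : ℕ} (i : Fin (2 * n + 1)) (c : ℂ)
    (f : MvPolynomial (Fin (2 * n + 1)) ℂ) (hf : f ∈ Box n) : inversion (2 * n) i c f ∈ Box n := by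
  rw [f.as_sum, map_sum]
  refine Submodule.sum_mem _ fun s hs => ?_
  rw [inversion_monomial, mem_restrictDegree]
  intro t ht k
  have := support_monomial_subset ht
  rw [Finset.mem_singleton] at this
  subst this
  rw [Finsupp.coe_update]
  by_cases hk : k = i
  · subst hk; simp
  · rw [Function.update_of_ne hk]
    exact (mem_restrictDegree _ _ _).1 hf s hs k

/-- The exchange of `w_i` and `w_j` on `Box n`. -/
def exchange (n : ℕ) (i j : Fin (2 * n + 1)) : Module.End ℂ (Box n) :=
  (rename (Equiv.swap i j)).toLinearMap.restrict (rename_swap_mem_box i j)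

/-- The map `f ↦ (c w_i) ^ (2 n) f(…, 1 / (c² w_i), …)` on `Box n`. -/
def invert (n : ℕ) (i : Fin (2 * n + 1)) (c : ℂ) : Module.End ℂ (Box n) :=
  (inversion (2 * n) i c).restrict (inversion_mem_box i c)

lemma coe_exchange {n : ℕ} (i j : Fin (2 * n + 1)) (f : Box n) :
    (exchange n i j f : MvPolynomial (Fin (2 * n + 1)) ℂ) = rename (Equiv.swap i j) f.1 := rfl

lemma eval_exchange {n : ℕ} (i j : Fin (2 * n + 1)) (f : Box n) (v : Fin (2 * n + 1) → ℂ) :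
    eval v (exchange n i j f).1 = eval (v ∘ Equiv.swap i j) f.1 := by
  rw [coe_exchange, eval_rename]

lemma aeval_invert {n : ℕ} {K : Type} [Field K] [Algebra ℂ K] {i : Fin (2 * n + 1)} {c : ℂ}
    (hc : c ≠ 0) {v : Fin (2 * n + 1) → K} (hv : v i ≠ 0) (f : Box n) :
    aeval v (invert n i c f).1 = (algebraMap ℂ K c * v i) ^ (2 * n) *
      aeval (Function.update v i (1 / (algebraMap ℂ K c ^ 2 * v i))) f.1 :=
  aeval_inversion hc hv (degreeOf_le_of_mem_box f i)

lemma eval_invert {n : ℕ} {i : Fin (2 * n + 1)} {c : ℂ}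
    (hc : c ≠ 0) {v : Fin (2 * n + 1) → ℂ} (hv : v i ≠ 0) (f : Box n) :
    eval v (invert n i c f).1 = (c * v i) ^ (2 * n) *
      eval (Function.update v i (1 / (c ^ 2 * v i))) f.1 := by
  have := aeval_invert hc hv f
  simpa [aeval_eq_eval] using this

/-- If `m * E f` is divisible by `p` within `Box n` for every `f`, then the quotient is linear. -/
lemma exists_linearMap_quotient {n : ℕ} {p : MvPolynomial (Fin (2 * n + 1)) ℂ} (hp : p ≠ 0)
    (m : MvPolynomial (Fin (2 * n + 1)) ℂ) (E : Module.End ℂ (Box n))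
    (h : ∀ f, ∃ g ∈ Box n, p * g = m * (E f).1) :
    ∃ D : Module.End ℂ (Box n), ∀ f, p * (D f).1 = m * (E f).1 := by
  choose g hg hg' using h
  refine ⟨{ toFun := fun f => ⟨g f, hg f⟩, map_add' := fun a b => ?_,
            map_smul' := fun c a => ?_ }, hg'⟩
  · apply Subtype.ext
    apply mul_left_cancel₀ hp
    rw [Submodule.coe_add, mul_add, hg', hg', hg', map_add, Submodule.coe_add, mul_add]
  · apply Subtype.ext
    apply mul_left_cancel₀ hp
    rw [RingHom.id_apply, Submodule.coe_smul, mul_smul_comm, hg', hg', map_smul,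
      Submodule.coe_smul, mul_smul_comm]

lemma X_sub_X_dvd_rename_swap_sub {σ : Type} [DecidableEq σ] (i j : σ) (f : MvPolynomial σ ℂ) :
    (X j - X i : MvPolynomial σ ℂ) ∣ rename (Equiv.swap i j) f - f := by
  induction f using MvPolynomial.induction_on with
  | C a => simp
  | add p q hp hq =>
    have : rename (Equiv.swap i j) (p + q) - (p + q) =
        (rename (Equiv.swap i j) p - p) + (rename (Equiv.swap i j) q - q) := by
      rw [map_add]; ring
    rw [this]
    exact dvd_add hp hq
  | mul_X p k hp =>
    have : rename (Equiv.swap i j) (p * X k) - p * X k =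
        (rename (Equiv.swap i j) p - p) * X (Equiv.swap i j k) +
          p * (X (Equiv.swap i j k) - X k) := by
      rw [map_mul, rename_X]; ring
    rw [this]
    refine dvd_add (hp.mul_right _) (Dvd.dvd.mul_left ?_ _)
    by_cases h1 : k = i
    · subst h1; simp
    · by_cases h2 : k = j
      · subst h2
        rw [Equiv.swap_apply_right, ← neg_sub (X k)]
        exact (dvd_refl _).neg_right
      · rw [Equiv.swap_apply_of_ne_of_ne h1 h2]; simp

lemma X_sub_X_ne_zero {σ : Type} {i j : σ} (hij : i ≠ j) :
    (X j - X i : MvPolynomial σ ℂ) ≠ 0 := by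
  rw [sub_ne_zero]
  exact fun h => hij (X_injective h).symm

lemma degreeOf_X_sub_X_ge {σ : Type} {i j : σ} (hij : i ≠ j) :
    1 ≤ (X j - X i : MvPolynomial σ ℂ).degreeOf i ∧
      1 ≤ (X j - X i : MvPolynomial σ ℂ).degreeOf j := by
  classical
  have h1 : ∀ a b : σ, a ≠ b → 1 ≤ (X b - X a : MvPolynomial σ ℂ).degreeOf b := by
    intro a b hab
    have : coeff (Finsupp.single b 1) (X b - X a : MvPolynomial σ ℂ) ≠ 0 := by
      rw [coeff_sub, coeff_X, coeff_X, if_pos rfl, if_neg]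
      · simp
      · intro h
        exact hab ((Finsupp.single_left_injective one_ne_zero) h)
    have := monomial_le_degreeOf b (mem_support_iff.2 this)
    simpa using this
  refine ⟨?_, h1 i j hij⟩
  rw [← neg_sub, degreeOf_neg]
  exact h1 j i hij.symm

lemma exists_dividedDifference {n : ℕ} {i j : Fin (2 * n + 1)} (hij : i ≠ j) :
    ∃ D : Module.End ℂ (Box n), ∀ f : Box n,
      (X j - X i) * (D f).1 = X i * ((exchange n i j f).1 - f.1) := by
  refine exists_linearMap_quotient (X_sub_X_ne_zero hij) (X i) (exchange n i j - 1) fun f => ?_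
  obtain ⟨g, hg⟩ := (X_sub_X_dvd_rename_swap_sub i j f.1).mul_left (X i)
  refine ⟨g, ?_, hg.symm⟩
  rw [mem_restrictDegree_iff_degreeOf]
  intro k
  by_cases hg0 : g = 0
  · simp [hg0]
  have h1 := congrArg (degreeOf k) hg
  rw [degreeOf_mul_eq (X_sub_X_ne_zero hij) hg0] at h1
  have h2 : degreeOf k (X i * (rename (Equiv.swap i j) f.1 - f.1)) ≤
      degreeOf k (X i : MvPolynomial (Fin (2 * n + 1)) ℂ) + 2 * n := by
    refine (degreeOf_mul_le _ _ _).trans (Nat.add_le_add_left ?_ _)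
    refine (degreeOf_sub_le _ _ _).trans (max_le ?_ (degreeOf_le_of_mem_box f k))
    exact degreeOf_le_of_mem_box (exchange n i j f) k
  by_cases hk : k = i
  · subst hk
    have := (degreeOf_X_sub_X_ge hij).1
    rw [degreeOf_X_self] at h2
    omega
  · rw [degreeOf_X_of_ne (Ne.symm (Ne.symm hk))] at h2
    omega

lemma one_sub_X_sq_ne_zero {σ : Type} (i : σ) : (1 - X i ^ 2 : MvPolynomial σ ℂ) ≠ 0 := by
  intro h
  have := congrArg (eval (0 : σ → ℂ)) h
  simp at this

lemma two_le_degreeOf_one_sub_X_sq {σ : Type} (i : σ) :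
    2 ≤ (1 - X i ^ 2 : MvPolynomial σ ℂ).degreeOf i := by
  classical
  have : coeff (Finsupp.single i 2) (1 - X i ^ 2 : MvPolynomial σ ℂ) ≠ 0 := by
    rw [coeff_sub, coeff_X_pow, coeff_one, if_neg]
    · simp
    · intro h
      have := DFunLike.congr_fun h i
      simp at this
  have := monomial_le_degreeOf i (mem_support_iff.2 this)
  simpa using this

/-- The exponents `k` and `2 n - k` have the same parity, which makes the quotient a polynomial. -/
lemma one_sub_X_sq_dvd_inversion_sub {n : ℕ} (i : Fin (2 * n + 1)) (f : Box n) :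
    (1 - X i ^ 2 : MvPolynomial (Fin (2 * n + 1)) ℂ) ∣ (invert n i 1 f).1 - f.1 := by
  have h0 : (invert n i 1 f).1 = inversion (2 * n) i 1 f.1 := rfl
  rw [h0]
  conv_rhs => rw [f.1.as_sum]
  rw [map_sum, ← Finset.sum_sub_distrib]
  refine Finset.dvd_sum fun s hs => ?_
  have hsi : s i ≤ 2 * n := degreeOf_le_iff.1 (degreeOf_le_of_mem_box f i) s hs
  rw [inversion_monomial]
  have key : ∀ k : ℕ, monomial (s.update i k) (coeff s f.1) =
      monomial (s.update i 0) (coeff s f.1) * X i ^ k := by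
    intro k
    have e : s.update i k = s.update i 0 + Finsupp.single i k := by
      ext x
      by_cases hx : x = i
      · subst hx; simp
      · simp [Function.update_of_ne hx, Ne.symm hx]
    rw [X_pow_eq_monomial, monomial_mul, mul_one, ← e]
  have e1 : s = s.update i (s i) := by simp
  have e2 : monomial s (coeff s f.1) = monomial (s.update i 0) (coeff s f.1) * X i ^ (s i) := by
    rw [← key, ← e1]
  rw [e2, one_pow, one_pow, inv_one, mul_one, mul_one, key, ← mul_sub]
  refine Dvd.dvd.mul_left ?_ _
  have aux : ∀ a b : ℕ, (1 - X i ^ 2 : MvPolynomial (Fin (2 * n + 1)) ℂ) ∣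
      X i ^ a - X i ^ (a + 2 * b) := by
    intro a b
    rw [pow_add, pow_mul, ← mul_one_sub]
    refine Dvd.dvd.mul_left ?_ _
    simpa using sub_dvd_pow_sub_pow (1 : MvPolynomial (Fin (2 * n + 1)) ℂ) (X i ^ 2) b
  rcases le_total (s i) n with h | h
  · rw [← neg_sub (X i ^ s i)]
    have := aux (s i) (n - s i)
    rw [show s i + 2 * (n - s i) = 2 * n - s i by omega] at this
    exact this.neg_right
  · have := aux (2 * n - s i) (s i - n)
    rwa [show 2 * n - s i + 2 * (s i - n) = s i by omega] at this

lemma exists_boundaryDifference {n : ℕ} (i : Fin (2 * n + 1)) :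
    ∃ D : Module.End ℂ (Box n), ∀ f : Box n,
      (1 - X i ^ 2) * (D f).1 = X i ^ 2 * ((invert n i 1 f).1 - f.1) := by
  refine exists_linearMap_quotient (one_sub_X_sq_ne_zero i) (X i ^ 2) (invert n i 1 - 1)
    fun f => ?_
  obtain ⟨g, hg⟩ := (one_sub_X_sq_dvd_inversion_sub i f).mul_left (X i ^ 2)
  refine ⟨g, ?_, hg.symm⟩
  rw [mem_restrictDegree_iff_degreeOf]
  intro k
  by_cases hg0 : g = 0
  · simp [hg0]
  have h1 := congrArg (degreeOf k) hg
  rw [degreeOf_mul_eq (one_sub_X_sq_ne_zero i) hg0] at h1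
  have h2 : degreeOf k (X i ^ 2 * ((invert n i 1 f).1 - f.1)) ≤
      degreeOf k (X i ^ 2 : MvPolynomial (Fin (2 * n + 1)) ℂ) + 2 * n := by
    refine (degreeOf_mul_le _ _ _).trans (Nat.add_le_add_left ?_ _)
    refine (degreeOf_sub_le _ _ _).trans (max_le ?_ (degreeOf_le_of_mem_box f k))
    exact degreeOf_le_of_mem_box (invert n i 1 f) k
  by_cases hk : k = i
  · subst hk
    have := two_le_degreeOf_one_sub_X_sq k
    rw [degreeOf_X_self_pow] at h2
    omega
  · rw [degreeOf_X_pow_of_ne 2 hk] at h2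
    omega

/-- The reflections of the finite Weyl group on `Box n`: exchange of neighbouring variables, and
inversion of the last variable. -/
def reflect (n : ℕ) : Fin (2 * n + 1) → Module.End ℂ (Box n) :=
  Fin.lastCases (invert n (Fin.last (2 * n)) 1) fun i => exchange n i.castSucc i.succ

lemma castSucc_ne_succ {m : ℕ} (i : Fin m) : i.castSucc ≠ i.succ := by
  intro h
  have := congrArg Fin.val h
  simp at this

/-- The operators `f ↦ (τ_i f - f) / (x_i - 1)` on `Box n`, where `x_i` is the argument of the
`R`-matrix and `τ_i` is `reflect n i`. -/
def difference (n : ℕ) : Fin (2 * n + 1) → Module.End ℂ (Box n) :=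
  Fin.lastCases (exists_boundaryDifference (Fin.last (2 * n))).choose
    fun i => (exists_dividedDifference (castSucc_ne_succ i)).choose

lemma difference_castSucc {n : ℕ} (i : Fin (2 * n)) (f : Box n) :
    (X i.succ - X i.castSucc) * (difference n i.castSucc f).1 =
      X i.castSucc * ((reflect n i.castSucc f).1 - f.1) := by
  simp only [difference, reflect, Fin.lastCases_castSucc]
  exact (exists_dividedDifference (castSucc_ne_succ i)).choose_spec f

lemma difference_last {n : ℕ} (f : Box n) :
    (1 - X (Fin.last (2 * n)) ^ 2) * (difference n (Fin.last (2 * n)) f).1 =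
      X (Fin.last (2 * n)) ^ 2 * ((reflect n (Fin.last (2 * n)) f).1 - f.1) := by
  simp only [difference, reflect, Fin.lastCases_last]
  exact (exists_boundaryDifference (Fin.last (2 * n))).choose_spec f

/-- The generators of the Hecke algebra of type `C_r`, with eigenvalues `q` and `-q⁻¹`, in the
polynomial representation by Demazure–Lusztig operators. -/
def heckeT (n : ℕ) (q : ℂ) (i : Fin (2 * n + 1)) : Module.End ℂ (Box n) :=
  q • difference n i - q⁻¹ • (difference n i + reflect n i)

lemma eval_reflect_castSucc {n : ℕ} (i : Fin (2 * n)) (f : Box n) (v : Fin (2 * n + 1) → ℂ) :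
    eval v (reflect n i.castSucc f).1 = eval (v ∘ Equiv.swap i.castSucc i.succ) f.1 := by
  simp only [reflect, Fin.lastCases_castSucc]
  exact eval_exchange _ _ f v

lemma eval_reflect_last {n : ℕ} (f : Box n) {v : Fin (2 * n + 1) → ℂ}
    (hv : v (Fin.last (2 * n)) ≠ 0) :
    eval v (reflect n (Fin.last (2 * n)) f).1 = v (Fin.last (2 * n)) ^ (2 * n) *
      eval (Function.update v (Fin.last (2 * n)) (v (Fin.last (2 * n)))⁻¹) f.1 := by
  simp only [reflect, Fin.lastCases_last]
  simpa using eval_invert one_ne_zero hv f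

/-- The defining formula of the bulk generators, with denominators cleared. -/
lemma heckeT_castSucc {n : ℕ} (q : ℂ) (i : Fin (2 * n)) (f : Box n) :
    (X i.succ - X i.castSucc) * (heckeT n q i.castSucc f).1 =
      (C q * X i.castSucc - C q⁻¹ * X i.succ) * (reflect n i.castSucc f).1 -
        C (q - q⁻¹) * X i.castSucc * f.1 := by
  have h := difference_castSucc i f
  simp only [heckeT, LinearMap.sub_apply, LinearMap.smul_apply, LinearMap.add_apply,
    Submodule.coe_sub, Submodule.coe_smul, Submodule.coe_add, smul_eq_C_mul, C_sub]
  linear_combination (C q - C q⁻¹) * h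

/-- The defining formula of the boundary generator, with denominators cleared. -/
lemma heckeT_last {n : ℕ} (q : ℂ) (f : Box n) :
    (1 - X (Fin.last (2 * n)) ^ 2) * (heckeT n q (Fin.last (2 * n)) f).1 =
      (C q * X (Fin.last (2 * n)) ^ 2 - C q⁻¹) * (reflect n (Fin.last (2 * n)) f).1 -
        C (q - q⁻¹) * X (Fin.last (2 * n)) ^ 2 * f.1 := by
  have h := difference_last f
  simp only [heckeT, LinearMap.sub_apply, LinearMap.smul_apply, LinearMap.add_apply,
    Submodule.coe_sub, Submodule.coe_smul, Submodule.coe_add, smul_eq_C_mul, C_sub]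
  linear_combination (C q - C q⁻¹) * h

lemma eval_heckeT_castSucc {n : ℕ} (q : ℂ) (i : Fin (2 * n)) (f : Box n)
    (v : Fin (2 * n + 1) → ℂ) :
    (v i.succ - v i.castSucc) * eval v (heckeT n q i.castSucc f).1 =
      (q * v i.castSucc - q⁻¹ * v i.succ) * eval (v ∘ Equiv.swap i.castSucc i.succ) f.1 -
        (q - q⁻¹) * v i.castSucc * eval v f.1 := by
  have := congrArg (eval v) (heckeT_castSucc q i f)
  simpa [eval_reflect_castSucc] using this

lemma eval_heckeT_last {n : ℕ} (q : ℂ) (f : Box n) {v : Fin (2 * n + 1) → ℂ}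
    (hv : v (Fin.last (2 * n)) ≠ 0) :
    (1 - v (Fin.last (2 * n)) ^ 2) * eval v (heckeT n q (Fin.last (2 * n)) f).1 =
      (q * v (Fin.last (2 * n)) ^ 2 - q⁻¹) * (v (Fin.last (2 * n)) ^ (2 * n) *
        eval (Function.update v (Fin.last (2 * n)) (v (Fin.last (2 * n)))⁻¹) f.1) -
        (q - q⁻¹) * v (Fin.last (2 * n)) ^ 2 * eval v f.1 := by
  have := congrArg (eval v) (heckeT_last q f)
  simpa [eval_reflect_last f hv] using this

/-- A polynomial that vanishes wherever another nonzero polynomial does not is zero. -/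
lemma eq_zero_of_eval_eq_zero_of_ne {σ : Type} {f N : MvPolynomial σ ℂ} (hN : N ≠ 0)
    (h : ∀ v, eval v N ≠ 0 → eval v f = 0) : f = 0 := by
  have : f * N = 0 := by
    apply MvPolynomial.funext
    intro v
    rw [map_mul, map_zero]
    by_cases hv : eval v N = 0
    · rw [hv, mul_zero]
    · rw [h v hv, zero_mul]
  exact (mul_eq_zero.1 this).resolve_right hN

end
end CqKZ

namespace CqKZ
open OpenLinkPattern MvPolynomial

noncomputable section

/-! ### The Hecke relations -/

/-- The points away from the reflection hyperplanes. -/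
def IsRegular {σ : Type} (v : σ → ℂ) : Prop :=
  (∀ i, v i ≠ 0) ∧ (∀ i, v i ^ 2 ≠ 1) ∧ ∀ i j, i ≠ j → v i ≠ v j ∧ v i * v j ≠ 1

lemma ext_of_isRegular {σ : Type} [Fintype σ] [DecidableEq σ] {f g : MvPolynomial σ ℂ}
    (h : ∀ v, IsRegular v → eval v f = eval v g) : f = g := by
  rw [← sub_eq_zero]
  refine eq_zero_of_eval_eq_zero_of_ne (N := (∏ i, X i * (1 - X i ^ 2)) *
    ∏ i, ∏ j ∈ Finset.univ.erase i, (X j - X i) * (1 - X i * X j)) ?_ fun v hv => ?_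
  · refine mul_ne_zero ?_ ?_
    · exact Finset.prod_ne_zero_iff.2 fun i _ => mul_ne_zero (X_ne_zero i) (one_sub_X_sq_ne_zero i)
    · refine Finset.prod_ne_zero_iff.2 fun i _ => Finset.prod_ne_zero_iff.2 fun j hj => ?_
      refine mul_ne_zero (X_sub_X_ne_zero (Finset.mem_erase.1 hj).1.symm) fun h => ?_
      have := congrArg (eval (0 : σ → ℂ)) h
      simp at this
  · rw [map_sub, sub_eq_zero]
    simp only [map_mul, map_prod, map_sub, map_one, map_pow, eval_X, mul_ne_zero_iff,
      Finset.prod_ne_zero_iff] at hv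
    refine h v ⟨fun i => (hv.1 i (Finset.mem_univ i)).1, fun i hi => ?_, fun i j hij => ?_⟩
    · exact (hv.1 i (Finset.mem_univ i)).2 (by rw [hi, sub_self])
    · have := hv.2 i (Finset.mem_univ i) j (Finset.mem_erase.2 ⟨hij.symm, Finset.mem_univ j⟩)
      exact ⟨fun e => this.1 (by rw [e, sub_self]), fun e => this.2 (by rw [e, sub_self])⟩

/-- A bulk Demazure–Lusztig operator on functions: `s` exchanges the coordinates `a` and `b`. -/
def bulkOp {Y : Type} (q : ℂ) (a b : Y → ℂ) (s : Y → Y) (φ : Y → ℂ) (y : Y) : ℂ :=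
  ((q * a y - q⁻¹ * b y) * φ (s y) - (q - q⁻¹) * a y * φ y) / (b y - a y)

/-- The boundary Demazure–Lusztig operator on functions: `s` inverts the coordinate `b`. -/
def boundaryOp {Y : Type} (q : ℂ) (d : ℕ) (b : Y → ℂ) (s : Y → Y) (φ : Y → ℂ) (y : Y) : ℂ :=
  ((q * b y ^ 2 - q⁻¹) * (b y ^ d * φ (s y)) - (q - q⁻¹) * b y ^ 2 * φ y) / (1 - b y ^ 2)

/-- The braid relation of two bulk operators: both sides are combinations of the values of `φ` at
the six points of the orbit of `y`, with the same coefficients. -/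
lemma bulkOp_braid {Y : Type} (q : ℂ) (a b c : Y → ℂ) (s t : Y → Y) (φ : Y → ℂ) (y : Y)
    (sa : ∀ y, a (s y) = b y) (sb : ∀ y, b (s y) = a y) (sc : ∀ y, c (s y) = c y)
    (ta : ∀ y, a (t y) = a y) (tb : ∀ y, b (t y) = c y) (tc : ∀ y, c (t y) = b y)
    (ss : ∀ y, s (s y) = y) (tt : ∀ y, t (t y) = y) (st : ∀ y, s (t (s y)) = t (s (t y)))
    (hab : a y ≠ b y) (hac : a y ≠ c y) (hbc : b y ≠ c y) :
    bulkOp q a b s (bulkOp q b c t (bulkOp q a b s φ)) y =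
      bulkOp q b c t (bulkOp q a b s (bulkOp q b c t φ)) y := by
  have h1 := sub_ne_zero.2 hab
  have h2 := sub_ne_zero.2 hac
  have h3 := sub_ne_zero.2 hbc
  have h4 := sub_ne_zero.2 hab.symm
  have h5 := sub_ne_zero.2 hac.symm
  have h6 := sub_ne_zero.2 hbc.symm
  simp only [bulkOp, sa, sb, sc, ta, tb, tc, ss, tt, st]
  generalize a y = A at *
  generalize b y = B at *
  generalize c y = D at *
  generalize q⁻¹ = p
  field_simp
  ring

set_option maxRecDepth 20000 in
set_option maxHeartbeats 1600000 in
/-- The braid relation of a bulk and the boundary operator, by comparison of the coefficients of the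
values of `φ` at the eight points of the orbit of `y`. -/
lemma boundaryOp_braid {Y : Type} (q : ℂ) (d : ℕ) (a b : Y → ℂ) (s t : Y → Y) (φ : Y → ℂ) (y : Y)
    (sa : ∀ y, a (s y) = b y) (sb : ∀ y, b (s y) = a y)
    (ta : ∀ y, a (t y) = a y) (tb : ∀ y, b (t y) = (b y)⁻¹)
    (ss : ∀ y, s (s y) = y) (tt : ∀ y, t (t y) = y)
    (st : ∀ y, s (t (s (t y))) = t (s (t (s y))))
    (ha : a y ≠ 0) (hb : b y ≠ 0) (ha2 : a y ^ 2 ≠ 1) (hb2 : b y ^ 2 ≠ 1)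
    (hab : a y ≠ b y) (hab' : a y * b y ≠ 1) :
    boundaryOp q d b t (bulkOp q a b s (boundaryOp q d b t (bulkOp q a b s φ))) y =
      bulkOp q a b s (boundaryOp q d b t (bulkOp q a b s (boundaryOp q d b t φ))) y := by
  have h1 := sub_ne_zero.2 hab
  have h2 := sub_ne_zero.2 hab.symm
  have h3 := sub_ne_zero.2 hab'
  have h4 := sub_ne_zero.2 hab'.symm
  have h5 := sub_ne_zero.2 ha2.symm
  have h6 := sub_ne_zero.2 hb2.symm
  have h7 := sub_ne_zero.2 ha2
  have h8 := sub_ne_zero.2 hb2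
  simp only [boundaryOp, bulkOp, sa, sb, ta, tb, ss, tt, st, inv_pow]
  have hA := pow_ne_zero d ha
  have hB := pow_ne_zero d hb
  generalize a y ^ d = AA at *
  generalize b y ^ d = BB at *
  generalize a y = A at *
  generalize b y = B at *
  generalize q⁻¹ = p
  generalize φ y = f1
  generalize φ (s y) = f2
  generalize φ (t y) = f3
  generalize φ (s (t y)) = f4
  generalize φ (t (s y)) = f5
  generalize φ (s (t (s y))) = f6
  generalize φ (t (s (t y))) = f7
  generalize φ (t (s (t (s y)))) = f8
  -- up to powers of `A` and `B`, the denominators are products of `D`, `U`, `V`, `W`, which are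
  -- atoms until the fractions have been cleared
  obtain ⟨D, hD⟩ : ∃ D, D = 1 - A * B := ⟨_, rfl⟩
  obtain ⟨U, hU⟩ : ∃ U, U = 1 - A ^ 2 := ⟨_, rfl⟩
  obtain ⟨V, hV⟩ : ∃ V, V = 1 - B ^ 2 := ⟨_, rfl⟩
  obtain ⟨W, hW⟩ : ∃ W, W = A - B := ⟨_, rfl⟩
  have r1 : B⁻¹ - A = D / B := by rw [hD]; field_simp
  have r2 : A⁻¹ - B = D / A := by rw [hD]; field_simp
  have r4 : A - B⁻¹ = -D / B := by rw [hD]; field_simp; ring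
  have r5 : 1 - (A ^ 2)⁻¹ = -U / A ^ 2 := by rw [hU]; field_simp; ring
  have r6 : 1 - (B ^ 2)⁻¹ = -V / B ^ 2 := by rw [hV]; field_simp; ring
  have r8 : A⁻¹ - B⁻¹ = -W / (A * B) := by rw [hW]; field_simp; ring
  have r9 : B - A = -W := by rw [hW]; ring
  rw [← hW] at h1
  rw [← hD] at h4
  rw [← hU] at h5
  rw [← hV] at h6
  simp only [r1, r2, r4, r5, r6, r8, r9, ← hU, ← hV, ← hW]
  clear r1 r2 r4 r5 r6 r8 r9 h2 h3 h7 h8 hab hab' ha2 hb2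
  field_simp
  rw [hD, hU, hV, hW]
  ring

end
end CqKZ

namespace CqKZ
open OpenLinkPattern MvPolynomial

noncomputable section

/-- The regular points of the torus of spectral parameters. -/
abbrev RegularPoint (n : ℕ) : Type := {v : Fin (2 * n + 1) → ℂ // IsRegular v}

lemma IsRegular.comp_perm {σ : Type} {v : σ → ℂ} (hv : IsRegular v) (e : Equiv.Perm σ) :
    IsRegular (v ∘ e) :=
  ⟨fun _ => hv.1 _, fun _ => hv.2.1 _, fun _ _ hij => hv.2.2 _ _ (e.injective.ne hij)⟩

lemma IsRegular.update_inv {σ : Type} [DecidableEq σ] {v : σ → ℂ} (hv : IsRegular v) (k : σ) :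
    IsRegular (Function.update v k (v k)⁻¹) := by
  have h : ∀ j, j ≠ k → (v k)⁻¹ ≠ v j ∧ (v k)⁻¹ * v j ≠ 1 := by
    intro j hj
    have h1 := hv.2.2 k j hj.symm
    have h0 := hv.1 k
    constructor
    · intro e; apply h1.2; rw [← e]; exact mul_inv_cancel₀ h0
    · intro e; apply h1.1; field_simp at e; exact e.symm
  refine ⟨fun i => ?_, fun i => ?_, fun i j hij => ?_⟩
  · by_cases hi : i = k
    · subst hi; simpa using hv.1 i
    · simpa [Function.update_of_ne hi] using hv.1 i
  · by_cases hi : i = k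
    · subst hi
      rw [Function.update_self, inv_pow]
      simpa using hv.2.1 i
    · simpa [Function.update_of_ne hi] using hv.2.1 i
  · by_cases hi : i = k
    · subst hi
      rw [Function.update_self, Function.update_of_ne hij.symm]
      exact h j hij.symm
    · by_cases hj : j = k
      · subst hj
        rw [Function.update_self, Function.update_of_ne hi]
        exact ⟨(h i hi).1.symm, by rw [mul_comm]; exact (h i hi).2⟩
      · rw [Function.update_of_ne hi, Function.update_of_ne hj]
        exact hv.2.2 i j hij

/-- Exchange of two coordinates of a regular point. -/
def RegularPoint.swap {n : ℕ} (i j : Fin (2 * n + 1)) (y : RegularPoint n) : RegularPoint n :=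
  ⟨y.1 ∘ Equiv.swap i j, y.2.comp_perm _⟩

/-- Inversion of the last coordinate of a regular point. -/
def RegularPoint.flip {n : ℕ} (y : RegularPoint n) : RegularPoint n :=
  ⟨Function.update y.1 (Fin.last (2 * n)) (y.1 (Fin.last (2 * n)))⁻¹, y.2.update_inv _⟩

/-- The values of an element of `Box n` at the regular points. -/
def values {n : ℕ} (f : Box n) (y : RegularPoint n) : ℂ := eval y.1 f.1

lemma values_injective {n : ℕ} : Function.Injective (values (n := n)) := by
  intro f g h
  exact Subtype.ext (ext_of_isRegular fun v hv => congrFun h ⟨v, hv⟩)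

lemma values_heckeT_castSucc {n : ℕ} (q : ℂ) (i : Fin (2 * n)) (f : Box n) :
    values (heckeT n q i.castSucc f) =
      bulkOp q (fun y : RegularPoint n => y.1 i.castSucc) (fun y => y.1 i.succ)
        (RegularPoint.swap i.castSucc i.succ) (values f) := by
  funext y
  have h : y.1 i.succ - y.1 i.castSucc ≠ 0 :=
    sub_ne_zero.2 (y.2.2.2 _ _ (castSucc_ne_succ i)).1.symm
  rw [bulkOp, eq_div_iff h, mul_comm]
  exact eval_heckeT_castSucc q i f y.1

lemma values_heckeT_last {n : ℕ} (q : ℂ) (f : Box n) :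
    values (heckeT n q (Fin.last (2 * n)) f) =
      boundaryOp q (2 * n) (fun y : RegularPoint n => y.1 (Fin.last (2 * n)))
        RegularPoint.flip (values f) := by
  funext y
  have h : 1 - y.1 (Fin.last (2 * n)) ^ 2 ≠ 0 := sub_ne_zero.2 (y.2.2.1 _).symm
  rw [boundaryOp, eq_div_iff h, mul_comm]
  exact eval_heckeT_last q f (y.2.1 _)

lemma heckeT_braid {n : ℕ} (q : ℂ) (i j : Fin (2 * n)) (hij : j.val = i.val + 1) :
    heckeT n q i.castSucc * heckeT n q j.castSucc * heckeT n q i.castSucc =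
      heckeT n q j.castSucc * heckeT n q i.castSucc * heckeT n q j.castSucc := by
  have e : j.castSucc = i.succ := by ext; simp [hij]
  have n1 : i.castSucc ≠ i.succ := castSucc_ne_succ i
  have n2 : i.succ ≠ j.succ := e ▸ castSucc_ne_succ j
  have n3 : i.castSucc ≠ j.succ := by
    intro h
    have := congrArg Fin.val h
    simp [hij] at this
    omega
  have sw : ∀ y : RegularPoint n, RegularPoint.swap i.castSucc i.succ
      (RegularPoint.swap i.succ j.succ (RegularPoint.swap i.castSucc i.succ y)) =
      RegularPoint.swap i.succ j.succ (RegularPoint.swap i.castSucc i.succ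
        (RegularPoint.swap i.succ j.succ y)) := by
    intro y
    apply Subtype.ext
    have key : Equiv.swap i.castSucc i.succ * Equiv.swap i.succ j.succ *
        Equiv.swap i.castSucc i.succ =
        Equiv.swap i.succ j.succ * Equiv.swap i.castSucc i.succ * Equiv.swap i.succ j.succ := by
      have h1 := Equiv.swap_mul_swap_mul_swap (x := j.succ) (y := i.succ) (z := i.castSucc)
        n2.symm n3.symm
      have h2 := Equiv.swap_mul_swap_mul_swap (x := i.castSucc) (y := i.succ) (z := j.succ) n1 n3
      rw [h2, Equiv.swap_comm i.castSucc i.succ, Equiv.swap_comm i.succ j.succ, h1,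
        Equiv.swap_comm]
    funext x
    exact congrArg y.1 (DFunLike.congr_fun key x)
  refine LinearMap.ext fun f => values_injective ?_
  funext y
  simp only [Module.End.mul_apply, values_heckeT_castSucc]
  simp only [e]
  have h1 := (y.2.2.2 _ _ n1).1
  have h2 := (y.2.2.2 _ _ n2).1
  have h3 := (y.2.2.2 _ _ n3).1
  refine bulkOp_braid q (fun y : RegularPoint n => y.1 i.castSucc) (fun y => y.1 i.succ)
    (fun y => y.1 j.succ) (RegularPoint.swap i.castSucc i.succ) (RegularPoint.swap i.succ j.succ)
    (values f) y ?_ ?_ ?_ ?_ ?_ ?_ ?_ ?_ sw h1 h3 h2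
  · intro y; simp [RegularPoint.swap]
  · intro y; simp [RegularPoint.swap]
  · intro y; simp [RegularPoint.swap, Equiv.swap_apply_of_ne_of_ne n3.symm n2.symm]
  · intro y; simp [RegularPoint.swap, Equiv.swap_apply_of_ne_of_ne n1 n3]
  · intro y; simp [RegularPoint.swap]
  · intro y; simp [RegularPoint.swap]
  · intro y; apply Subtype.ext; funext x; simp [RegularPoint.swap]
  · intro y; apply Subtype.ext; funext x; simp [RegularPoint.swap]

lemma heckeT_braid_last {n : ℕ} (q : ℂ) (i : Fin (2 * n)) (hi : i.val + 1 = 2 * n) :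
    heckeT n q (Fin.last (2 * n)) * heckeT n q i.castSucc * heckeT n q (Fin.last (2 * n)) *
        heckeT n q i.castSucc =
      heckeT n q i.castSucc * heckeT n q (Fin.last (2 * n)) * heckeT n q i.castSucc *
        heckeT n q (Fin.last (2 * n)) := by
  have e : Fin.last (2 * n) = i.succ := by ext; simp [hi]
  have n1 : i.castSucc ≠ i.succ := castSucc_ne_succ i
  have st : ∀ y : RegularPoint n, RegularPoint.swap i.castSucc i.succ
      (RegularPoint.flip (RegularPoint.swap i.castSucc i.succ (RegularPoint.flip y))) =
      RegularPoint.flip (RegularPoint.swap i.castSucc i.succ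
        (RegularPoint.flip (RegularPoint.swap i.castSucc i.succ y))) := by
    intro y
    apply Subtype.ext
    simp only [RegularPoint.swap, RegularPoint.flip, e]
    funext x
    simp only [Function.comp_apply, Function.update_apply, Equiv.swap_apply_def]
    split_ifs <;> simp_all
  refine LinearMap.ext fun f => values_injective ?_
  funext y
  simp only [Module.End.mul_apply, values_heckeT_castSucc, values_heckeT_last]
  simp only [e]
  refine boundaryOp_braid q _ _ _ _ _ _ y ?_ ?_ ?_ ?_ ?_ ?_ st (y.2.1 _) (y.2.1 _)
    (y.2.2.1 _) (y.2.2.1 _) (y.2.2.2 _ _ n1).1 (y.2.2.2 _ _ n1).2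
  · intro y; simp [RegularPoint.swap]
  · intro y; simp [RegularPoint.swap]
  · intro y; simp [RegularPoint.flip, e, n1]
  · intro y; simp [RegularPoint.flip, e]
  · intro y; apply Subtype.ext; funext x; simp [RegularPoint.swap]
  · intro y; apply Subtype.ext; simp [RegularPoint.flip]

lemma heckeT_comm {n : ℕ} (q : ℂ) (i j : Fin (2 * n)) (hij : i.val + 1 < j.val) :
    heckeT n q i.castSucc * heckeT n q j.castSucc =
      heckeT n q j.castSucc * heckeT n q i.castSucc := by
  have n1 : i.castSucc ≠ j.castSucc := by intro h; have := congrArg Fin.val h; simp at this; omega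
  have n2 : i.castSucc ≠ j.succ := by intro h; have := congrArg Fin.val h; simp at this; omega
  have n3 : i.succ ≠ j.castSucc := by intro h; have := congrArg Fin.val h; simp at this; omega
  have n4 : i.succ ≠ j.succ := by intro h; have := congrArg Fin.val h; simp at this; omega
  refine LinearMap.ext fun f => values_injective ?_
  funext y
  simp only [Module.End.mul_apply, values_heckeT_castSucc]
  have st : RegularPoint.swap j.castSucc j.succ (RegularPoint.swap i.castSucc i.succ y) =
      RegularPoint.swap i.castSucc i.succ (RegularPoint.swap j.castSucc j.succ y) := by
    apply Subtype.ext
    simp only [RegularPoint.swap]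
    funext x
    simp only [Function.comp_apply]
    simp only [Equiv.swap_apply_def]
    split_ifs <;> simp_all
  have e1 : ((RegularPoint.swap i.castSucc i.succ y).1 j.castSucc) = y.1 j.castSucc := by
    simp [RegularPoint.swap, Equiv.swap_apply_of_ne_of_ne n1.symm n3.symm]
  have e2 : ((RegularPoint.swap i.castSucc i.succ y).1 j.succ) = y.1 j.succ := by
    simp [RegularPoint.swap, Equiv.swap_apply_of_ne_of_ne n2.symm n4.symm]
  have e3 : ((RegularPoint.swap j.castSucc j.succ y).1 i.castSucc) = y.1 i.castSucc := by
    simp [RegularPoint.swap, Equiv.swap_apply_of_ne_of_ne n1 n2]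
  have e4 : ((RegularPoint.swap j.castSucc j.succ y).1 i.succ) = y.1 i.succ := by
    simp [RegularPoint.swap, Equiv.swap_apply_of_ne_of_ne n3 n4]
  simp only [bulkOp, e1, e2, e3, e4, st]
  have h1 := sub_ne_zero.2 (y.2.2.2 _ _ (castSucc_ne_succ i)).1.symm
  have h2 := sub_ne_zero.2 (y.2.2.2 _ _ (castSucc_ne_succ j)).1.symm
  field_simp
  ring

lemma heckeT_comm_last {n : ℕ} (q : ℂ) (i : Fin (2 * n)) (hi : i.val + 1 < 2 * n) :
    heckeT n q i.castSucc * heckeT n q (Fin.last (2 * n)) =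
      heckeT n q (Fin.last (2 * n)) * heckeT n q i.castSucc := by
  have n1 : i.castSucc ≠ Fin.last (2 * n) := by
    intro h; have := congrArg Fin.val h; simp at this; omega
  have n2 : i.succ ≠ Fin.last (2 * n) := by
    intro h; have := congrArg Fin.val h; simp at this; omega
  refine LinearMap.ext fun f => values_injective ?_
  funext y
  simp only [Module.End.mul_apply, values_heckeT_castSucc, values_heckeT_last]
  have st : RegularPoint.flip (RegularPoint.swap i.castSucc i.succ y) =
      RegularPoint.swap i.castSucc i.succ (RegularPoint.flip y) := by
    apply Subtype.ext
    simp only [RegularPoint.swap, RegularPoint.flip]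
    funext x
    simp only [Function.comp_apply, Function.update_apply, Equiv.swap_apply_def]
    split_ifs <;> simp_all
  have e1 : ((RegularPoint.swap i.castSucc i.succ y).1 (Fin.last (2 * n))) =
      y.1 (Fin.last (2 * n)) := by
    simp [RegularPoint.swap, Equiv.swap_apply_of_ne_of_ne n1.symm n2.symm]
  have e3 : ((RegularPoint.flip y).1 i.castSucc) = y.1 i.castSucc := by
    simp [RegularPoint.flip]
  have e4 : ((RegularPoint.flip y).1 i.succ) = y.1 i.succ := by
    simp [RegularPoint.flip, Function.update_of_ne n2]
  simp only [bulkOp, boundaryOp, e1, e3, e4, st]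
  have h1 := sub_ne_zero.2 (y.2.2.2 _ _ (castSucc_ne_succ i)).1.symm
  have h2 := sub_ne_zero.2 (y.2.2.1 (Fin.last (2 * n))).symm
  field_simp
  ring

lemma heckeT_sq_castSucc {n : ℕ} {q : ℂ} (hq : q ≠ 0) (i : Fin (2 * n)) :
    heckeT n q i.castSucc * heckeT n q i.castSucc = (q - q⁻¹) • heckeT n q i.castSucc + 1 := by
  refine LinearMap.ext fun f => values_injective ?_
  funext y
  have h0 : values ((((q - q⁻¹) • heckeT n q i.castSucc + 1 : Module.End ℂ (Box n))) f) y =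
      (q - q⁻¹) * values (heckeT n q i.castSucc f) y + values f y := by
    simp [values, smul_eq_C_mul]
  rw [h0]
  simp only [Module.End.mul_apply, values_heckeT_castSucc]
  have ss : RegularPoint.swap i.castSucc i.succ (RegularPoint.swap i.castSucc i.succ y) = y := by
    apply Subtype.ext; funext x; simp [RegularPoint.swap]
  have e1 : ((RegularPoint.swap i.castSucc i.succ y).1 i.castSucc) = y.1 i.succ := by
    simp [RegularPoint.swap]
  have e2 : ((RegularPoint.swap i.castSucc i.succ y).1 i.succ) = y.1 i.castSucc := by
    simp [RegularPoint.swap]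
  simp only [bulkOp, e1, e2, ss]
  have h1 := sub_ne_zero.2 (y.2.2.2 _ _ (castSucc_ne_succ i)).1.symm
  have h2 := sub_ne_zero.2 (y.2.2.2 _ _ (castSucc_ne_succ i)).1
  field_simp
  ring

lemma heckeT_sq_last {n : ℕ} {q : ℂ} (hq : q ≠ 0) :
    heckeT n q (Fin.last (2 * n)) * heckeT n q (Fin.last (2 * n)) =
      (q - q⁻¹) • heckeT n q (Fin.last (2 * n)) + 1 := by
  refine LinearMap.ext fun f => values_injective ?_
  funext y
  have h0 : values ((((q - q⁻¹) • heckeT n q (Fin.last (2 * n)) + 1 : Module.End ℂ (Box n))) f) y =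
      (q - q⁻¹) * values (heckeT n q (Fin.last (2 * n)) f) y + values f y := by
    simp [values, smul_eq_C_mul]
  rw [h0]
  simp only [Module.End.mul_apply, values_heckeT_last]
  have ss : RegularPoint.flip (RegularPoint.flip y) = y := by
    apply Subtype.ext; simp [RegularPoint.flip]
  have e1 : ((RegularPoint.flip y).1 (Fin.last (2 * n))) = (y.1 (Fin.last (2 * n)))⁻¹ := by
    simp [RegularPoint.flip]
  simp only [boundaryOp, e1, ss, inv_pow]
  have h0 := y.2.1 (Fin.last (2 * n))
  have h1 := sub_ne_zero.2 (y.2.2.1 (Fin.last (2 * n)))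
  have h2 := sub_ne_zero.2 (y.2.2.1 (Fin.last (2 * n))).symm
  have hB := pow_ne_zero (2 * n) h0
  generalize y.1 (Fin.last (2 * n)) ^ (2 * n) = BB at *
  generalize y.1 (Fin.last (2 * n)) = B at *
  have r : 1 - (B ^ 2)⁻¹ = -(1 - B ^ 2) / B ^ 2 := by field_simp; ring
  rw [r]
  field_simp
  ring

end
end CqKZ

namespace CqKZ
open OpenLinkPattern MvPolynomial

noncomputable section

/-! ### Vectors of spin chain type in a Hecke module -/

section SpinVectors

variable {M : Type} [AddCommGroup M] [Module ℂ M]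

/-- Operators `T 0, …, T (N - 1), B` satisfying the braid relations of type `C`; the quadratic
relations are not required. -/
structure TypeCBraid (N : ℕ) (T : ℕ → Module.End ℂ M) (B : Module.End ℂ M) : Prop where
  comm : ∀ i j, i + 1 < j → j < N → T i * T j = T j * T i
  comm_last : ∀ i, i + 1 < N → T i * B = B * T i
  braid : ∀ i, i + 1 < N → T i * T (i + 1) * T i = T (i + 1) * T i * T (i + 1)
  braid_last : ∀ i, i + 1 = N → B * T i * B * T i = T i * B * T i * B

/-- `lowering N T B k = T_k T_{k+1} ⋯ T_{N-1} B`: it creates a down spin at the last site, and moves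
it to site `k`. -/
def lowering (N : ℕ) (T : ℕ → Module.End ℂ M) (B : Module.End ℂ M) (k : ℕ) : Module.End ℂ M :=
  Nat.rec B (fun j D => T (N - 1 - j) * D) (N - k)

/-- The sites from `0` to `k - 1` are set to the spins `ε` (`true` is up), from the left to the
right, starting with all spins up. -/
def spinPrefix (N : ℕ) (T : ℕ → Module.End ℂ M) (B : Module.End ℂ M) (v : M) (ε : ℕ → Bool) :
    ℕ → M
  | 0 => v
  | k + 1 => if ε k then spinPrefix N T B v ε k else lowering N T B k (spinPrefix N T B v ε k)

variable {N : ℕ} {T : ℕ → Module.End ℂ M} {B : Module.End ℂ M}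

lemma lowering_last : lowering N T B N = B := by
  simp [lowering]

lemma lowering_of_lt {k : ℕ} (hk : k < N) :
    lowering N T B k = T k * lowering N T B (k + 1) := by
  obtain ⟨j, rfl⟩ := Nat.exists_eq_add_of_lt hk
  simp only [lowering]
  rw [show k + j + 1 - k = j + 1 by omega, show k + j + 1 - (k + 1) = j by omega]
  simp only
  rw [show k + j + 1 - 1 - j = k by omega]

lemma TypeCBraid.comm_lowering (h : TypeCBraid N T B) {i a : ℕ} (hia : i + 1 < a) (ha : a ≤ N) :
    T i * lowering N T B a = lowering N T B a * T i := by
  induction ha using Nat.decreasingInduction with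
  | self => rw [lowering_last, h.comm_last i hia]
  | of_succ a ha ih =>
    rw [lowering_of_lt ha, ← mul_assoc, h.comm i a hia ha, mul_assoc, ih (by omega), mul_assoc]

/-- A generator to the right of the site `a` is shifted by one place to the left when it passes
`lowering N T B a`. -/
lemma TypeCBraid.shift_lowering (h : TypeCBraid N T B) {i a : ℕ} (hai : a ≤ i) (hi : i + 1 < N) :
    T (i + 1) * lowering N T B a = lowering N T B a * T i := by
  induction hai using Nat.decreasingInduction with
  | self =>
    rw [lowering_of_lt (show i < N by omega), lowering_of_lt hi,
      ← mul_assoc, ← mul_assoc, ← h.braid i hi, mul_assoc, h.comm_lowering (by omega) (by omega)]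
    simp only [mul_assoc]
  | of_succ a ha ih =>
    rw [lowering_of_lt (show a < N by omega), ← mul_assoc, ← h.comm a (i + 1) (by omega) hi,
      mul_assoc, ih, mul_assoc]

/-- After `lowering N T B a`, a second down spin may be created at the site `a` instead of `a + 1`,
up to a generator at the right end of the chain. The boundary braid relation is the case
`a = N - 1`. -/
lemma TypeCBraid.lowering_mul_lowering (h : TypeCBraid N T B) {a : ℕ} (ha : a + 1 ≤ N) :
    lowering N T B a * lowering N T B a =
      lowering N T B (a + 1) * lowering N T B a * T (N - 1) := by
  obtain ⟨m, rfl⟩ : ∃ m, N = m + 1 := ⟨N - 1, by omega⟩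
  have ha' : a ≤ m := by omega
  clear ha
  rw [Nat.add_sub_cancel]
  induction ha' using Nat.decreasingInduction with
  | self =>
    rw [lowering_of_lt (Nat.lt_succ_self m), lowering_last, ← mul_assoc, ← mul_assoc,
      h.braid_last m rfl]
  | of_succ a ha ih =>
    have h1 := lowering_of_lt (T := T) (B := B) (show a < m + 1 by omega)
    have h2 := lowering_of_lt (T := T) (B := B) (show a + 1 < m + 1 by omega)
    have h3 := h.comm_lowering (i := a) (a := a + 2) (by omega) (by omega)
    have h4 := h.braid a (by omega)
    generalize lowering (m + 1) T B a = D0 at *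
    generalize lowering (m + 1) T B (a + 1) = D1 at *
    generalize lowering (m + 1) T B (a + 2) = D2 at *
    calc D0 * D0 = T a * T (a + 1) * (D2 * T a) * D1 := by
          rw [h1]; nth_rewrite 1 [h2]; simp only [mul_assoc]
      _ = (T a * T (a + 1) * T a) * D2 * D1 := by rw [← h3]; simp only [mul_assoc]
      _ = T (a + 1) * T a * (D1 * D1) := by rw [h4]; nth_rewrite 2 [h2]; simp only [mul_assoc]
      _ = T (a + 1) * (T a * D2) * D1 * T m := by rw [ih]; simp only [mul_assoc]
      _ = D1 * D0 * T m := by rw [h3, h1]; nth_rewrite 2 [h2]; simp only [mul_assoc]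

lemma spinPrefix_congr {v : M} {ε ε' : ℕ → Bool} {k : ℕ} (h : ∀ i, i < k → ε i = ε' i) :
    spinPrefix N T B v ε k = spinPrefix N T B v ε' k := by
  induction k with
  | zero => rfl
  | succ k ih =>
    rw [spinPrefix, spinPrefix, h k (Nat.lt_succ_self k),
      ih fun i hi => h i (hi.trans k.lt_succ_self)]

variable {v : M} {q : ℂ}

/-- The sites from `k` on carry up spins, and there `T i` acts as on `v`. -/
lemma TypeCBraid.apply_spinPrefix (h : TypeCBraid N T B) (hv : ∀ i, i < N → T i v = q • v)
    (ε : ℕ → Bool) {k : ℕ} : ∀ {i : ℕ}, k ≤ i → i < N →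
      T i (spinPrefix N T B v ε k) = q • spinPrefix N T B v ε k := by
  induction k with
  | zero => exact fun _ hi => hv _ hi
  | succ k ih =>
    intro i hki hi
    rw [spinPrefix]
    split_ifs
    · exact ih (by omega) hi
    · obtain ⟨j, rfl⟩ : ∃ j, i = j + 1 := ⟨i - 1, by omega⟩
      rw [← Module.End.mul_apply, h.shift_lowering (by omega) hi, Module.End.mul_apply,
        ih (by omega) (by omega), map_smul]

/-- Once sites `i` and `i + 1` are set, `T i` commutes with setting the sites on their right. -/
lemma TypeCBraid.apply_spinPrefix_of_le (h : TypeCBraid N T B) {ε ε' : ℕ → Bool} {c : ℂ} {i : ℕ}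
    (hε : ∀ j, i + 2 ≤ j → ε j = ε' j)
    (h0 : T i (spinPrefix N T B v ε (i + 2)) = c • spinPrefix N T B v ε' (i + 2)) {m : ℕ}
    (hm : i + 2 ≤ m) (hmN : m ≤ N + 1) :
    T i (spinPrefix N T B v ε m) = c • spinPrefix N T B v ε' m := by
  induction m, hm using Nat.le_induction with
  | base => exact h0
  | succ m hm ih =>
    have ih := ih (by omega)
    rw [spinPrefix, spinPrefix, ← hε m hm]
    split_ifs
    · exact ih
    · rw [← Module.End.mul_apply, h.comm_lowering (by omega) (by omega), Module.End.mul_apply, ih,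
        map_smul]

/-- On two equal neighbouring spins `T i` acts by `q`. For two down spins, it passes both lowering
operators and reaches `v` at the right end of the chain, by `TypeCBraid.lowering_mul_lowering`. -/
lemma TypeCBraid.apply_spin_of_eq (h : TypeCBraid N T B) (hv : ∀ i, i < N → T i v = q • v)
    (ε : ℕ → Bool) {i : ℕ} (hi : i < N) (hε : ε i = ε (i + 1)) :
    T i (spinPrefix N T B v ε (N + 1)) = q • spinPrefix N T B v ε (N + 1) := by
  refine h.apply_spinPrefix_of_le (fun _ _ => rfl) ?_ (by omega) le_rfl
  have h0 := fun {j} => h.apply_spinPrefix hv ε (k := i) (i := j)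
  rw [spinPrefix, spinPrefix, ← hε]
  cases ε i
  · simp only [Bool.false_eq_true, if_false]
    have h1 : T i * lowering N T B (i + 1) * lowering N T B i =
        lowering N T B (i + 1) * lowering N T B i * T (N - 1) := by
      rw [← lowering_of_lt hi, h.lowering_mul_lowering hi]
    rw [← Module.End.mul_apply, ← Module.End.mul_apply, h1, Module.End.mul_apply,
      h0 (by omega) (by omega), map_smul, Module.End.mul_apply]
  · simpa using h0 le_rfl hi

/-- `T i` moves a down spin from site `i + 1` to site `i`. -/
lemma TypeCBraid.apply_spin_of_ne (h : TypeCBraid N T B)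
    {ε ε' : ℕ → Bool} {i : ℕ} (hi : i < N) (h1 : ε i = true) (h2 : ε (i + 1) = false)
    (h1' : ε' i = false) (h2' : ε' (i + 1) = true) (hε : ∀ j, j ≠ i → j ≠ i + 1 → ε j = ε' j) :
    T i (spinPrefix N T B v ε (N + 1)) = spinPrefix N T B v ε' (N + 1) := by
  have := h.apply_spinPrefix_of_le (v := v) (c := 1) (i := i) (ε := ε) (ε' := ε')
    (fun j hj => hε j (by omega) (by omega)) ?_ (show i + 2 ≤ N + 1 by omega) le_rfl
  · simpa using this
  · simp only [spinPrefix, h1, h2, h1', h2', if_true, Bool.false_eq_true, if_false, one_smul]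
    rw [← Module.End.mul_apply, ← lowering_of_lt hi,
      spinPrefix_congr fun j hj => hε j (by omega) (by omega)]

/-- The boundary operator turns an up spin at the last site into a down spin. -/
lemma apply_spin_last {ε ε' : ℕ → Bool} (h1 : ε N = true) (h1' : ε' N = false)
    (hε : ∀ j, j < N → ε j = ε' j) :
    B (spinPrefix N T B v ε (N + 1)) = spinPrefix N T B v ε' (N + 1) := by
  simp only [spinPrefix, h1, h1', if_true, Bool.false_eq_true, if_false, lowering_last]
  rw [spinPrefix_congr hε]

end SpinVectors

end
end CqKZ

namespace CqKZ
open OpenLinkPattern MvPolynomial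

noncomputable section

/-! ### Link patterns in the spin chain -/

section Patterns

variable {r : ℕ} (π : OpenLinkPattern r)

lemma pattern_invol (x : Fin r) : π.1 (π.1 x) = x := π.2.1 x

lemma pattern_nested {a c : Fin r} (h1 : a < c) (h2 : c < π.1 a) :
    π.1 c ≠ c ∧ a < π.1 c ∧ π.1 c < π.1 a := π.2.2 a c h1 h2

/-- The ends of a closed arch have opposite parities: the points strictly below the arch are matched
among themselves, so that their number is even. -/
lemma odd_add_partner {a : Fin r} (ha : π.1 a ≠ a) : Odd (a.val + (π.1 a).val) := by
  have key : ∀ a : Fin r, a < π.1 a → Odd (a.val + (π.1 a).val) := by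
    intro a ha
    have h : ∏ _x ∈ Finset.Ioo a (π.1 a), (-1 : ℤ) = 1 := by
      refine Finset.prod_involution (fun x _ => π.1 x) (fun _ _ => by norm_num) ?_ ?_ ?_
      · intro x hx _
        rw [Finset.mem_Ioo] at hx
        exact (pattern_nested π hx.1 hx.2).1
      · intro x hx
        rw [Finset.mem_Ioo] at hx ⊢
        exact (pattern_nested π hx.1 hx.2).2
      · intro x _
        exact pattern_invol π x
    rw [Finset.prod_const, neg_one_pow_eq_one_iff_even (by norm_num), Fin.card_Ioo] at h
    obtain ⟨k, hk⟩ := h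
    have : a.val < (π.1 a).val := ha
    exact ⟨a.val + k, by omega⟩
  rcases lt_or_gt_of_ne ha with h | h
  · have := key (π.1 a) (by rwa [pattern_invol])
    rwa [pattern_invol, add_comm] at this
  · exact key a h

lemma even_iff_of_partner {a : Fin r} (ha : π.1 a ≠ a) : Even (π.1 a).val ↔ ¬ Even a.val := by
  have := odd_add_partner π ha
  rw [Nat.odd_add] at this
  rw [← this, Nat.not_even_iff_odd]

end Patterns

/-- Spin configurations on the `2 n + 1` sites; `true` is an up spin. -/
abbrev Spin (n : ℕ) : Type := Fin (2 * n + 1) → Bool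

/-- The two components of the singlet vector `κ |↑↓⟩ - κ⁻¹ |↓↑⟩`, by the left spin. -/
def spinSign (κ : ℂ) (b : Bool) : ℂ := if b then κ else -κ⁻¹

/-- The weight of the point `x` in the spin vector of a link pattern: a closed arch is a singlet
(its weight is put on the left end), an open arch is one of two vectors, according to the parity
of its position. -/
def siteWeight {n : ℕ} (κ : ℂ) (ε : Spin n) (π : OpenLinkPattern (2 * n + 1))
    (x : Fin (2 * n + 1)) : ℂ :=
  if π.1 x = x then (if Even x.val then 1 else spinSign κ (!ε x))
  else if x < π.1 x then (if ε x = ε (π.1 x) then 0 else spinSign κ (ε x))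
  else 1

/-- The spin vector of a link pattern. -/
def spinVec {n : ℕ} (κ : ℂ) (π : OpenLinkPattern (2 * n + 1)) (ε : Spin n) : ℂ :=
  ∏ x, siteWeight κ ε π x

section Weights

variable {n : ℕ} {κ : ℂ} {ε : Spin n} {π : OpenLinkPattern (2 * n + 1)} {x y : Fin (2 * n + 1)}

lemma siteWeight_open (h : π.1 x = x) :
    siteWeight κ ε π x = if Even x.val then 1 else spinSign κ (!ε x) := if_pos h

lemma siteWeight_left (h : π.1 x = y) (hxy : x < y) :
    siteWeight κ ε π x = if ε x = ε y then 0 else spinSign κ (ε x) := by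
  subst h
  rw [siteWeight, if_neg hxy.ne', if_pos hxy]

lemma siteWeight_right (h : π.1 x = y) (hxy : y < x) : siteWeight κ ε π x = 1 := by
  subst h
  rw [siteWeight, if_neg hxy.ne, if_neg hxy.not_gt]

lemma spinVec_eq_mul (T : Finset (Fin (2 * n + 1))) :
    spinVec κ π ε = (∏ x ∈ T, siteWeight κ ε π x) * ∏ x ∈ Tᶜ, siteWeight κ ε π x :=
  (Finset.prod_mul_prod_compl T _).symm

/-- The action of a Temperley–Lieb generator on the spin chain. -/
def bulkSpin {M : Type} [AddCommGroup M] [Module ℂ M] (κ : ℂ) (i j : Fin (2 * n + 1))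
    (G : Spin n → M) (ε : Spin n) : M :=
  if ε i = ε j then 0 else
    -(spinSign κ (ε i) • (spinSign κ (ε i) • G ε + spinSign κ (!ε i) • G (ε ∘ Equiv.swap i j)))

/-- The action of the boundary generator on the last site of the spin chain. -/
def lastSpin {M : Type} [AddCommGroup M] [Module ℂ M] (q : ℂ)
    (G : Spin n → M) (ε : Spin n) : M :=
  -(q • G (Function.update ε (Fin.last (2 * n)) true) +
    q⁻¹ • G (Function.update ε (Fin.last (2 * n)) false))

section Join

variable {r : ℕ} {π : OpenLinkPattern r} {i j x : Fin r} (hij : j.val = i.val + 1)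

lemma join_left : (π.join i j hij).1 i = j := by simp [join, joinFun]

lemma join_right : (π.join i j hij).1 j = i := by
  have : j ≠ i := by intro h; rw [h] at hij; omega
  simp [join, joinFun, this]

lemma join_partner_left (h1 : x ≠ i) (h2 : x ≠ j) (h : π.1 x = i) :
    (π.join i j hij).1 x = if π.1 j = j then x else π.1 j := by
  simp [join, joinFun, h1, h2, h]

lemma join_partner_right (h1 : x ≠ i) (h2 : x ≠ j) (h : π.1 x = j) :
    (π.join i j hij).1 x = if π.1 i = i then x else π.1 i := by
  have : j ≠ i := by intro h; rw [h] at hij; omega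
  simp [join, joinFun, h1, h2, h, this]

lemma join_other (h1 : x ≠ i) (h2 : x ≠ j) (h3 : π.1 x ≠ i) (h4 : π.1 x ≠ j) :
    (π.join i j hij).1 x = π.1 x := by
  simp [join, joinFun, h1, h2, h3, h4]

end Join

lemma siteWeight_congr {ε' : Spin n} {π' : OpenLinkPattern (2 * n + 1)} (h : π'.1 x = π.1 x)
    (h1 : ε' x = ε x) (h2 : ε' (π.1 x) = ε (π.1 x)) :
    siteWeight κ ε' π' x = siteWeight κ ε π x := by
  simp only [siteWeight, h, h1, h2]

variable {i j : Fin (2 * n + 1)}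

lemma prod_compl_join (hij : j.val = i.val + 1) {T : Finset (Fin (2 * n + 1))} (hi : i ∈ T)
    (hj : j ∈ T) (hpi : π.1 i ∈ T) (hpj : π.1 j ∈ T) :
    ∏ x ∈ Tᶜ, siteWeight κ ε (π.join i j hij) x = ∏ x ∈ Tᶜ, siteWeight κ ε π x := by
  refine Finset.prod_congr rfl fun x hx => ?_
  rw [Finset.mem_compl] at hx
  refine siteWeight_congr (join_other hij ?_ ?_ ?_ ?_) rfl rfl
  · rintro rfl; exact hx hi
  · rintro rfl; exact hx hj
  · intro h; rw [← h, pattern_invol] at hpi; exact hx hpi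
  · intro h; rw [← h, pattern_invol] at hpj; exact hx hpj

lemma prod_compl_swap {T : Finset (Fin (2 * n + 1))} (hi : i ∈ T)
    (hj : j ∈ T) (hpi : π.1 i ∈ T) (hpj : π.1 j ∈ T) :
    ∏ x ∈ Tᶜ, siteWeight κ (ε ∘ Equiv.swap i j) π x = ∏ x ∈ Tᶜ, siteWeight κ ε π x := by
  refine Finset.prod_congr rfl fun x hx => ?_
  rw [Finset.mem_compl] at hx
  refine siteWeight_congr rfl ?_ ?_
  · rw [Function.comp_apply, Equiv.swap_apply_of_ne_of_ne]
    · rintro rfl; exact hx hi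
    · rintro rfl; exact hx hj
  · rw [Function.comp_apply, Equiv.swap_apply_of_ne_of_ne]
    · intro h; rw [← h, pattern_invol] at hpi; exact hx hpi
    · intro h; rw [← h, pattern_invol] at hpj; exact hx hpj

/-- Only the weights of the points of `T` change, if `T` contains `i`, `j` and their partners, so
the relation can be checked on the product over `T`. -/
lemma bulkSpin_spinVec_of_local (hij : j.val = i.val + 1) (c : ℂ) (T : Finset (Fin (2 * n + 1)))
    (hi : i ∈ T) (hj : j ∈ T) (hpi : π.1 i ∈ T) (hpj : π.1 j ∈ T) (hε : ε i ≠ ε j)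
    (h : -(spinSign κ (ε i) * (spinSign κ (ε i) * ∏ x ∈ T, siteWeight κ ε π x +
      spinSign κ (!ε i) * ∏ x ∈ T, siteWeight κ (ε ∘ Equiv.swap i j) π x)) =
      c * ∏ x ∈ T, siteWeight κ ε (π.join i j hij) x) :
    bulkSpin κ i j (spinVec κ π) ε = c * spinVec κ (π.join i j hij) ε := by
  rw [bulkSpin, if_neg hε, spinVec_eq_mul T, spinVec_eq_mul (ε := ε ∘ Equiv.swap i j) T,
    spinVec_eq_mul (π := π.join i j hij) T, prod_compl_join hij hi hj hpi hpj,
    prod_compl_swap hi hj hpi hpj]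
  simp only [smul_eq_mul]
  linear_combination (∏ x ∈ Tᶜ, siteWeight κ ε π x) * h

/-- The relation for the neighbouring sites `I` and `J`, by cases on the arches at `I` and `J`. -/
lemma bulkSpin_spinVec_aux (hκ : κ ≠ 0) (I J : Fin (2 * n + 1)) (hval : J.val = I.val + 1)
    (π : OpenLinkPattern (2 * n + 1)) (ε : Spin n) :
    bulkSpin κ I J (spinVec κ π) ε =
      (if π.1 I = J then loopWeight (κ ^ 2) else if π.1 I = I ∧ π.1 J = J then
        (if Even I.val then loopWeight (κ ^ 2) else 2) else 1) *
        spinVec κ (π.join I J hval) ε := by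
  have hlt : I < J := by rw [Fin.lt_def]; omega
  have hej : Even J.val ↔ ¬ Even I.val := by rw [hval, Nat.even_add_one]
  by_cases hε : ε I = ε J
  · have h0 : spinVec κ (π.join I J hval) ε = 0 :=
      Finset.prod_eq_zero (Finset.mem_univ I) (by
        rw [siteWeight_left (join_left hval) hlt, if_pos hε])
    rw [bulkSpin, if_pos hε, h0, mul_zero]
  have hεJ : ε J = !ε I := by
    revert hε; cases ε I <;> cases ε J <;> simp
  have hne : I ≠ J := hlt.ne
  have wJI : siteWeight κ ε (π.join I J hval) I = spinSign κ (ε I) := by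
    rw [siteWeight_left (join_left hval) hlt, if_neg hε]
  have wJJ : siteWeight κ ε (π.join I J hval) J = 1 := siteWeight_right (join_right hval) hlt
  have sI : (ε ∘ Equiv.swap I J) I = !ε I := by simp [hεJ]
  have sJ : (ε ∘ Equiv.swap I J) J = ε I := by simp
  have sO : ∀ x, x ≠ I → x ≠ J → (ε ∘ Equiv.swap I J) x = ε x := by
    intro x h1 h2; simp [Equiv.swap_apply_of_ne_of_ne h1 h2]
  by_cases c1 : π.1 I = J
  · -- a closed loop
    have c1' : π.1 J = I := by rw [← c1, pattern_invol]
    rw [if_pos c1]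
    refine bulkSpin_spinVec_of_local hval _ {I, J} (by simp) (by simp) (by simp [c1])
      (by simp [c1']) hε ?_
    rw [Finset.prod_pair hne, Finset.prod_pair hne, Finset.prod_pair hne, wJI, wJJ,
      siteWeight_left c1 hlt, siteWeight_left c1 hlt, siteWeight_right c1' hlt,
      siteWeight_right c1' hlt, sI, sJ, hεJ]
    cases ε I <;> simp [spinSign, loopWeight] <;> field_simp <;> ring
  rw [if_neg c1]
  by_cases oI : π.1 I = I
  · by_cases oJ : π.1 J = J
    · -- two open arches
      rw [if_pos ⟨oI, oJ⟩]
      refine bulkSpin_spinVec_of_local hval _ {I, J} (by simp) (by simp) (by simp [oI])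
        (by simp [oJ]) hε ?_
      rw [Finset.prod_pair hne, Finset.prod_pair hne, Finset.prod_pair hne, wJI, wJJ,
        siteWeight_open oI, siteWeight_open oI, siteWeight_open oJ, siteWeight_open oJ,
        sI, sJ, hεJ]
      simp only [hej]
      by_cases hp : Even I.val
      · simp only [hp]
        cases ε I <;> simp [spinSign, loopWeight] <;> field_simp <;> ring
      · simp only [hp]
        cases ε I <;> simp [spinSign] <;> field_simp <;> ring
    · -- `I` is open, and the partner of `J` becomes open
      rw [if_neg (fun h => oJ h.2)]
      set b := π.1 J with hb
      have hbJ : π.1 b = J := pattern_invol π J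
      have hJb : J < b := by
        rcases lt_or_gt_of_ne oJ with h | h
        · exfalso
          have hbI : b ≠ I := by intro e; rw [e, oI] at hbJ; exact hne hbJ
          have h1 : b < I := by
            rcases lt_or_gt_of_ne hbI with h' | h'
            · exact h'
            · have e1 : I.val < b.val := h'
              have e2 : b.val < J.val := h
              omega
          exact (pattern_nested π h1 (by rw [hbJ]; exact hlt)).1 oI
        · exact h
      have hbI : b ≠ I := (hlt.trans hJb).ne'
      have hbe : Even b.val ↔ Even I.val := by
        rw [even_iff_of_partner π oJ, hej, not_not]
      refine bulkSpin_spinVec_of_local hval _ {I, J, b} (by simp) (by simp) (by simp [oI])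
        (by simp [hb]) hε ?_
      have jb : (π.join I J hval).1 b = b := by
        rw [join_partner_right hval hbI hJb.ne' hbJ, if_pos oI]
      have hn1 : I ∉ ({J, b} : Finset (Fin (2 * n + 1))) := by simp [hne, hbI.symm]
      simp only [Finset.prod_insert hn1, Finset.prod_pair hJb.ne]
      rw [wJI, wJJ, siteWeight_open jb, siteWeight_open oI, siteWeight_open oI,
        siteWeight_left hb.symm hJb, siteWeight_left hb.symm hJb, siteWeight_right hbJ hJb,
        siteWeight_right hbJ hJb, sI, sJ, sO b hbI hJb.ne', hεJ]
      simp only [hbe]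
      by_cases hp : Even I.val
      · simp only [hp]
        cases ε I <;> cases ε b <;> simp [spinSign, hκ]
      · simp only [hp]
        cases ε I <;> cases ε b <;> simp [spinSign, hκ]
  · rw [if_neg (fun h => oI h.1)]
    by_cases oJ : π.1 J = J
    · -- `J` is open, and the partner of `I` becomes open
      set a := π.1 I with ha
      have haI : π.1 a = I := pattern_invol π I
      have haI' : a < I := by
        rcases lt_or_gt_of_ne oI with h | h
        · exact h
        · exfalso
          have h1 : J < a := by
            rcases lt_or_gt_of_ne c1 with h' | h'
            · have e1 : I.val < a.val := h
              have e2 : a.val < J.val := h'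
              omega
            · exact h'
          exact (pattern_nested π hlt h1).1 oJ
      have haJ : a ≠ J := (haI'.trans hlt).ne
      have hae : Even a.val ↔ ¬ Even I.val := by
        rw [even_iff_of_partner π oI]
      refine bulkSpin_spinVec_of_local hval _ {I, J, a} (by simp) (by simp) (by simp [ha])
        (by simp [oJ]) hε ?_
      have ja : (π.join I J hval).1 a = a := by
        rw [join_partner_left hval haI'.ne haJ haI, if_pos oJ]
      have hn1 : I ∉ ({J, a} : Finset (Fin (2 * n + 1))) := by simp [hne, haI'.ne']
      simp only [Finset.prod_insert hn1, Finset.prod_pair haJ.symm]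
      rw [wJI, wJJ, siteWeight_open ja, siteWeight_open oJ, siteWeight_open oJ,
        siteWeight_right ha.symm haI', siteWeight_right ha.symm haI', siteWeight_left haI haI',
        siteWeight_left haI haI', sI, sJ, sO a haI'.ne haJ, hεJ]
      simp only [hej, hae]
      by_cases hp : Even I.val
      · simp only [hp]
        cases ε I <;> cases ε a <;> simp [spinSign, hκ]
      · simp only [hp]
        cases ε I <;> cases ε a <;> simp [spinSign, hκ]
    · -- both partners are joined
      set a := π.1 I with ha
      set b := π.1 J with hb
      have haI : π.1 a = I := pattern_invol π I
      have hbJ : π.1 b = J := pattern_invol π J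
      have hab : a ≠ b := by intro e; rw [e, hbJ] at haI; exact hne haI.symm
      have hbI : b ≠ I := by intro e; rw [e] at hbJ; exact c1 (ha.trans hbJ)
      have hn1 : I ∉ ({J, a, b} : Finset (Fin (2 * n + 1))) := by
        simp [hne, Ne.symm oI, hbI.symm]
      have hn2 : J ∉ ({a, b} : Finset (Fin (2 * n + 1))) := by
        simp [Ne.symm c1, Ne.symm oJ]
      refine bulkSpin_spinVec_of_local hval _ {I, J, a, b} (by simp) (by simp) (by simp [ha])
        (by simp [hb]) hε ?_
      have ja : (π.join I J hval).1 a = b := by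
        rw [join_partner_left hval oI c1 haI, if_neg oJ]
      have jb : (π.join I J hval).1 b = a := by
        rw [join_partner_right hval hbI oJ hbJ, if_neg oI]
      simp only [Finset.prod_insert hn1, Finset.prod_insert hn2, Finset.prod_pair hab]
      have nI := fun {c} => pattern_nested π (a := I) (c := c)
      have nJ := fun {c} => pattern_nested π (a := J) (c := c)
      have na := fun {c} => pattern_nested π (a := a) (c := c)
      have nb := fun {c} => pattern_nested π (a := b) (c := c)
      rw [← ha] at nI
      rw [← hb] at nJ
      rw [haI] at na
      rw [hbJ] at nb
      rcases lt_or_gt_of_ne oI with hIa | hIa <;> rcases lt_or_gt_of_ne oJ with hJb | hJb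
      · -- `b < a < I`
        have hba : b < a := by
          rcases lt_or_gt_of_ne hab with h | h
          · exfalso
            have e1 : b.val < J.val := hJb
            have e2 : b.val ≠ I.val := fun e => hbI (Fin.ext e)
            have h3 : b < I := by rw [Fin.lt_def]; omega
            have := (na h h3).2.2
            rw [hbJ] at this
            exact absurd this hlt.not_gt
          · exact h
        rw [wJI, wJJ, siteWeight_right ja hba, siteWeight_left jb hba,
          siteWeight_right ha.symm hIa, siteWeight_right ha.symm hIa,
          siteWeight_right hb.symm hJb, siteWeight_right hb.symm hJb,
          siteWeight_left haI hIa, siteWeight_left haI hIa,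
          siteWeight_left hbJ hJb, siteWeight_left hbJ hJb, sI, sJ, sO a oI c1, sO b hbI oJ, hεJ]
        cases ε I <;> cases ε a <;> cases ε b <;> simp [spinSign, hκ]
      · -- `a < I`, `J < b`
        have hlt' : a < b := hIa.trans (hlt.trans hJb)
        rw [wJI, wJJ, siteWeight_left ja hlt', siteWeight_right jb hlt',
          siteWeight_right ha.symm hIa, siteWeight_right ha.symm hIa,
          siteWeight_left hb.symm hJb, siteWeight_left hb.symm hJb,
          siteWeight_left haI hIa, siteWeight_left haI hIa,
          siteWeight_right hbJ hJb, siteWeight_right hbJ hJb, sI, sJ, sO a oI c1, sO b hbI oJ, hεJ]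
        cases ε I <;> cases ε a <;> cases ε b <;> simp [spinSign, hκ]
      · -- crossing arches
        exfalso
        have e1 : b.val < J.val := hJb
        have e2 : b.val ≠ I.val := fun e => hbI (Fin.ext e)
        have e3 : I.val < a.val := hIa
        have e4 : a.val ≠ J.val := fun e => c1 (Fin.ext e)
        have h3 : b < I := by rw [Fin.lt_def]; omega
        have h4 : J < a := by rw [Fin.lt_def]; omega
        have := (nI hlt h4).2.1
        rw [← hb] at this
        exact absurd this h3.not_gt
      · -- `J < b < a`
        have e3 : I.val < a.val := hIa
        have e4 : a.val ≠ J.val := fun e => c1 (Fin.ext e)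
        have h4 : J < a := by rw [Fin.lt_def]; omega
        have hba : b < a := by
          have := (nI hlt h4).2.2
          rwa [← hb] at this
        rw [wJI, wJJ, siteWeight_right ja hba, siteWeight_left jb hba,
          siteWeight_left ha.symm hIa, siteWeight_left ha.symm hIa,
          siteWeight_left hb.symm hJb, siteWeight_left hb.symm hJb,
          siteWeight_right haI hIa, siteWeight_right haI hIa,
          siteWeight_right hbJ hJb, siteWeight_right hbJ hJb, sI, sJ, sO a oI c1, sO b hbI oJ, hεJ]
        cases ε I <;> cases ε a <;> cases ε b <;> simp [spinSign, hκ]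

/-- The spin vectors intertwine the bulk generators. -/
lemma bulkSpin_spinVec (hκ : κ ≠ 0) (i : Fin (2 * n)) (π : OpenLinkPattern (2 * n + 1))
    (ε : Spin n) :
    bulkSpin κ i.castSucc i.succ (spinVec κ π) ε =
      bulkWeight (loopWeight (κ ^ 2)) i π *
        spinVec κ (π.join i.castSucc i.succ (by simp)) ε :=
  bulkSpin_spinVec_aux hκ i.castSucc i.succ (by simp) π ε

lemma spinVec_mul_compl_congr {π' : OpenLinkPattern (2 * n + 1)} {ε' : Spin n}
    (T : Finset (Fin (2 * n + 1))) (hT : ∀ x ∉ T, π'.1 x = π.1 x)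
    (hε : ∀ x ∉ T, ε' x = ε x) (hT' : ∀ x ∉ T, π.1 x ∉ T) :
    spinVec κ π' ε' = (∏ x ∈ T, siteWeight κ ε' π' x) * ∏ x ∈ Tᶜ, siteWeight κ ε π x := by
  rw [spinVec_eq_mul T]
  congr 1
  refine Finset.prod_congr rfl fun x hx => ?_
  rw [Finset.mem_compl] at hx
  exact siteWeight_congr (hT x hx) (hε x hx) (hε _ (hT' x hx))

lemma cutFun_other {r : ℕ} {p : Fin r → Fin r} {a x : Fin r} (h1 : x ≠ a) (h2 : x ≠ p a) :
    cutFun p a x = p x := by simp [cutFun, h1, h2]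

lemma cutFun_self {r : ℕ} {p : Fin r → Fin r} {a : Fin r} : cutFun p a a = a := by simp [cutFun]

lemma cutFun_partner {r : ℕ} {p : Fin r → Fin r} {a : Fin r} :
    cutFun p a (p a) = p a := by simp [cutFun]

lemma cutLast_of_open (h : π.1 (Fin.last (2 * n)) = Fin.last (2 * n)) : π.cutLast = π := by
  refine Subtype.ext (funext fun x => ?_)
  by_cases hx : x = Fin.last (2 * n)
  · subst hx; simp [cutLast, cutFun, h]
  · exact cutFun_other hx (by rwa [h])

/-- The spin vectors intertwine the boundary generator. -/
lemma lastSpin_spinVec (hκ : κ ≠ 0) (π : OpenLinkPattern (2 * n + 1)) (ε : Spin n) :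
    lastSpin (κ ^ 2) (spinVec κ π) ε =
      (if π.1 (Fin.last (2 * n)) = Fin.last (2 * n) then loopWeight (κ ^ 2) else 1) *
        spinVec κ π.cutLast ε := by
  set L := Fin.last (2 * n) with hL
  have hLe : Even L.val := ⟨n, by simp [hL]; ring⟩
  by_cases h : π.1 L = L
  · rw [if_pos h, cutLast_of_open h]
    have hup : ∀ b, spinVec κ π (Function.update ε L b) = spinVec κ π ε := by
      intro b
      rw [spinVec_mul_compl_congr (π := π) (ε := ε) {L} (fun _ _ => rfl)
        (fun x hx => by
          rw [Finset.mem_singleton] at hx; rw [Function.update_of_ne hx])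
        (fun x hx => by
          rw [Finset.mem_singleton] at hx ⊢
          exact fun e => hx (by rw [← pattern_invol π x, e, h])), spinVec_eq_mul (ε := ε) {L}]
      simp [siteWeight_open h, hLe]
    rw [lastSpin, hup, hup, loopWeight]
    simp only [smul_eq_mul]
    ring
  · rw [if_neg h]
    set a := π.1 L with ha
    have haL : π.1 a = L := pattern_invol π L
    have hlt : a < L := lt_of_le_of_ne (Fin.le_last a) h
    have hae : ¬ Even a.val := by rw [even_iff_of_partner π h]; simpa using hLe
    have hT : ∀ x ∉ ({a, L} : Finset (Fin (2 * n + 1))), π.1 x ∉ ({a, L} : Finset _) := by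
      intro x hx
      simp only [Finset.mem_insert, Finset.mem_singleton, not_or] at hx ⊢
      refine ⟨fun e => hx.2 ?_, fun e => hx.1 ?_⟩
      · rw [← haL, ← e, pattern_invol]
      · rw [ha, ← e, pattern_invol]
    have hup : ∀ b, spinVec κ π (Function.update ε L b) =
        (if ε a = b then 0 else spinSign κ (ε a)) *
          ∏ x ∈ ({a, L} : Finset (Fin (2 * n + 1)))ᶜ, siteWeight κ ε π x := by
      intro b
      rw [spinVec_mul_compl_congr (π := π) (ε := ε) {a, L} (fun _ _ => rfl)
        (fun x hx => by
          simp only [Finset.mem_insert, Finset.mem_singleton, not_or] at hx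
          rw [Function.update_of_ne hx.2]) hT, Finset.prod_pair hlt.ne,
        siteWeight_left haL hlt, siteWeight_right ha.symm hlt, Function.update_self,
        Function.update_of_ne hlt.ne, mul_one]
    rw [lastSpin, hup, hup, spinVec_mul_compl_congr (π := π) (π' := π.cutLast) (ε := ε) {a, L}
      (fun x hx => by
          simp only [Finset.mem_insert, Finset.mem_singleton, not_or] at hx
          exact cutFun_other hx.2 hx.1) (fun _ _ => rfl) hT, Finset.prod_pair hlt.ne,
      siteWeight_open (cutFun_partner (p := π.1) (a := L)),
      siteWeight_open (cutFun_self (p := π.1) (a := L)), if_neg hae, if_pos hLe]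
    simp only [smul_eq_mul]
    cases ε a <;> simp [spinSign] <;> field_simp

/-- Reversing the spin of the first site. -/
def flipFirst (ε : Spin n) : Spin n := Function.update ε 0 (!ε 0)

/-- The spin vectors intertwine `s` with the reversal of the first spin. -/
lemma spinVec_flipFirst (π : OpenLinkPattern (2 * n + 1)) (ε : Spin n) :
    spinVec κ π (flipFirst ε) =
      if π.1 0 = 0 then spinVec κ π ε else spinVec κ π.cutFirst ε - spinVec κ π ε := by
  have h0e : Even (0 : Fin (2 * n + 1)).val := by simp
  by_cases h : π.1 0 = 0
  · rw [if_pos h, spinVec_mul_compl_congr (π := π) (ε := ε) {0} (fun _ _ => rfl)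
        (fun x hx => by
          rw [Finset.mem_singleton] at hx; rw [flipFirst, Function.update_of_ne hx])
        (fun x hx => by
          rw [Finset.mem_singleton] at hx ⊢
          exact fun e => hx (by rw [← pattern_invol π x, e, h])), spinVec_eq_mul (ε := ε) {0}]
    simp [siteWeight_open h]
  · rw [if_neg h]
    set b := π.1 0 with hb
    have hb0 : π.1 b = 0 := pattern_invol π 0
    have hlt : 0 < b := Fin.pos_of_ne_zero h
    have hbe : ¬ Even b.val := by rw [even_iff_of_partner π h]; simp
    have hT : ∀ x ∉ ({0, b} : Finset (Fin (2 * n + 1))), π.1 x ∉ ({0, b} : Finset _) := by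
      intro x hx
      simp only [Finset.mem_insert, Finset.mem_singleton, not_or] at hx ⊢
      refine ⟨fun e => hx.2 ?_, fun e => hx.1 ?_⟩
      · rw [hb, ← e, pattern_invol]
      · rw [← hb0, ← e, pattern_invol]
    rw [spinVec_mul_compl_congr (π := π) (ε := ε) (ε' := flipFirst ε) {0, b} (fun _ _ => rfl)
        (fun x hx => by
          simp only [Finset.mem_insert, Finset.mem_singleton, not_or] at hx
          rw [flipFirst, Function.update_of_ne hx.1]) hT,
      spinVec_mul_compl_congr (π := π) (π' := π.cutFirst) (ε := ε) {0, b}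
      (fun x hx => by
          simp only [Finset.mem_insert, Finset.mem_singleton, not_or] at hx
          exact cutFun_other hx.1 hx.2) (fun _ _ => rfl) hT, spinVec_eq_mul (ε := ε) {0, b}]
    simp only [Finset.prod_pair hlt.ne]
    have o1 : π.cutFirst.1 b = b := cutFun_partner
    have o2 : π.cutFirst.1 0 = 0 := cutFun_self (p := π.1) (a := 0)
    rw [siteWeight_open o1, siteWeight_open o2, if_neg hbe, if_pos h0e,
      siteWeight_left hb.symm hlt, siteWeight_left hb.symm hlt, siteWeight_right hb0 hlt,
      siteWeight_right hb0 hlt, flipFirst, Function.update_self, Function.update_of_ne hlt.ne']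
    cases ε 0 <;> cases ε b <;> simp

end Weights

end
end CqKZ

namespace CqKZ
open OpenLinkPattern MvPolynomial

noncomputable section

/-! ### Closing points and the triangular order -/

section Closings

variable {n : ℕ} {κ : ℂ}

/-- The spin configuration whose down spins are the right ends of the closed arches. -/
def closings (π : OpenLinkPattern (2 * n + 1)) : Spin n := fun x => !decide (π.1 x < x)

/-- The weighted number of down spins, a site weighing more the further left it is. -/
def downArea (ε : Spin n) : ℕ := ∑ x, if ε x then 0 else 2 * n + 1 - x.val

lemma closings_eq_false {π : OpenLinkPattern (2 * n + 1)} {x : Fin (2 * n + 1)} :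
    closings π x = false ↔ π.1 x < x := by simp [closings]

lemma closings_eq_true {π : OpenLinkPattern (2 * n + 1)} {x : Fin (2 * n + 1)} :
    closings π x = true ↔ x ≤ π.1 x := by simp [closings]

/-- A pattern is determined by the right ends of its closed arches. -/
lemma closings_injective : Function.Injective (closings (n := n)) := by
  intro π π' h
  have hlt : ∀ x, π.1 x < x ↔ π'.1 x < x := by
    intro x
    rw [← closings_eq_false, ← closings_eq_false, h]
  -- induction on the right end: nested arches agree, so that the left ends agree
  have key : ∀ (ρ ρ' : OpenLinkPattern (2 * n + 1)), (∀ x, ρ.1 x < x ↔ ρ'.1 x < x) →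
      ∀ c, (∀ c' < c, ρ.1 c' < c' → ρ.1 c' = ρ'.1 c') → ρ.1 c < c → ¬ ρ.1 c < ρ'.1 c := by
    intro ρ ρ' hc c ih h1 h2
    have h3 : ρ'.1 c < c := (hc c).1 h1
    have hn := pattern_nested ρ h2 (by rwa [pattern_invol])
    rw [pattern_invol] at hn
    set a' := ρ'.1 c with ha'
    have e1 : ρ'.1 a' = c := pattern_invol ρ' c
    have h4 : ¬ ρ.1 a' < a' := by rw [hc, e1]; exact h3.not_gt
    have h5 : a' < ρ.1 a' := lt_of_le_of_ne (not_lt.1 h4) (Ne.symm hn.1)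
    have h6 := ih (ρ.1 a') hn.2.2 (by rwa [pattern_invol])
    rw [pattern_invol] at h6
    have h7 : ρ'.1 a' = ρ.1 a' := by
      conv_lhs => rw [h6]
      exact pattern_invol ρ' _
    rw [e1] at h7
    exact absurd hn.2.2 (by rw [← h7]; exact lt_irrefl _)
  have main : ∀ c, π.1 c < c → π.1 c = π'.1 c := by
    intro c
    induction c using WellFoundedLT.induction with
    | ind c ih =>
      intro h1
      refine le_antisymm (not_lt.1 fun h2 => ?_) (not_lt.1 ?_)
      · refine key π' π (fun x => (hlt x).symm) c (fun c' hc' h' => ?_) ((hlt c).1 h1) h2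
        exact (ih c' hc' ((hlt c').2 h')).symm
      · exact key π π' hlt c ih h1
  refine Subtype.ext (funext fun x => ?_)
  rcases lt_trichotomy (π.1 x) x with h1 | h1 | h1
  · exact main x h1
  · rcases lt_trichotomy (π'.1 x) x with h2 | h2 | h2
    · exact main x ((hlt x).2 h2)
    · exact h1.trans h2.symm
    · have := main (π'.1 x) ((hlt _).2 (by rwa [pattern_invol]))
      rw [pattern_invol] at this
      have h3 : π.1 x = π'.1 x := by
        conv_lhs => rw [← this]
        exact pattern_invol π _
      exact h3
  · have := main (π.1 x) (by rwa [pattern_invol])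
    rw [pattern_invol] at this
    conv_rhs => rw [this]
    exact (pattern_invol π' _).symm

/-- The spin vector of `π` is supported on the configurations that have exactly one down spin on
each closed arch; the one of least area has all of them on the right ends. -/
lemma downArea_closings_le {π : OpenLinkPattern (2 * n + 1)} {ε : Spin n}
    (h : spinVec κ π ε ≠ 0) :
    downArea (closings π) ≤ downArea ε ∧
      (downArea ε ≤ downArea (closings π) → ε = closings π) := by
  have harc : ∀ x, π.1 x < x → ε (π.1 x) ≠ ε x := by
    intro x hx e
    refine h (Finset.prod_eq_zero (Finset.mem_univ (π.1 x)) ?_)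
    rw [siteWeight_left (pattern_invol π x) hx, if_pos e]
  set g : Fin (2 * n + 1) → ℕ := fun x => if ε x then 0 else 2 * n + 1 - x.val with hg
  set f : Fin (2 * n + 1) → ℕ := fun x => if π.1 x < x then 2 * n + 1 - x.val else 0 with hf
  have hA : downArea (closings π) = ∑ x, f x := by
    refine Finset.sum_congr rfl fun x _ => ?_
    by_cases hx : π.1 x < x <;> simp [closings, hf, hx]
  -- `g` is regrouped along the closed arches, each being charged to its right end
  have hsplit : ∑ x, g x = ∑ x, (if π.1 x = x then g x else 0) +
      ∑ x, (if π.1 x < x then g x + g (π.1 x) else 0) := by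
    have e1 : ∑ x, (if π.1 x < x then g (π.1 x) else 0) = ∑ x, if x < π.1 x then g x else 0 := by
      refine Fintype.sum_equiv ⟨π.1, π.1, pattern_invol π, pattern_invol π⟩ _ _ fun x => ?_
      simp [pattern_invol]
    have e2 : ∀ x, (if π.1 x < x then g x + g (π.1 x) else 0) =
        (if π.1 x < x then g x else 0) + if π.1 x < x then g (π.1 x) else 0 := by
      intro x; split_ifs <;> simp
    simp only [e2, Finset.sum_add_distrib, e1]
    rw [← Finset.sum_add_distrib, ← Finset.sum_add_distrib]
    refine Finset.sum_congr rfl fun x _ => ?_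
    rcases lt_trichotomy (π.1 x) x with h1 | h1 | h1
    · simp [h1, h1.ne, h1.not_gt]
    · simp [h1]
    · simp [h1, h1.ne', h1.not_gt]
  have hle : ∀ x, f x ≤ if π.1 x < x then g x + g (π.1 x) else 0 := by
    intro x
    by_cases hx : π.1 x < x
    · have := harc x hx
      have hx' : (π.1 x).val < x.val := hx
      simp only [hf, hg, hx, if_true]
      cases h1 : ε x <;> cases h2 : ε (π.1 x) <;> simp_all
      omega
    · simp [hf, hx]
  have hdA : downArea ε = ∑ x, g x := rfl
  have hle' := Finset.sum_le_sum fun x (_ : x ∈ Finset.univ) => hle x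
  refine ⟨by rw [hA, hdA, hsplit]; exact hle'.trans (Nat.le_add_left _ _), fun hge => ?_⟩
  rw [hA, hdA, hsplit] at hge
  have hz : ∑ x, (if π.1 x = x then g x else 0) = 0 := by omega
  have heq := (Finset.sum_eq_sum_iff_of_le fun x (_ : x ∈ Finset.univ) => hle x).1
    (by omega)
  rw [Finset.sum_eq_zero_iff] at hz
  have hclose : ∀ x, π.1 x < x → ε x = false := by
    intro x hx
    have h1 := heq x (Finset.mem_univ x)
    have h2 := harc x hx
    have hx' : (π.1 x).val < x.val := hx
    have := x.isLt
    simp only [hf, hg, hx, if_true] at h1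
    by_contra h3
    rw [Bool.not_eq_false] at h3
    rw [h3] at h2 h1
    have h4 : ε (π.1 x) = false := by simpa using h2
    simp [h4] at h1
    omega
  funext x
  rcases lt_trichotomy (π.1 x) x with h1 | h1 | h1
  · rw [hclose x h1, closings_eq_false.2 h1]
  · rw [closings_eq_true.2 h1.ge]
    have h2 := hz x (Finset.mem_univ x)
    have := x.isLt
    by_contra h3
    rw [Bool.not_eq_true] at h3
    simp [hg, h1, h3] at h2
    omega
  · rw [closings_eq_true.2 h1.le]
    have h2 := harc (π.1 x) (by rwa [pattern_invol])
    rw [pattern_invol, hclose (π.1 x) (by rwa [pattern_invol])] at h2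
    simpa using h2

lemma spinSign_ne_zero (hκ : κ ≠ 0) (b : Bool) : spinSign κ b ≠ 0 := by
  cases b <;> simp [spinSign, hκ]

lemma spinVec_closings_ne_zero (hκ : κ ≠ 0) (π : OpenLinkPattern (2 * n + 1)) :
    spinVec κ π (closings π) ≠ 0 := by
  refine Finset.prod_ne_zero_iff.2 fun x _ => ?_
  rcases lt_trichotomy (π.1 x) x with h1 | h1 | h1
  · rw [siteWeight_right rfl h1]; exact one_ne_zero
  · rw [siteWeight_open h1]
    split_ifs
    · exact one_ne_zero
    · exact spinSign_ne_zero hκ _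
  · rw [siteWeight_left rfl h1, closings_eq_true.2 h1.le,
      closings_eq_false.2 (by rwa [pattern_invol])]
    simpa using spinSign_ne_zero hκ true

/-- The spin vectors of the patterns are linearly independent: the component of the spin vectors at
`closings π` is triangular with respect to the area. -/
lemma eq_zero_of_sum_spinVec {M : Type} [AddCommGroup M] [Module ℂ M] (hκ : κ ≠ 0)
    {Ψ : OpenLinkPattern (2 * n + 1) → M} (h : ∀ ε, ∑ π, spinVec κ π ε • Ψ π = 0) : Ψ = 0 := by
  have key : ∀ k, ∀ π, downArea (closings π) = k → Ψ π = 0 := by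
    intro k
    induction k using Nat.strong_induction_on with
    | _ k ih =>
      intro π hπ
      have h1 := h (closings π)
      rw [Finset.sum_eq_single π] at h1
      · exact (smul_eq_zero.1 h1).resolve_left (spinVec_closings_ne_zero hκ π)
      · intro π' _ hne
        by_cases h2 : spinVec κ π' (closings π) = 0
        · rw [h2, zero_smul]
        · have h3 := downArea_closings_le h2
          rcases h3.1.lt_or_eq with h4 | h4
          · rw [ih _ (hπ ▸ h4) π' rfl, smul_zero]
          · exact absurd (closings_injective (h3.2 h4.ge)).symm hne
      · intro h2; exact absurd (Finset.mem_univ _) h2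
  funext π
  exact key _ π rfl

end Closings

end
end CqKZ

namespace CqKZ
open OpenLinkPattern MvPolynomial

noncomputable section

section Triangular

variable {n : ℕ}

lemma downArea_update_last (ε : Spin n) (h : ε (Fin.last (2 * n)) = false) :
    downArea (Function.update ε (Fin.last (2 * n)) true) + 1 = downArea ε := by
  rw [downArea, downArea, ← Finset.add_sum_erase _ _ (Finset.mem_univ (Fin.last (2 * n))),
    ← Finset.add_sum_erase _ _ (Finset.mem_univ (Fin.last (2 * n))), h, Function.update_self]
  have : ∑ x ∈ Finset.univ.erase (Fin.last (2 * n)),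
      (if Function.update ε (Fin.last (2 * n)) true x then 0 else 2 * n + 1 - x.val) =
      ∑ x ∈ Finset.univ.erase (Fin.last (2 * n)), if ε x then 0 else 2 * n + 1 - x.val := by
    refine Finset.sum_congr rfl fun x hx => ?_
    rw [Function.update_of_ne (Finset.ne_of_mem_erase hx)]
  rw [this]
  simp
  omega

lemma downArea_swap (ε : Spin n) {i j : Fin (2 * n + 1)} (hij : j.val = i.val + 1)
    (hi : ε i = false) (hj : ε j = true) :
    downArea (ε ∘ Equiv.swap i j) + 1 = downArea ε := by
  have hne : j ≠ i := by intro e; rw [e] at hij; omega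
  have hm : j ∈ Finset.univ.erase i := by simp [hne]
  rw [downArea, downArea, ← Finset.add_sum_erase _ _ (Finset.mem_univ i),
    ← Finset.add_sum_erase _ _ (Finset.mem_univ i), ← Finset.add_sum_erase _ _ hm,
    ← Finset.add_sum_erase _ _ hm]
  have : ∑ x ∈ (Finset.univ.erase i).erase j,
      (if (ε ∘ Equiv.swap i j) x then 0 else 2 * n + 1 - x.val) =
      ∑ x ∈ (Finset.univ.erase i).erase j, if ε x then 0 else 2 * n + 1 - x.val := by
    refine Finset.sum_congr rfl fun x hx => ?_
    simp only [Finset.mem_erase] at hx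
    rw [Function.comp_apply, Equiv.swap_apply_of_ne_of_ne hx.2.1 hx.1]
  rw [this]
  have := j.isLt
  simp [hi, hj]
  omega

lemma comp_swap_comp_swap (ε : Spin n) (i j : Fin (2 * n + 1)) :
    (ε ∘ Equiv.swap i j) ∘ Equiv.swap i j = ε := by
  funext x
  simp

/-- Cutting a closed arch at the last point removes one closing point, and the result has no other
preimage of larger area under `cutLast`. -/
lemma cutLast_area {π : OpenLinkPattern (2 * n + 1)}
    (h : π.1 (Fin.last (2 * n)) < Fin.last (2 * n)) :
    downArea (closings π.cutLast) < downArea (closings π) ∧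
      ∀ ρ : OpenLinkPattern (2 * n + 1), ρ.cutLast = π.cutLast → ρ ≠ π →
        downArea (closings ρ) < downArea (closings π) := by
  have h1 : (1 : ℂ) ≠ 0 := one_ne_zero
  have hσL : ∀ ρ : OpenLinkPattern (2 * n + 1),
      ρ.cutLast.1 (Fin.last (2 * n)) = Fin.last (2 * n) := fun ρ => cutFun_self (p := ρ.1)
  -- the boundary relation, with a nonzero weight
  have hrel : ∀ (ρ : OpenLinkPattern (2 * n + 1)) (ε : Spin n), spinVec 1 ρ.cutLast ε ≠ 0 ↔
      spinVec 1 ρ (Function.update ε (Fin.last (2 * n)) true) +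
        spinVec 1 ρ (Function.update ε (Fin.last (2 * n)) false) ≠ 0 := by
    intro ρ ε
    have := lastSpin_spinVec h1 ρ ε
    simp only [lastSpin, one_pow, inv_one, one_smul] at this
    rw [← not_iff_not, not_not, not_not, ← neg_eq_zero (a := _ + _), this, mul_eq_zero]
    refine ⟨fun h => Or.inr h, fun h => h.resolve_left ?_⟩
    split_ifs
    · simp only [loopWeight]; norm_num
    · exact h1
  have hc : closings π (Fin.last (2 * n)) = false := closings_eq_false.2 h
  have hup : spinVec 1 π (Function.update (closings π) (Fin.last (2 * n)) true) = 0 := by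
    by_contra h2
    have := (downArea_closings_le h2).1
    have := downArea_update_last (closings π) hc
    omega
  have hσ : spinVec 1 π.cutLast (Function.update (closings π) (Fin.last (2 * n)) true) ≠ 0 := by
    rw [hrel, Function.update_idem, Function.update_idem, hup, zero_add, ← hc,
      Function.update_eq_self]
    exact spinVec_closings_ne_zero h1 π
  have hlt : downArea (closings π.cutLast) < downArea (closings π) := by
    have := (downArea_closings_le hσ).1
    have := downArea_update_last (closings π) hc
    omega
  have hσc : closings π.cutLast (Fin.last (2 * n)) = true := closings_eq_true.2 (hσL π).ge
  have hA := downArea_update_last (Function.update (closings π.cutLast) (Fin.last (2 * n)) false)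
    (Function.update_self ..)
  rw [Function.update_idem] at hA
  have hup' : Function.update (closings π.cutLast) (Fin.last (2 * n)) true =
      closings π.cutLast := by
    rw [← hσc, Function.update_eq_self]
  rw [hup'] at hA
  have hpre : ∀ ρ : OpenLinkPattern (2 * n + 1), ρ.cutLast = π.cutLast →
      downArea (closings ρ) < downArea (closings π) ∨
        closings ρ = Function.update (closings π.cutLast) (Fin.last (2 * n)) false := by
    intro ρ hρ
    have h2 := spinVec_closings_ne_zero h1 ρ.cutLast
    rw [hrel, hρ, hup'] at h2
    by_cases h3 : spinVec 1 ρ (closings π.cutLast) = 0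
    · rw [h3, zero_add] at h2
      have h4 := downArea_closings_le h2
      rcases h4.1.lt_or_eq with h5 | h5
      · left; omega
      · right; exact (h4.2 h5.ge).symm
    · left; have := (downArea_closings_le h3).1; omega
  refine ⟨hlt, fun ρ hρ hne => (hpre ρ hρ).resolve_right fun h2 => hne ?_⟩
  exact closings_injective (h2.trans ((hpre π rfl).resolve_left (lt_irrefl _)).symm)

/-- Gluing at `i, j = i + 1` when `i` is a closing point and `j` is not lowers the area, and the
result has no other preimage of larger area. -/
lemma join_area {π : OpenLinkPattern (2 * n + 1)} {i j : Fin (2 * n + 1)}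
    (hij : j.val = i.val + 1) (hi : π.1 i < i) (hj : j ≤ π.1 j) :
    downArea (closings (π.join i j hij)) < downArea (closings π) ∧
      ∀ ρ : OpenLinkPattern (2 * n + 1), ρ.join i j hij = π.join i j hij → ρ ≠ π →
        downArea (closings ρ) < downArea (closings π) := by
  have h1 : (1 : ℂ) ≠ 0 := one_ne_zero
  have hlt : i < j := by rw [Fin.lt_def]; omega
  have hrel : ∀ (ρ : OpenLinkPattern (2 * n + 1)) (ε : Spin n), ε i ≠ ε j →
      (spinVec 1 (ρ.join i j hij) ε ≠ 0 ↔
        spinVec 1 ρ ε - spinVec 1 ρ (ε ∘ Equiv.swap i j) ≠ 0) := by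
    intro ρ ε hε
    have := bulkSpin_spinVec_aux h1 i j hij ρ ε
    rw [bulkSpin, if_neg hε] at this
    have h2 : spinVec 1 ρ ε - spinVec 1 ρ (ε ∘ Equiv.swap i j) = 0 ↔
        -(spinSign 1 (ε i) • (spinSign 1 (ε i) • spinVec 1 ρ ε +
          spinSign 1 (!ε i) • spinVec 1 ρ (ε ∘ Equiv.swap i j))) = 0 := by
      cases ε i <;> simp [spinSign]
      · rw [← neg_eq_zero, neg_sub, sub_eq_neg_add]
      · rw [← neg_eq_zero, neg_sub, sub_eq_neg_add, add_comm]
    rw [← not_iff_not, not_not, not_not, h2, this, mul_eq_zero]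
    refine ⟨fun h => Or.inr h, fun h => h.resolve_left ?_⟩
    split_ifs <;> norm_num [loopWeight]
  have hci : closings π i = false := closings_eq_false.2 hi
  have hcj : closings π j = true := closings_eq_true.2 hj
  have hA := downArea_swap (closings π) hij hci hcj
  have hup : spinVec 1 π (closings π ∘ Equiv.swap i j) = 0 := by
    by_contra h2
    have := (downArea_closings_le h2).1
    omega
  have hσ : spinVec 1 (π.join i j hij) (closings π ∘ Equiv.swap i j) ≠ 0 := by
    rw [hrel _ _ (by simp [hci, hcj]), hup, zero_sub, neg_ne_zero, comp_swap_comp_swap]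
    exact spinVec_closings_ne_zero h1 π
  have hlt' : downArea (closings (π.join i j hij)) < downArea (closings π) := by
    have := (downArea_closings_le hσ).1
    omega
  set σ := π.join i j hij with hσd
  have hsi : closings σ i = true := closings_eq_true.2 (by
    rw [hσd, join_left]; exact hlt.le)
  have hsj : closings σ j = false := closings_eq_false.2 (by
    rw [hσd, join_right]; exact hlt)
  have hA' := downArea_swap (closings σ ∘ Equiv.swap i j) hij (by simp [hsj]) (by simp [hsi])
  rw [comp_swap_comp_swap] at hA'
  have hpre : ∀ ρ : OpenLinkPattern (2 * n + 1), ρ.join i j hij = σ →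
      downArea (closings ρ) < downArea (closings π) ∨
        closings ρ = closings σ ∘ Equiv.swap i j := by
    intro ρ hρ
    have h2 := spinVec_closings_ne_zero h1 (ρ.join i j hij)
    rw [hrel _ _ (by rw [hρ, hsi, hsj]; simp), hρ] at h2
    by_cases h3 : spinVec 1 ρ (closings σ) = 0
    · rw [h3, zero_sub, neg_ne_zero] at h2
      have h4 := downArea_closings_le h2
      rcases h4.1.lt_or_eq with h5 | h5
      · left; omega
      · right; exact (h4.2 h5.ge).symm
    · left; have := (downArea_closings_le h3).1; omega
  refine ⟨hlt', fun ρ hρ hne => (hpre ρ hρ).resolve_right fun h2 => hne ?_⟩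
  exact closings_injective (h2.trans ((hpre π rfl).resolve_left (lt_irrefl _)).symm)

/-- The generators over the constants. -/
def genC (n : ℕ) (β : ℂ) : Fin (2 * n + 1) → Op n ℂ := Fin.lastCases (lastE n β) (bulkE n β)

lemma genC_last (β : ℂ) : genC n β (Fin.last (2 * n)) = lastE n β := Fin.lastCases_last ..

lemma genC_castSucc (β : ℂ) (i : Fin (2 * n)) : genC n β i.castSucc = bulkE n β i :=
  Fin.lastCases_castSucc ..

lemma downArea_closings_allOpen : downArea (closings (allOpen (2 * n + 1))) = 0 :=
  Finset.sum_eq_zero fun x _ => by simp [closings, allOpen]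

lemma allOpen_of_no_closing {π : OpenLinkPattern (2 * n + 1)} (h : ∀ x, ¬ π.1 x < x) :
    π = allOpen (2 * n + 1) := by
  refine Subtype.ext (funext fun x => le_antisymm (not_lt.1 fun h1 => ?_) (not_lt.1 (h x)))
  have h1 : x < π.1 x := h1
  exact h (π.1 x) (by rwa [pattern_invol])

/-- Every pattern `π` but the one with all arches open occurs with coefficient `1` in the row `σ` of
a generator, where `σ` and the other patterns in this row have smaller area than `π`. The generator
is the one at the rightmost closing point of `π`, and `σ` is its action on `π`. -/
lemma exists_predecessor {π : OpenLinkPattern (2 * n + 1)} (hπ : π ≠ allOpen (2 * n + 1)) :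
    ∃ i σ, downArea (closings σ) < downArea (closings π) ∧ ∀ β : ℂ, genC n β i σ π = 1 ∧
      ∀ ρ, genC n β i σ ρ ≠ 0 → ρ ≠ π → downArea (closings ρ) < downArea (closings π) := by
  by_cases hL : π.1 (Fin.last (2 * n)) < Fin.last (2 * n)
  · have h := cutLast_area hL
    refine ⟨Fin.last (2 * n), π.cutLast, h.1, fun β => ⟨?_, fun ρ hρ => h.2 ρ ?_⟩⟩
    · rw [genC_last, lastE, if_pos rfl, if_neg hL.ne]
    · rw [genC_last, lastE] at hρ
      by_contra hne
      exact hρ (if_neg fun e => hne e.symm)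
  · have hex : (Finset.univ.filter fun x => π.1 x < x).Nonempty := by
      by_contra he
      rw [Finset.not_nonempty_iff_eq_empty, Finset.filter_eq_empty_iff] at he
      exact hπ (allOpen_of_no_closing fun x => he (Finset.mem_univ x))
    obtain ⟨x, hx, hmax⟩ := Finset.exists_max_image _ id hex
    rw [Finset.mem_filter] at hx
    obtain ⟨i, rfl⟩ : ∃ i : Fin (2 * n), x = i.castSucc :=
      ⟨x.castPred (by rintro rfl; exact hL hx.2), by simp⟩
    have hj : i.succ ≤ π.1 i.succ := by
      by_contra hj
      have := hmax i.succ (by simpa using not_le.1 hj)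
      exact absurd this (not_le.2 Fin.castSucc_lt_succ)
    have h := join_area (π := π) (i := i.castSucc) (j := i.succ) (by simp) hx.2 hj
    refine ⟨i.castSucc, _, h.1, fun β => ⟨?_, fun ρ hρ => h.2 ρ ?_⟩⟩
    · rw [genC_castSucc, bulkE, if_pos rfl, bulkWeight, if_neg, if_neg fun e => hx.2.ne e.1]
      exact (hx.2.trans Fin.castSucc_lt_succ).ne
    · rw [genC_castSucc, bulkE] at hρ
      by_contra hne
      exact hρ (if_neg fun e => hne e.symm)

/-- A total order on the patterns refining the comparison of areas. -/
def rank (π : OpenLinkPattern (2 * n + 1)) : ℕ :=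
  if π = allOpen (2 * n + 1) then 0 else
    downArea (closings π) * Fintype.card (OpenLinkPattern (2 * n + 1)) +
      (Fintype.equivFin (OpenLinkPattern (2 * n + 1)) π).val

lemma downArea_pos {π : OpenLinkPattern (2 * n + 1)} (hπ : π ≠ allOpen (2 * n + 1)) :
    0 < downArea (closings π) := by
  obtain ⟨_, _, h, _⟩ := exists_predecessor hπ
  omega

lemma rank_allOpen : rank (allOpen (2 * n + 1)) = 0 := if_pos rfl

lemma rank_lt {ρ π : OpenLinkPattern (2 * n + 1)}
    (h : downArea (closings ρ) < downArea (closings π)) : rank ρ < rank π := by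
  have hπ : π ≠ allOpen (2 * n + 1) := by
    rintro rfl; rw [downArea_closings_allOpen] at h; omega
  have hN : 0 < Fintype.card (OpenLinkPattern (2 * n + 1)) := Fintype.card_pos_iff.2 ⟨π⟩
  have h1 := (Fintype.equivFin (OpenLinkPattern (2 * n + 1)) ρ).isLt
  rw [rank, rank, if_neg hπ]
  split_ifs
  · have := downArea_pos hπ
    positivity
  · have := Nat.mul_le_mul_right (Fintype.card (OpenLinkPattern (2 * n + 1))) h
    rw [Nat.succ_mul] at this
    omega

lemma rank_injective : Function.Injective (rank (n := n)) := by
  intro ρ π h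
  rcases lt_trichotomy (downArea (closings ρ)) (downArea (closings π)) with h1 | h1 | h1
  · exact absurd h (rank_lt h1).ne
  · by_cases hπ : π = allOpen (2 * n + 1)
    · by_contra hne
      rw [hπ, downArea_closings_allOpen] at h1
      have := downArea_pos (π := ρ) (by rwa [hπ] at hne)
      omega
    · by_cases hρ : ρ = allOpen (2 * n + 1)
      · have := downArea_pos hπ
        rw [hρ, downArea_closings_allOpen] at h1
        omega
      · rw [rank, rank, if_neg hπ, if_neg hρ, h1] at h
        exact (Fintype.equivFin _).injective (Fin.ext (by omega))
  · exact absurd h (rank_lt h1).ne'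

end Triangular

end
end CqKZ

namespace CqKZ
open OpenLinkPattern MvPolynomial

noncomputable section

/-! ### The base entry -/

section Base

variable {σ : Type}

/-- The linear forms whose product is the base entry. -/
def linForm (q : ℂ) (i j : σ) : MvPolynomial σ ℂ := C q * X i - C q⁻¹ * X j

lemma eval_linForm (q : ℂ) (i j : σ) (v : σ → ℂ) :
    eval v (linForm q i j) = q * v i - q⁻¹ * v j := by simp [linForm]

lemma rename_linForm {τ : Type} (g : σ → τ) (q : ℂ) (i j : σ) :
    rename g (linForm q i j) = linForm q (g i) (g j) := by simp [linForm]

lemma linForm_ne_zero {q : ℂ} (hq : q ≠ 0) {i j : σ} (hij : i ≠ j) : linForm q i j ≠ 0 := by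
  classical
  intro h
  have := congrArg (eval (Pi.single i 1)) h
  simp [eval_linForm, hq, hij.symm] at this

/-- The restriction to the hyperplane where a linear form vanishes. -/
def onHyperplane [DecidableEq σ] (q : ℂ) (i j : σ) : MvPolynomial σ ℂ →ₐ[ℂ] MvPolynomial σ ℂ :=
  aeval (Function.update X j (C (q ^ 2) * X i))

/-- A polynomial vanishes on a hyperplane if and only if it is divisible by the linear form. -/
lemma linForm_dvd_iff [DecidableEq σ] {q : ℂ} (hq : q ≠ 0) {i j : σ} (hij : i ≠ j)
    (f : MvPolynomial σ ℂ) : linForm q i j ∣ f ↔ onHyperplane q i j f = 0 := by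
  constructor
  · rintro ⟨g, rfl⟩
    have h0 : onHyperplane q i j (linForm q i j) = 0 := by
      simp only [onHyperplane, linForm, map_sub, map_mul, aeval_X, algHom_C, algebraMap_eq,
        Function.update_of_ne hij, Function.update_self, sub_eq_zero]
      rw [← mul_assoc, ← C_mul, pow_two, inv_mul_cancel_left₀ hq]
    rw [map_mul, h0, zero_mul]
  · intro h
    have key : linForm q i j ∣ f - onHyperplane q i j f := by
      clear h
      induction f using MvPolynomial.induction_on with
      | C a => simp [onHyperplane]
      | add f g hf hg =>
        rw [map_add, add_sub_add_comm]
        exact dvd_add hf hg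
      | mul_X f k hf =>
        have e : f * X k - onHyperplane q i j (f * X k) =
            (f - onHyperplane q i j f) * X k +
              onHyperplane q i j f * (X k - onHyperplane q i j (X k)) := by
          rw [map_mul]; ring
        rw [e]
        refine dvd_add (hf.mul_right _) (Dvd.dvd.mul_left ?_ _)
        by_cases hk : k = j
        · subst hk
          refine ⟨-C q, ?_⟩
          simp only [onHyperplane, aeval_X, Function.update_self, linForm]
          have : (C q * C q⁻¹ : MvPolynomial σ ℂ) = 1 := by
            rw [← C_mul, mul_inv_cancel₀ hq, C_1]
          rw [C_pow]
          linear_combination (-X k) * this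
        · simp [onHyperplane, hk]
    rwa [h, sub_zero] at key

lemma linForm_prime [DecidableEq σ] {q : ℂ} (hq : q ≠ 0) {i j : σ} (hij : i ≠ j) :
    Prime (linForm q i j) := by
  refine ⟨linForm_ne_zero hq hij, fun h => ?_, fun f g h => ?_⟩
  · have := (linForm_dvd_iff hq hij 1).1 h.dvd
    simp at this
  · simp only [linForm_dvd_iff hq hij, map_mul, mul_eq_zero] at h ⊢
    exact h

/-- A linear form divides another one only if they are equal, or if the indices are interchanged and
`q⁴ = 1`. -/
lemma not_linForm_dvd [DecidableEq σ] {q : ℂ} (hq : q ≠ 0) {i j k l : σ} (hij : i ≠ j)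
    (hkl : k ≠ l) (h1 : ¬ (k = i ∧ l = j)) (h2 : k = j → l = i → q ^ 4 ≠ 1) :
    ¬ linForm q i j ∣ linForm q k l := by
  rintro ⟨g, hg⟩
  have hz : ∀ v : σ → ℂ, v j = q ^ 2 * v i → q * v k = q⁻¹ * v l := by
    intro v hv
    have := congrArg (eval v) hg
    rw [map_mul, eval_linForm, eval_linForm, hv, pow_two, ← mul_assoc, inv_mul_cancel_left₀ hq,
      sub_self, zero_mul, sub_eq_zero] at this
    exact this
  have hz' := hz (Function.update (Function.update (fun _ => 0) i 1) j (q ^ 2))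
    (by simp [Function.update_of_ne hij])
  by_cases ki : k = i
  · subst ki
    have lj : l ≠ j := fun e => h1 ⟨rfl, e⟩
    simp [hij, lj, hkl.symm, hq] at hz'
  · by_cases kj : k = j
    · subst kj
      by_cases li : l = i
      · subst li
        simp only [Function.update_self, Function.update_of_ne hij] at hz'
        refine h2 rfl rfl ?_
        field_simp at hz'
        linear_combination hz'
      · simp [hkl.symm, li, hq] at hz'
    · by_cases li : l = i
      · subst li
        simp [hij, ki, kj, Ne.symm hq] at hz'
      · by_cases lj : l = j
        · subst lj
          simp [ki, kj, hq] at hz'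
        · have := hz (Function.update (fun _ => 0) k 1) (by simp [Ne.symm ki, Ne.symm kj])
          simp [hkl.symm, hq] at this

variable {n : ℕ}

/-- The pairs of indices `i < j`. -/
def pairs (n : ℕ) : Finset (Fin (2 * n + 1) × Fin (2 * n + 1)) :=
  Finset.univ.filter fun p => p.1 < p.2

lemma prod_pairs {M : Type} [CommMonoid M] (f : Fin (2 * n + 1) → Fin (2 * n + 1) → M) :
    ∏ p ∈ pairs n, f p.1 p.2 = ∏ i, ∏ j ∈ Finset.Ioi i, f i j := by
  rw [Finset.prod_sigma']
  symm
  refine Finset.prod_bij' (fun x _ => (x.1, x.2)) (fun p _ => ⟨p.1, p.2⟩) ?_ ?_ ?_ ?_ ?_ <;>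
    simp [pairs]

lemma baseEntry_eq (q : ℂ) : baseEntry n q = ∏ p ∈ pairs n, linForm q p.1 p.2 :=
  (prod_pairs (linForm q)).symm

lemma card_pairs : (pairs n).card = n * (2 * n + 1) := by
  have h : (pairs n).card = ∑ i : Fin (2 * n + 1), (Finset.Ioi i).card := by
    rw [← Finset.card_sigma]
    refine Finset.card_bij' (fun p _ => ⟨p.1, p.2⟩) (fun x _ => (x.1, x.2)) ?_ ?_ ?_ ?_ <;>
      simp [pairs]
  rw [h]
  simp only [Fin.card_Ioi]
  rw [Fin.sum_univ_eq_sum_range (fun i => 2 * n + 1 - 1 - i) (2 * n + 1),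
    Finset.sum_range_reflect (fun i => i) (2 * n + 1), Finset.sum_range_id]
  rw [Nat.add_sub_cancel, mul_comm (2 * n + 1), mul_assoc, Nat.mul_div_cancel_left _ two_pos]

lemma baseEntry_ne_zero {q : ℂ} (hq : q ≠ 0) : baseEntry n q ≠ 0 := by
  rw [baseEntry_eq]
  exact Finset.prod_ne_zero_iff.2 fun p hp =>
    linForm_ne_zero hq (Finset.mem_filter.1 hp).2.ne

lemma baseEntry_isHomogeneous (q : ℂ) : (baseEntry n q).IsHomogeneous (n * (2 * n + 1)) := by
  rw [baseEntry_eq, ← card_pairs, Finset.card_eq_sum_ones]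
  refine IsHomogeneous.prod _ _ _ fun p _ => ?_
  exact ((isHomogeneous_X ℂ p.1).C_mul q).sub ((isHomogeneous_X ℂ p.2).C_mul q⁻¹)

lemma baseEntry_totalDegree {q : ℂ} (hq : q ≠ 0) :
    (baseEntry n q).totalDegree = n * (2 * n + 1) :=
  (baseEntry_isHomogeneous q).totalDegree (baseEntry_ne_zero hq)

lemma degreeOf_linForm [DecidableEq σ] {q : ℂ} (hq : q ≠ 0) {i j : σ} (hij : i ≠ j) (k : σ) :
    (linForm q i j).degreeOf k = if k = i ∨ k = j then 1 else 0 := by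
  have hX : ∀ (a : ℂ), a ≠ 0 → ∀ l : σ, (C a * X l : MvPolynomial σ ℂ).degreeOf k =
      if k = l then 1 else 0 := by
    intro a ha l
    rw [degreeOf_C_mul _ _ (by simpa using ha), degreeOf_X]
  have h1 := hX q hq i
  have h2 := hX q⁻¹ (inv_ne_zero hq) j
  refine le_antisymm ?_ ?_
  · refine (degreeOf_sub_le k _ _).trans ?_
    rw [h1, h2]
    split_ifs <;> simp_all
  · split_ifs with hk
    · rw [Nat.one_le_iff_ne_zero]
      intro h0
      have hc : coeff (Finsupp.single k 1) (linForm q i j) ≠ 0 := by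
        simp only [linForm, coeff_sub, coeff_C_mul, coeff_X,
          Finsupp.single_left_inj one_ne_zero]
        rcases hk with rfl | rfl
        · simp [hij.symm, hq]
        · simp [hij, hq]
      have := degreeOf_le_iff.1 h0.le _ (mem_support_iff.2 hc)
      simp at this
    · exact Nat.zero_le _

lemma baseEntry_degreeOf {q : ℂ} (hq : q ≠ 0) (k : Fin (2 * n + 1)) :
    (baseEntry n q).degreeOf k = 2 * n := by
  rw [baseEntry_eq, degreeOf_prod_eq _ _ fun p hp =>
    linForm_ne_zero hq (Finset.mem_filter.1 hp).2.ne]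
  rw [Finset.sum_congr rfl fun p hp => degreeOf_linForm hq (Finset.mem_filter.1 hp).2.ne k,
    Finset.sum_boole]
  -- the pairs containing `k` are in bijection with the other indices
  have : ((pairs n).filter fun p => k = p.1 ∨ k = p.2).card = (Finset.univ.erase k).card := by
    refine Finset.card_bij' (fun p _ => if p.1 = k then p.2 else p.1)
      (fun x _ => if x < k then (x, k) else (k, x)) ?_ ?_ ?_ ?_
    · rintro ⟨a, b⟩ h
      simp only [pairs, Finset.mem_filter, Finset.mem_univ, true_and] at h
      rcases h with ⟨h1, rfl | rfl⟩
      · simp [h1.ne']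
      · simp [h1.ne]
    · intro x hx
      have hx : x ≠ k := by simpa using hx
      simp only [pairs, Finset.mem_filter, Finset.mem_univ, true_and]
      split_ifs with h
      · exact ⟨h, Or.inr rfl⟩
      · exact ⟨lt_of_le_of_ne (not_lt.1 h) hx.symm, Or.inl rfl⟩
    · rintro ⟨a, b⟩ h
      simp only [pairs, Finset.mem_filter, Finset.mem_univ, true_and] at h
      rcases h with ⟨h1, rfl | rfl⟩
      · simp [h1.not_gt]
      · simp [h1.ne, h1]
    · intro x hx
      have hx : x ≠ k := by simpa using hx
      split_ifs with h <;> simp_all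
  simp [this]

lemma baseEntry_mem_box {q : ℂ} (hq : q ≠ 0) : baseEntry n q ∈ Box n :=
  (mem_restrictDegree_iff_degreeOf _ _).2 fun i => (baseEntry_degreeOf hq i).le

/-- The base entry is an eigenvector of the bulk Hecke generators. -/
lemma linForm_mul_baseEntry (q : ℂ) (i : Fin (2 * n)) :
    linForm q i.succ i.castSucc * baseEntry n q =
      linForm q i.castSucc i.succ * rename (Equiv.swap i.castSucc i.succ) (baseEntry n q) := by
  have hlt : i.castSucc < i.succ := Fin.castSucc_lt_succ
  have hmem : (i.castSucc, i.succ) ∈ pairs n := by simp [pairs, hlt]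
  rw [baseEntry_eq, ← Finset.mul_prod_erase _ _ hmem, map_mul, map_prod]
  simp only [rename_linForm, Equiv.swap_apply_left, Equiv.swap_apply_right]
  -- the other pairs are permuted
  have : ∏ p ∈ (pairs n).erase (i.castSucc, i.succ),
      linForm q (Equiv.swap i.castSucc i.succ p.1) (Equiv.swap i.castSucc i.succ p.2) =
      ∏ p ∈ (pairs n).erase (i.castSucc, i.succ), linForm q p.1 p.2 := by
    have key : ∀ p ∈ (pairs n).erase (i.castSucc, i.succ),
        (Equiv.swap i.castSucc i.succ p.1, Equiv.swap i.castSucc i.succ p.2) ∈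
          (pairs n).erase (i.castSucc, i.succ) := by
      rintro ⟨a, b⟩ hp
      simp only [pairs, Finset.mem_erase, Finset.mem_filter, Finset.mem_univ, true_and, ne_eq,
        Prod.mk.injEq, Equiv.swap_apply_def] at hp ⊢
      obtain ⟨h1, h2⟩ := hp
      simp only [Fin.ext_iff, Fin.lt_def, Fin.val_castSucc, Fin.val_succ] at h1 h2 ⊢
      split_ifs <;> (try simp only [Fin.val_castSucc, Fin.val_succ]) <;> omega
    exact Finset.prod_bij'
      (fun p _ => (Equiv.swap i.castSucc i.succ p.1, Equiv.swap i.castSucc i.succ p.2))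
      (fun p _ => (Equiv.swap i.castSucc i.succ p.1, Equiv.swap i.castSucc i.succ p.2))
      key key (by simp) (by simp) (by simp)
  rw [this]
  ring

/-- For `q² = 1` the eigenvalue relation says that `f` is antisymmetric. -/
lemma linForm_dvd_of_antisymm {q : ℂ} (h2 : q ^ 2 = 1) {i j : Fin (2 * n + 1)} (hij : i ≠ j)
    {f : MvPolynomial (Fin (2 * n + 1)) ℂ}
    (hf : linForm q j i * f = linForm q i j * rename (Equiv.swap i j) f) :
    linForm q i j ∣ f := by
  have hq : q ≠ 0 := by rintro rfl; norm_num at h2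
  have hqi : q⁻¹ = q := by field_simp; exact h2.symm
  have e1 : linForm q j i = C q * (X j - X i) := by rw [linForm, hqi]; ring
  have e2 : linForm q i j = -(C q * (X j - X i)) := by rw [linForm, hqi]; ring
  rw [e1, e2] at hf
  have h5 : rename (Equiv.swap i j) f = -f := by
    have hne : (C q * (X j - X i) : MvPolynomial (Fin (2 * n + 1)) ℂ) ≠ 0 :=
      mul_ne_zero (by simpa using hq) (X_sub_X_ne_zero hij)
    apply mul_left_cancel₀ hne
    linear_combination hf
  obtain ⟨g, hg⟩ := h5 ▸ X_sub_X_dvd_rename_swap_sub i j f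
  refine ⟨C q * C 2⁻¹ * g, ?_⟩
  have e3 : (C q * C q : MvPolynomial (Fin (2 * n + 1)) ℂ) = 1 := by
    rw [← C_mul, ← pow_two, h2, C_1]
  have e4 : (C 2 * C 2⁻¹ : MvPolynomial (Fin (2 * n + 1)) ℂ) = 1 := by
    rw [← C_mul, mul_inv_cancel₀ two_ne_zero, C_1]
  have e5 : (C 2 : MvPolynomial (Fin (2 * n + 1)) ℂ) = 2 := map_ofNat C 2
  rw [e5] at e4
  rw [e2]
  linear_combination (-C 2⁻¹ * C q * C q) * hg + (-2 * C 2⁻¹ * f) * e3 - f * e4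

/-- The eigenvectors of the bulk Hecke generators are divisible by the linear forms: the relation
for `i, i + 1` gives the divisibility by the form of this pair, and it carries the divisibility
by the form of `k, i` over to that of `k, i + 1`. -/
lemma linForm_dvd_of_eigenvector {q : ℂ} (hq : q ≠ 0) (hq2 : q ^ 2 ≠ -1)
    {f : MvPolynomial (Fin (2 * n + 1)) ℂ}
    (hf : ∀ i : Fin (2 * n), linForm q i.succ i.castSucc * f =
      linForm q i.castSucc i.succ * rename (Equiv.swap i.castSucc i.succ) f) (m : ℕ) :
    ∀ i j : Fin (2 * n + 1), j.val = i.val + m + 1 → linForm q i j ∣ f := by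
  induction m with
  | zero =>
    intro i j hij
    obtain ⟨k, rfl⟩ : ∃ k : Fin (2 * n), i = k.castSucc := ⟨⟨i.val, by omega⟩, rfl⟩
    obtain rfl : j = k.succ := Fin.ext (by simpa using hij)
    by_cases h4 : q ^ 4 = 1
    · have h2 : q ^ 2 = 1 := by
        have : (q ^ 2 - 1) * (q ^ 2 + 1) = 0 := by linear_combination h4
        rcases mul_eq_zero.1 this with h | h
        · linear_combination h
        · exact absurd (by linear_combination h) hq2
      exact linForm_dvd_of_antisymm h2 (castSucc_ne_succ k) (hf k)
    · refine ((linForm_prime hq (castSucc_ne_succ k)).dvd_or_dvd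
        (Dvd.intro _ (hf k).symm)).resolve_left ?_
      exact not_linForm_dvd hq (castSucc_ne_succ k) (castSucc_ne_succ k).symm
        (fun e => castSucc_ne_succ k e.1.symm) fun _ _ => h4
  | succ m ih =>
    intro i j hij
    obtain ⟨k, rfl⟩ : ∃ k : Fin (2 * n), j = k.succ :=
      ⟨⟨i.val + m + 1, by omega⟩, Fin.ext (by simp; omega)⟩
    rw [Fin.val_succ] at hij
    have h1 := ih i k.castSucc (by rw [Fin.val_castSucc]; omega)
    have hi1 : i ≠ k.castSucc := by
      intro e; have := congrArg Fin.val e; rw [Fin.val_castSucc] at this; omega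
    have hi2 : i ≠ k.succ := by
      intro e; have := congrArg Fin.val e; rw [Fin.val_succ] at this; omega
    have h2 := map_dvd (rename (R := ℂ) (Equiv.swap k.castSucc k.succ)) h1
    rw [rename_linForm, Equiv.swap_apply_left, Equiv.swap_apply_of_ne_of_ne hi1 hi2] at h2
    have h3 := h2.mul_left (linForm q k.castSucc k.succ)
    rw [← hf k] at h3
    refine ((linForm_prime hq hi2).dvd_or_dvd h3).resolve_left ?_
    exact not_linForm_dvd hq hi2 (castSucc_ne_succ k).symm (fun e => hi2 e.1.symm)
      fun _ e => absurd e.symm hi1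

/-- The eigenvectors of the bulk Hecke generators are divisible by the base entry. -/
lemma baseEntry_dvd {q : ℂ} (hq : q ≠ 0) (hq2 : q ^ 2 ≠ -1)
    {f : MvPolynomial (Fin (2 * n + 1)) ℂ}
    (hf : ∀ i : Fin (2 * n), linForm q i.succ i.castSucc * f =
      linForm q i.castSucc i.succ * rename (Equiv.swap i.castSucc i.succ) f) :
    baseEntry n q ∣ f := by
  rw [baseEntry_eq]
  have key : ∀ s ⊆ pairs n, ∏ p ∈ s, linForm q p.1 p.2 ∣ f := by
    intro s hs
    induction s using Finset.induction_on with
    | empty => simp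
    | insert p s hp ih =>
      have hp' : p.1 < p.2 := (Finset.mem_filter.1 (hs (Finset.mem_insert_self p s))).2
      obtain ⟨g, hg⟩ := ih fun x hx => hs (Finset.mem_insert_of_mem hx)
      rw [Finset.prod_insert hp, mul_comm (linForm q p.1 p.2), hg]
      refine mul_dvd_mul_left _ ?_
      have h1 := linForm_dvd_of_eigenvector hq hq2 hf (p.2.val - p.1.val - 1) p.1 p.2
        (by have : p.1.val < p.2.val := hp'
            omega)
      rw [hg] at h1
      refine ((linForm_prime hq hp'.ne).dvd_or_dvd h1).resolve_left fun h2 => ?_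
      obtain ⟨x, hx, h3⟩ := (Prime.dvd_finsetProd_iff (linForm_prime hq hp'.ne) _).1 h2
      have hx' : x.1 < x.2 := (Finset.mem_filter.1 (hs (Finset.mem_insert_of_mem hx))).2
      refine not_linForm_dvd hq hp'.ne hx'.ne (fun e => ?_) (fun e1 e2 => ?_) h3
      · exact hp ((Prod.ext e.1 e.2 : x = p) ▸ hx)
      · rw [e1, e2] at hx'
        exact absurd hx' hp'.not_gt
  exact key _ subset_rfl

end Base

end
end CqKZ

namespace CqKZ

noncomputable section

/-! ### A partial fraction identity -/

section Lagrange

variable {ι : Type} [DecidableEq ι]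

/-- The result of moving the boundary operator through the sites `s` to a site with coordinate
`x`, when the boundary operator multiplies by `γ` of the last coordinate. -/
def tailSum (q : ℂ) (γ : ℂ → ℂ) (s : Finset ι) (v : ι → ℂ) (x : ℂ) : ℂ :=
  (∏ l ∈ s, (q * v l - q⁻¹ * x)) / (∏ l ∈ s, (v l - x)) * γ x +
    ∑ j ∈ s, x / v j * ((∏ l ∈ s, (q * v l - q⁻¹ * v j)) /
      ((x - v j) * ∏ l ∈ s.erase j, (v l - v j))) * γ (v j)

lemma tailSum_congr {q : ℂ} {γ : ℂ → ℂ} {s : Finset ι} {v v' : ι → ℂ} {x : ℂ}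
    (h : ∀ l ∈ s, v l = v' l) : tailSum q γ s v x = tailSum q γ s v' x := by
  have e : ∀ y, ∏ l ∈ s, (q * v l - q⁻¹ * y) = ∏ l ∈ s, (q * v' l - q⁻¹ * y) := fun y =>
    Finset.prod_congr rfl fun l hl => by rw [h l hl]
  rw [tailSum, tailSum, e]
  have e' : ∀ t ⊆ s, ∀ y, ∏ l ∈ t, (v l - y) = ∏ l ∈ t, (v' l - y) := fun t ht y =>
    Finset.prod_congr rfl fun l hl => by rw [h l (ht hl)]
  rw [e' s subset_rfl]
  congr 1
  refine Finset.sum_congr rfl fun j hj => ?_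
  rw [h j hj, e, e' _ (Finset.erase_subset j s)]

/-- Moving the boundary operator through one more site `b` is the action of a bulk generator. -/
lemma tailSum_insert (q : ℂ) (γ : ℂ → ℂ) {s : Finset ι} {v : ι → ℂ} {x : ℂ} {b : ι} (hb : b ∉ s)
    (hxb : x ≠ v b) (hx : ∀ l ∈ s, x ≠ v l) (hv : ∀ l ∈ s, v b ≠ v l) (hb0 : v b ≠ 0) :
    (v b - x) * tailSum q γ (insert b s) v x =
      (q * v b - q⁻¹ * x) * tailSum q γ s v x - (q - q⁻¹) * x * tailSum q γ s v (v b) := by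
  have h1 : v b - x ≠ 0 := sub_ne_zero.2 hxb.symm
  have h2 : x - v b ≠ 0 := sub_ne_zero.2 hxb
  simp only [tailSum]
  rw [Finset.prod_insert hb, Finset.prod_insert hb, Finset.sum_insert hb, Finset.erase_insert hb,
    Finset.prod_insert hb]
  have hsum : (v b - x) * ∑ j ∈ s, x / v j * ((∏ l ∈ insert b s, (q * v l - q⁻¹ * v j)) /
      ((x - v j) * ∏ l ∈ (insert b s).erase j, (v l - v j))) * γ (v j) =
      (q * v b - q⁻¹ * x) * (∑ j ∈ s, x / v j * ((∏ l ∈ s, (q * v l - q⁻¹ * v j)) /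
        ((x - v j) * ∏ l ∈ s.erase j, (v l - v j))) * γ (v j)) -
      (q - q⁻¹) * x * ∑ j ∈ s, v b / v j * ((∏ l ∈ s, (q * v l - q⁻¹ * v j)) /
        ((v b - v j) * ∏ l ∈ s.erase j, (v l - v j))) * γ (v j) := by
    rw [Finset.mul_sum, Finset.mul_sum, Finset.mul_sum, ← Finset.sum_sub_distrib]
    refine Finset.sum_congr rfl fun j hj => ?_
    have hbj : b ≠ j := by rintro rfl; exact hb hj
    have h3 : x - v j ≠ 0 := sub_ne_zero.2 (hx j hj)
    have h4 : v b - v j ≠ 0 := sub_ne_zero.2 (hv j hj)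
    rw [Finset.prod_insert hb, Finset.erase_insert_of_ne hbj,
      Finset.prod_insert fun h => hb (Finset.mem_of_mem_erase h)]
    simp only [div_eq_mul_inv, mul_inv]
    generalize (∏ l ∈ s.erase j, (v l - v j))⁻¹ = D
    generalize (v j)⁻¹ = J
    generalize ∏ l ∈ s, (q * v l - q⁻¹ * v j) = P
    generalize q⁻¹ = p
    field_simp
    ring
  rw [mul_add, mul_add, hsum]
  simp only [div_eq_mul_inv, mul_inv]
  generalize (∏ l ∈ s, (v l - x))⁻¹ = D
  generalize (∏ l ∈ s, (v l - v b))⁻¹ = D'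
  generalize q⁻¹ = p
  field_simp
  ring

open Polynomial in
/-- The value of the full sum, by Lagrange interpolation at the nodes `v l` of a polynomial whose
value is wanted at `q² v a`. -/
lemma tailSum_eq {q : ℂ} (hq : q ≠ 0) {S : Finset ι} {m : ℕ} (hS : S.card = 2 * m + 1) {a : ι}
    (ha : a ∈ S) {v : ι → ℂ} (hinj : Set.InjOn v S) (h0 : ∀ l ∈ S, v l ≠ 0)
    (h1 : ∀ l ∈ S, v l ^ 2 ≠ 1) (hD : ∀ i ∈ S, ∀ l ∈ S, q * v l ≠ q⁻¹ * v i)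
    (h4 : q ^ 4 * v a ^ 2 ≠ 1) :
    -q * tailSum q (fun u => (q - q⁻¹) * u * ((∏ l ∈ S, (q * u * v l - q⁻¹)) /
      (∏ l ∈ S, (q * v l - q⁻¹ * u)) - u) / (1 - u ^ 2)) (S.erase a) v (v a) *
        ∏ l ∈ S.erase a, (q * v a - q⁻¹ * v l) =
      ∏ l ∈ S.erase a, (q⁻¹ ^ 2 - q ^ 2 * (v a * v l)) := by
  set Np : ℂ[X] := ∏ l ∈ S, (C (q * v l) * X - C q⁻¹) with hNp
  set Dp : ℂ[X] := ∏ l ∈ S, (C (q * v l) - C q⁻¹ * X) with hDp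
  have hNe : ∀ u, Np.eval u = ∏ l ∈ S, (q * u * v l - q⁻¹) := by
    intro u
    simp only [hNp, eval_prod, eval_sub, eval_mul, eval_C, eval_X]
    exact Finset.prod_congr rfl fun l _ => by ring
  have hDe : ∀ u, Dp.eval u = ∏ l ∈ S, (q * v l - q⁻¹ * u) := by
    intro u
    simp only [hDp, eval_prod, eval_sub, eval_mul, eval_C, eval_X]
  -- the numerator vanishes at `1` and `-1`
  have hr1 : (X - C 1 : ℂ[X]) ∣ Np - X * Dp := by
    rw [dvd_iff_isRoot, IsRoot, eval_sub, eval_mul, eval_X, hNe, hDe]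
    simp
  have hr2 : (X - C (-1) : ℂ[X]) ∣ Np - X * Dp := by
    rw [dvd_iff_isRoot, IsRoot, eval_sub, eval_mul, eval_X, hNe, hDe]
    have : ∏ l ∈ S, (q * (-1) * v l - q⁻¹) = ∏ l ∈ S, (-1) * (q * v l - q⁻¹ * (-1)) :=
      Finset.prod_congr rfl fun l _ => by ring
    rw [this, Finset.prod_mul_distrib, Finset.prod_const, hS, pow_succ, pow_mul]
    ring
  have hcop : IsCoprime (X - C 1 : ℂ[X]) (X - C (-1)) :=
    isCoprime_X_sub_C_of_isUnit_sub (by norm_num)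
  obtain ⟨g, hg⟩ := hcop.mul_dvd hr1 hr2
  set h : ℂ[X] := -g with hh
  have hgh : (1 - X ^ 2) * h = Np - X * Dp := by
    rw [hg, hh, C_neg, C_1]; ring
  have hev : ∀ u, (1 - u ^ 2) * h.eval u =
      (∏ l ∈ S, (q * u * v l - q⁻¹)) - u * ∏ l ∈ S, (q * v l - q⁻¹ * u) := by
    intro u
    have := congrArg (eval u) hgh
    simpa [hNe, hDe] using this
  have hdeg : h.degree < S.card := by
    by_cases hz : h = 0
    · rw [hz, degree_zero]; exact WithBot.bot_lt_coe _
    rw [degree_eq_natDegree hz, Nat.cast_lt]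
    have e1 : (1 - X ^ 2 : ℂ[X]).natDegree = 2 := by compute_degree!
    have e2 : (1 - X ^ 2 : ℂ[X]) ≠ 0 := by intro e; rw [e] at e1; simp at e1
    have e3 := congrArg natDegree hgh
    rw [natDegree_mul e2 hz, e1] at e3
    have e4 : Np.natDegree ≤ S.card := by
      refine (natDegree_prod_le _ _).trans ?_
      rw [Finset.card_eq_sum_ones]
      exact Finset.sum_le_sum fun l _ => by compute_degree
    have e5 : Dp.natDegree ≤ S.card := by
      refine (natDegree_prod_le _ _).trans ?_
      rw [Finset.card_eq_sum_ones]
      exact Finset.sum_le_sum fun l _ => by compute_degree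
    have e6 : (X * Dp : ℂ[X]).natDegree ≤ S.card + 1 := by
      refine natDegree_mul_le.trans ?_
      rw [natDegree_X]; omega
    have e7 := natDegree_sub_le Np (X * Dp)
    have e8 : max Np.natDegree (X * Dp : ℂ[X]).natDegree ≤ S.card + 1 := max_le (by omega) e6
    omega
  -- interpolation
  have hqv : ∀ l ∈ S, q ^ 2 * v a ≠ v l := by
    intro l hl e
    apply hD l hl a ha
    rw [← e]; field_simp
  have hint := congrArg (eval (q ^ 2 * v a)) (Lagrange.eq_interpolate hinj hdeg)
  rw [Lagrange.eval_interpolate_not_at_node _ hqv, Lagrange.eval_nodal] at hint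
  have hx := hev (q ^ 2 * v a)
  have hDz : ∏ l ∈ S, (q * v l - q⁻¹ * (q ^ 2 * v a)) = 0 :=
    Finset.prod_eq_zero ha (by field_simp; ring)
  rw [hDz, mul_zero, sub_zero] at hx
  have hw : ∀ j ∈ S, Lagrange.nodalWeight S v j = (∏ l ∈ S.erase j, (v l - v j))⁻¹ := by
    intro j hj
    rw [Lagrange.nodalWeight, Finset.prod_inv_distrib]
    have : ∏ l ∈ S.erase j, (v j - v l) = ∏ l ∈ S.erase j, (-1) * (v l - v j) :=
      Finset.prod_congr rfl fun l _ => by ring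
    rw [this, Finset.prod_mul_distrib, Finset.prod_const, Finset.card_erase_of_mem hj, hS,
      Nat.add_sub_cancel, pow_mul]
    norm_num
  have hD' : ∀ j ∈ S, ∏ l ∈ S, (q * v l - q⁻¹ * v j) ≠ 0 := fun j hj =>
    Finset.prod_ne_zero_iff.2 fun l hl => sub_ne_zero.2 (hD j hj l hl)
  have hγ : ∀ j ∈ S, (q - q⁻¹) * v j * ((∏ l ∈ S, (q * v j * v l - q⁻¹)) /
      (∏ l ∈ S, (q * v l - q⁻¹ * v j)) - v j) / (1 - v j ^ 2) =
      (q - q⁻¹) * v j * h.eval (v j) / ∏ l ∈ S, (q * v l - q⁻¹ * v j) := by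
    intro j hj
    have e1 := hev (v j)
    have e2 : 1 - v j ^ 2 ≠ 0 := sub_ne_zero.2 (h1 j hj).symm
    have e3 := hD' j hj
    rw [div_eq_div_iff e2 e3]
    generalize ∏ l ∈ S, (q * v l - q⁻¹ * v j) = D at *
    have e4 := div_mul_cancel₀ (∏ l ∈ S, (q * v j * v l - q⁻¹)) e3
    linear_combination (-(q - q⁻¹) * v j) * e1 + (q - q⁻¹) * v j * e4
  have hxa : q ^ 2 * v a - v a ≠ 0 := sub_ne_zero.2 (hqv a ha)
  have hq1 : q - q⁻¹ ≠ 0 := by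
    intro e
    apply hxa
    have : q ^ 2 * v a - v a = q * (q - q⁻¹) * v a := by field_simp
    rw [this, e]; ring
  have hsum : tailSum q (fun u => (q - q⁻¹) * u * ((∏ l ∈ S, (q * u * v l - q⁻¹)) /
      (∏ l ∈ S, (q * v l - q⁻¹ * u)) - u) / (1 - u ^ 2)) (S.erase a) v (v a) =
      v a * (q - q⁻¹) * q * ∑ j ∈ S, Lagrange.nodalWeight S v j * (q ^ 2 * v a - v j)⁻¹ *
        h.eval (v j) := by
    rw [tailSum, Finset.mul_sum, ← Finset.add_sum_erase _ _ ha]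
    congr 1
    · rw [hγ a ha, hw a ha, ← Finset.mul_prod_erase _ _ ha]
      have e1 := hD' a ha
      rw [← Finset.mul_prod_erase _ _ ha] at e1
      have e2 := right_ne_zero_of_mul e1
      have e3 := h0 a ha
      have e4 : q * v a - q⁻¹ * v a = (q - q⁻¹) * v a := by ring
      have e5 : q ^ 2 * v a - v a = (q - q⁻¹) * (q * v a) := by field_simp
      rw [e4, e5]
      generalize ∏ l ∈ S.erase a, (q * v l - q⁻¹ * v a) = D at *
      simp only [div_eq_mul_inv, mul_inv]
      generalize (∏ l ∈ S.erase a, (v l - v a))⁻¹ = D'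
      generalize q - q⁻¹ = p at *
      field_simp
    · refine Finset.sum_congr rfl fun j hj => ?_
      have hjS := Finset.mem_of_mem_erase hj
      have haj : a ∈ S.erase j := Finset.mem_erase.2 ⟨(Finset.ne_of_mem_erase hj).symm, ha⟩
      rw [hγ j hjS, hw j hjS, ← Finset.mul_prod_erase _ _ haj, Finset.erase_right_comm,
        ← Finset.mul_prod_erase S (fun l => q * v l - q⁻¹ * v j) ha]
      have e1 := hD' j hjS
      rw [← Finset.mul_prod_erase _ _ ha] at e1
      have e2 := right_ne_zero_of_mul e1
      have e3 := h0 j hjS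
      have e5 : q * v a - q⁻¹ * v j = q⁻¹ * (q ^ 2 * v a - v j) := by field_simp
      have e6 : q ^ 2 * v a - v j ≠ 0 := sub_ne_zero.2 (hqv j hjS)
      rw [e5]
      generalize ∏ l ∈ S.erase a, (q * v l - q⁻¹ * v j) = D at *
      simp only [div_eq_mul_inv, mul_inv]
      generalize (∏ l ∈ (S.erase a).erase j, (v l - v j))⁻¹ = D'
      generalize q - q⁻¹ = p at *
      generalize q ^ 2 * v a - v j = y at *
      field_simp
  rw [hsum]
  have hcard : (S.erase a).card = 2 * m := by rw [Finset.card_erase_of_mem ha, hS]; rfl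
  -- all products are compared with those of `q² v a - v l` and of `q³ v a v l - q⁻¹`
  have hP : ∏ l ∈ S.erase a, (q ^ 2 * v a - v l) =
      q ^ (2 * m) * ∏ l ∈ S.erase a, (q * v a - q⁻¹ * v l) := by
    rw [← hcard, ← Finset.prod_const, ← Finset.prod_mul_distrib]
    exact Finset.prod_congr rfl fun l _ => by field_simp
  have hR : q ^ (2 * m) * ∏ l ∈ S.erase a, (q⁻¹ ^ 2 - q ^ 2 * (v a * v l)) =
      ∏ l ∈ S.erase a, (q * (q ^ 2 * v a) * v l - q⁻¹) := by
    have e : ∀ l, q * (q ^ 2 * v a) * v l - q⁻¹ = (-1) * (q * (q⁻¹ ^ 2 - q ^ 2 * (v a * v l))) := by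
      intro l; field_simp; ring
    simp only [e]
    rw [Finset.prod_mul_distrib, Finset.prod_mul_distrib, Finset.prod_const, Finset.prod_const,
      hcard, pow_mul (-1 : ℂ)]
    norm_num
  rw [← Finset.mul_prod_erase _ _ ha] at hx hint
  rw [← hR] at hx
  rw [hP] at hint
  have h4' : 1 - q ^ 4 * v a ^ 2 ≠ 0 := sub_ne_zero.2 h4.symm
  have hqm : q ^ (2 * m) ≠ 0 := pow_ne_zero _ hq
  generalize ∏ l ∈ S.erase a, (q⁻¹ ^ 2 - q ^ 2 * (v a * v l)) = R at *
  generalize ∏ l ∈ S.erase a, (q * v a - q⁻¹ * v l) = P at *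
  generalize ∑ j ∈ S, Lagrange.nodalWeight S v j * (q ^ 2 * v a - v j)⁻¹ * h.eval (v j) = Z at *
  generalize h.eval (q ^ 2 * v a) = H at *
  have e7 : q * (q ^ 2 * v a) * v a - q⁻¹ = -q⁻¹ * (1 - q ^ 4 * v a ^ 2) := by field_simp; ring
  have hx' : H = -q⁻¹ * (q ^ (2 * m) * R) := by
    apply mul_left_cancel₀ h4'
    rw [e7] at hx
    linear_combination hx
  rw [hx'] at hint
  apply mul_left_cancel₀ hqm
  have e8 : q * q⁻¹ = 1 := mul_inv_cancel₀ hq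
  linear_combination q * hint + (q ^ (2 * m) * R + q ^ (2 * m) * P * q * v a * Z) * e8

end Lagrange

end
end CqKZ

namespace CqKZ
open OpenLinkPattern MvPolynomial

noncomputable section

/-! ### The spin vector of polynomials -/

section HeckeModule

variable {n : ℕ} {q : ℂ}

/-- The bulk generators indexed by natural numbers (and `0` out of range). -/
def bulkT (n : ℕ) (q : ℂ) (k : ℕ) : Module.End ℂ (Box n) :=
  if h : k < 2 * n then heckeT n q (Fin.castSucc ⟨k, h⟩) else 0

/-- The boundary generator, normalised so that it turns an up spin at the last site into a
down spin. -/
def lastT (n : ℕ) (q : ℂ) : Module.End ℂ (Box n) := (-q) • heckeT n q (Fin.last (2 * n))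

lemma bulkT_of_lt {k : ℕ} (h : k < 2 * n) : bulkT n q k = heckeT n q (Fin.castSucc ⟨k, h⟩) :=
  dif_pos h

lemma bulkT_val (i : Fin (2 * n)) : bulkT n q i.val = heckeT n q i.castSucc := bulkT_of_lt i.isLt

lemma typeCBraid (n : ℕ) (q : ℂ) : TypeCBraid (2 * n) (bulkT n q) (lastT n q) where
  comm i j hij hj := by
    rw [bulkT_of_lt (show i < 2 * n by omega), bulkT_of_lt hj]
    exact heckeT_comm q _ _ hij
  comm_last i hi := by
    rw [bulkT_of_lt (show i < 2 * n by omega), lastT, mul_smul_comm, smul_mul_assoc,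
      heckeT_comm_last q _ hi]
  braid i hi := by
    rw [bulkT_of_lt (show i < 2 * n by omega), bulkT_of_lt hi]
    exact heckeT_braid q _ _ rfl
  braid_last i hi := by
    rw [bulkT_of_lt (show i < 2 * n by omega), lastT]
    simp only [mul_smul_comm, smul_mul_assoc]
    rw [heckeT_braid_last q _ hi]

/-- The base entry as an element of `Box n`. -/
def baseBox (n : ℕ) (hq : q ≠ 0) : Box n := ⟨baseEntry n q, baseEntry_mem_box hq⟩

lemma heckeT_eq_smul_iff (i : Fin (2 * n)) (f : Box n) :
    heckeT n q i.castSucc f = q • f ↔ linForm q i.succ i.castSucc * f.1 =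
      linForm q i.castSucc i.succ * rename (Equiv.swap i.castSucc i.succ) f.1 := by
  have h := heckeT_castSucc q i f
  have hr : (reflect n i.castSucc f).1 = rename (Equiv.swap i.castSucc i.succ) f.1 := by
    simp only [reflect, Fin.lastCases_castSucc]; rfl
  rw [hr] at h
  have e : linForm q i.succ i.castSucc * f.1 = (X i.succ - X i.castSucc) * (C q * f.1) +
      C (q - q⁻¹) * X i.castSucc * f.1 := by
    rw [linForm, C_sub]; ring
  constructor
  · intro h'
    rw [h', Submodule.coe_smul, smul_eq_C_mul] at h
    rw [e, h, linForm]; ring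
  · intro h'
    apply Subtype.ext
    apply mul_left_cancel₀ (X_sub_X_ne_zero (castSucc_ne_succ i))
    rw [h, Submodule.coe_smul, smul_eq_C_mul]
    rw [e, linForm] at h'
    linear_combination -h'

lemma bulkT_baseBox (hq : q ≠ 0) (i : ℕ) (hi : i < 2 * n) :
    bulkT n q i (baseBox n hq) = q • baseBox n hq := by
  rw [bulkT_of_lt hi, heckeT_eq_smul_iff]
  exact linForm_mul_baseEntry q _

/-- A spin configuration extended to the natural numbers. -/
def extSpin (ε : Spin n) (k : ℕ) : Bool := if h : k < 2 * n + 1 then ε ⟨k, h⟩ else true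

lemma extSpin_val (ε : Spin n) (x : Fin (2 * n + 1)) : extSpin ε x.val = ε x := dif_pos x.isLt

/-- The spin vector generated from the vector `f` with all spins up. -/
def spinPoly (n : ℕ) (q : ℂ) (f : Box n) (ε : Spin n) : Box n :=
  spinPrefix (2 * n) (bulkT n q) (lastT n q) f (extSpin ε) (2 * n + 1)

lemma heckeT_sq_apply (hq : q ≠ 0) (i : Fin (2 * n + 1)) (f : Box n) :
    heckeT n q i (heckeT n q i f) = (q - q⁻¹) • heckeT n q i f + f := by
  have : heckeT n q i * heckeT n q i = (q - q⁻¹) • heckeT n q i + 1 := by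
    refine Fin.lastCases ?_ (fun i => ?_) i
    · exact heckeT_sq_last hq
    · exact heckeT_sq_castSucc hq i
  exact DFunLike.congr_fun this f

/-- On the spin vector generated from an eigenvector, the Hecke generators act by the
Temperley–Lieb generators of the spin chain. -/
lemma heckeT_spinPoly {κ : ℂ} (hκ : κ ≠ 0) {f : Box n}
    (hf : ∀ i, i < 2 * n → bulkT n (κ ^ 2) i f = κ ^ 2 • f) (i : Fin (2 * n)) (ε : Spin n) :
    heckeT n (κ ^ 2) i.castSucc (spinPoly n (κ ^ 2) f ε) =
      κ ^ 2 • spinPoly n (κ ^ 2) f ε +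
        bulkSpin κ i.castSucc i.succ (spinPoly n (κ ^ 2) f) ε := by
  have hq : κ ^ 2 ≠ 0 := pow_ne_zero 2 hκ
  have h1 : ∀ ε : Spin n, extSpin ε i.val = ε i.castSucc := fun ε => extSpin_val ε i.castSucc
  have h2 : ∀ ε : Spin n, extSpin ε (i.val + 1) = ε i.succ := fun ε => extSpin_val ε i.succ
  -- the case of an up spin followed by a down spin
  have key : ∀ ε : Spin n, ε i.castSucc = true → ε i.succ = false →
      heckeT n (κ ^ 2) i.castSucc (spinPoly n (κ ^ 2) f ε) =
        spinPoly n (κ ^ 2) f (ε ∘ Equiv.swap i.castSucc i.succ) := by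
    intro ε e1 e2
    rw [← bulkT_val]
    refine (typeCBraid n (κ ^ 2)).apply_spin_of_ne i.isLt (by rw [h1, e1]) (by rw [h2, e2])
      (by rw [h1]; simp [e2]) (by rw [h2]; simp [e1]) fun j hj1 hj2 => ?_
    by_cases hj : j < 2 * n + 1
    · rw [extSpin, extSpin, dif_pos hj, dif_pos hj, Function.comp_apply,
        Equiv.swap_apply_of_ne_of_ne]
      · exact fun e => hj1 (congrArg Fin.val e)
      · exact fun e => hj2 (congrArg Fin.val e)
    · rw [extSpin, extSpin, dif_neg hj, dif_neg hj]
  by_cases hε : ε i.castSucc = ε i.succ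
  · rw [bulkSpin, if_pos hε, add_zero, ← bulkT_val]
    exact (typeCBraid n (κ ^ 2)).apply_spin_of_eq hf _ i.isLt (by rw [h1, h2, hε])
  · rw [bulkSpin, if_neg hε]
    cases e1 : ε i.castSucc
    · have e2 : ε i.succ = true := by rw [e1] at hε; simpa using hε
      have h3 := key (ε ∘ Equiv.swap i.castSucc i.succ) (by simp [e2]) (by simp [e1])
      rw [comp_swap_comp_swap] at h3
      have h4 := heckeT_sq_apply hq i.castSucc
        (spinPoly n (κ ^ 2) f (ε ∘ Equiv.swap i.castSucc i.succ))
      rw [h3] at h4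
      rw [h4]
      simp only [spinSign, Bool.not_false, if_true, Bool.false_eq_true, if_false]
      match_scalars <;> field_simp
      ring
    · have e2 : ε i.succ = false := by rw [e1] at hε; simpa using hε
      rw [key ε e1 e2]
      simp only [spinSign, Bool.not_true, if_true, Bool.false_eq_true, if_false]
      match_scalars <;> field_simp
      ring

lemma heckeT_last_spinPoly (hq : q ≠ 0) (f : Box n) (ε : Spin n) :
    heckeT n q (Fin.last (2 * n)) (spinPoly n q f ε) =
      q • spinPoly n q f ε + lastSpin q (spinPoly n q f) ε := by
  have key : lastT n q (spinPoly n q f (Function.update ε (Fin.last (2 * n)) true)) =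
      spinPoly n q f (Function.update ε (Fin.last (2 * n)) false) := by
    have h1 : ∀ ε : Spin n, extSpin ε (2 * n) = ε (Fin.last (2 * n)) := fun ε =>
      extSpin_val ε (Fin.last (2 * n))
    refine apply_spin_last (by rw [h1]; simp) (by rw [h1]; simp) fun j hj => ?_
    have hj' : j < 2 * n + 1 := by omega
    have hne : (⟨j, hj'⟩ : Fin (2 * n + 1)) ≠ Fin.last (2 * n) := fun e => by
      have := congrArg Fin.val e
      simp at this
      omega
    rw [extSpin, extSpin, dif_pos hj', dif_pos hj', Function.update_of_ne hne,
      Function.update_of_ne hne]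
  rw [lastT, LinearMap.smul_apply] at key
  have h1 : heckeT n q (Fin.last (2 * n))
      (spinPoly n q f (Function.update ε (Fin.last (2 * n)) true)) =
      -q⁻¹ • spinPoly n q f (Function.update ε (Fin.last (2 * n)) false) := by
    rw [← key, smul_smul]; simp [hq]
  have h2 := heckeT_sq_apply hq (Fin.last (2 * n))
    (spinPoly n q f (Function.update ε (Fin.last (2 * n)) true))
  rw [h1, map_smul] at h2
  rw [lastSpin]
  cases e : ε (Fin.last (2 * n))
  · have e' : Function.update ε (Fin.last (2 * n)) false = ε := by rw [← e]; simp
    rw [e'] at h1 h2 ⊢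
    have h3 : heckeT n q (Fin.last (2 * n)) (spinPoly n q f ε) = -q •
        (-q⁻¹ • heckeT n q (Fin.last (2 * n)) (spinPoly n q f ε)) := by
      rw [smul_smul]; simp [hq]
    rw [h3, h2]
    match_scalars <;> field_simp
    ring
  · have e' : Function.update ε (Fin.last (2 * n)) true = ε := by rw [← e]; simp
    rw [e'] at h1 ⊢
    rw [h1]
    match_scalars <;> field_simp
    ring

/-- The spins `ε` on the sites before `k`, and up spins on the others. -/
def upFrom (k : ℕ) (ε : Spin n) : Spin n := fun x => if x.val < k then ε x else true

/-- A down spin created at the last site travels through up spins to the site `j`. -/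
lemma lowering_apply {G : Spin n → Box n}
    (hT : ∀ (i : Fin (2 * n)) (ε : Spin n), ε i.castSucc = true → ε i.succ = false →
      heckeT n q i.castSucc (G ε) = G (ε ∘ Equiv.swap i.castSucc i.succ))
    (hB : ∀ ε : Spin n, ε (Fin.last (2 * n)) = true →
      lastT n q (G ε) = G (Function.update ε (Fin.last (2 * n)) false)) {k : ℕ} (ε : Spin n)
    (j : Fin (2 * n + 1)) (hj : k ≤ j.val) :
    lowering (2 * n) (bulkT n q) (lastT n q) j.val (G (upFrom k ε)) =
      G (Function.update (upFrom k ε) j false) := by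
  induction j using Fin.reverseInduction with
  | last =>
    have : ¬ (2 * n < k) := by simpa using hj
    rw [Fin.val_last, lowering_last, hB _ (by simp [upFrom, this])]
  | cast i ih =>
    rw [Fin.val_castSucc] at hj ⊢
    have ih := ih (by rw [Fin.val_succ]; omega)
    rw [Fin.val_succ] at ih
    rw [lowering_of_lt i.isLt, Module.End.mul_apply, ih, bulkT_val, hT]
    · congr 1
      funext x
      rw [Function.comp_apply, Equiv.swap_apply_def]
      have hu : ∀ y : Fin (2 * n + 1), k ≤ y.val → upFrom k ε y = true := fun y hy => by
        simp [upFrom, hy]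
      split_ifs with h1 h2
      · rw [h1]; simp
      · rw [h2, Function.update_of_ne (castSucc_ne_succ i), Function.update_of_ne
          (castSucc_ne_succ i).symm, hu _ (by simpa using hj), hu _ (by simp; omega)]
      · rw [Function.update_of_ne h1, Function.update_of_ne h2]
    · rw [Function.update_of_ne (castSucc_ne_succ i)]
      simp [upFrom, hj]
    · simp

/-- A vector on which the Hecke generators act by the spin chain is generated from its component
with all spins up. -/
lemma eq_spinPoly {κ : ℂ} (hκ : κ ≠ 0) {G : Spin n → Box n}
    (hT : ∀ (i : Fin (2 * n)) (ε : Spin n), heckeT n (κ ^ 2) i.castSucc (G ε) =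
      κ ^ 2 • G ε + bulkSpin κ i.castSucc i.succ G ε)
    (hB : ∀ ε : Spin n, heckeT n (κ ^ 2) (Fin.last (2 * n)) (G ε) =
      κ ^ 2 • G ε + lastSpin (κ ^ 2) G ε) :
    G = spinPoly n (κ ^ 2) (G fun _ => true) := by
  have hT' : ∀ (i : Fin (2 * n)) (ε : Spin n), ε i.castSucc = true → ε i.succ = false →
      heckeT n (κ ^ 2) i.castSucc (G ε) = G (ε ∘ Equiv.swap i.castSucc i.succ) := by
    intro i ε h1 h2
    rw [hT, bulkSpin, if_neg (by rw [h1, h2]; simp), h1]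
    simp only [spinSign, Bool.not_true, if_true, Bool.false_eq_true, if_false]
    match_scalars <;> field_simp
    ring
  have hB' : ∀ ε : Spin n, ε (Fin.last (2 * n)) = true →
      lastT n (κ ^ 2) (G ε) = G (Function.update ε (Fin.last (2 * n)) false) := by
    intro ε h1
    have e' : Function.update ε (Fin.last (2 * n)) true = ε := by rw [← h1]; simp
    rw [lastT, LinearMap.smul_apply, hB, lastSpin, e']
    match_scalars <;> field_simp
    ring
  funext ε
  have key : ∀ k, k ≤ 2 * n + 1 → G (upFrom k ε) =
      spinPrefix (2 * n) (bulkT n (κ ^ 2)) (lastT n (κ ^ 2)) (G fun _ => true)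
        (extSpin ε) k := by
    intro k
    induction k with
    | zero =>
      intro _
      have : upFrom 0 ε = fun _ => true := by funext x; simp [upFrom]
      rw [this, spinPrefix]
    | succ k ih =>
      intro hk
      have ih := ih (by omega)
      rw [spinPrefix, ← ih]
      have hk' : k < 2 * n + 1 := hk
      have hε : extSpin ε k = ε ⟨k, hk'⟩ := dif_pos hk'
      rw [hε]
      split_ifs with h
      · congr 1
        funext x
        by_cases hx : x.val = k
        · have : x = ⟨k, hk'⟩ := Fin.ext hx
          subst this
          simp [upFrom, h]
        · have : x.val < k + 1 ↔ x.val < k := by omega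
          simp [upFrom, this]
      · have := lowering_apply hT' hB' ε ⟨k, hk'⟩ (le_refl k)
        rw [this]
        congr 1
        funext x
        by_cases hx : x.val = k
        · have : x = ⟨k, hk'⟩ := Fin.ext hx
          subst this
          simp only [upFrom, Nat.lt_succ_self, if_true, Function.update_self]
          simpa using h
        · have h1 : x.val < k + 1 ↔ x.val < k := by omega
          rw [Function.update_of_ne fun e => hx (congrArg Fin.val e)]
          simp [upFrom, h1]
  have h1 := key (2 * n + 1) le_rfl
  rw [spinPoly, ← h1]
  congr 1
  funext x
  rw [upFrom, if_pos x.isLt]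

end HeckeModule

end
end CqKZ

namespace CqKZ
open OpenLinkPattern MvPolynomial

noncomputable section

/-! ### The affine reflection of the spin vector -/

section Affine

variable {n : ℕ} {q : ℂ}

/-- The regular points at which the base entry does not vanish, in any ordering. -/
def IsGeneric (q : ℂ) (v : Fin (2 * n + 1) → ℂ) : Prop :=
  IsRegular v ∧ ∀ i l, i ≠ l → q * v l ≠ q⁻¹ * v i

lemma ext_of_isGeneric (hq : q ≠ 0) {f g : MvPolynomial (Fin (2 * n + 1)) ℂ}
    (h : ∀ v, IsGeneric q v → q ^ 4 * v 0 ^ 2 ≠ 1 → eval v f = eval v g) : f = g := by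
  have hL : (∏ i, ∏ l ∈ Finset.univ.erase i, linForm q l i :
      MvPolynomial (Fin (2 * n + 1)) ℂ) ≠ 0 :=
    Finset.prod_ne_zero_iff.2 fun i _ => Finset.prod_ne_zero_iff.2 fun l hl =>
      linForm_ne_zero hq (Finset.ne_of_mem_erase hl)
  have hN : (1 - C (q ^ 4) * X 0 ^ 2 : MvPolynomial (Fin (2 * n + 1)) ℂ) ≠ 0 := by
    intro h
    have := congrArg (eval 0) h
    simp at this
  apply mul_left_cancel₀ (mul_ne_zero hL hN)
  refine ext_of_isRegular fun v hv => ?_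
  simp only [map_mul, map_prod, map_sub, map_one, map_pow, eval_linForm, eval_C, eval_X]
  by_cases h1 : IsGeneric q v
  · by_cases h2 : q ^ 4 * v 0 ^ 2 = 1
    · simp [h2]
    · rw [h v h1 h2]
  · have : ∃ i l, i ≠ l ∧ q * v l = q⁻¹ * v i := by
      by_contra hc
      push Not at hc
      exact h1 ⟨hv, hc⟩
    obtain ⟨i, l, hil, e⟩ := this
    rw [Finset.prod_eq_zero (Finset.mem_univ i) (Finset.prod_eq_zero
      (Finset.mem_erase.2 ⟨hil.symm, Finset.mem_univ l⟩) (sub_eq_zero.2 e))]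
    simp

lemma IsGeneric.comp_perm {v : Fin (2 * n + 1) → ℂ} (hv : IsGeneric q v)
    (e : Equiv.Perm (Fin (2 * n + 1))) : IsGeneric q (v ∘ e) :=
  ⟨hv.1.comp_perm e, fun _ _ hil => hv.2 _ _ (e.injective.ne hil)⟩

/-- The ratio of the boundary operator on the base entry to the base entry is a symmetric function
of the point `v`, evaluated at the last coordinate `u`. -/
def boundaryRatio (q : ℂ) (v : Fin (2 * n + 1) → ℂ) (u : ℂ) : ℂ :=
  (q - q⁻¹) * u * ((∏ l ∈ Finset.univ, (q * u * v l - q⁻¹)) /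
    (∏ l ∈ Finset.univ, (q * v l - q⁻¹ * u)) - u) / (1 - u ^ 2)

lemma boundaryRatio_comp (q : ℂ) (v : Fin (2 * n + 1) → ℂ) (e : Equiv.Perm (Fin (2 * n + 1))) :
    boundaryRatio q (v ∘ e) = boundaryRatio q v := by
  funext u
  have h1 := Equiv.prod_comp e fun l => q * u * v l - q⁻¹
  have h2 := Equiv.prod_comp e fun l => q * v l - q⁻¹ * u
  simp only [boundaryRatio, Function.comp_apply, h1, h2]

lemma eval_baseEntry (q : ℂ) (v : Fin (2 * n + 1) → ℂ) :
    eval v (baseEntry n q) = ∏ i, ∏ j ∈ Finset.Ioi i, (q * v i - q⁻¹ * v j) := by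
  simp [baseEntry]

lemma eval_baseEntry_first (q : ℂ) (v : Fin (2 * n + 1) → ℂ) (y : ℂ) :
    eval (Function.update v 0 y) (baseEntry n q) =
      (∏ l ∈ Finset.Ioi 0, (q * y - q⁻¹ * v l)) *
        ∏ i : Fin (2 * n), ∏ j ∈ Finset.Ioi i.succ, (q * v i.succ - q⁻¹ * v j) := by
  rw [eval_baseEntry, Fin.prod_univ_succ]
  congr 1
  · refine Finset.prod_congr rfl fun l hl => ?_
    rw [Function.update_self, Function.update_of_ne (Finset.mem_Ioi.1 hl).ne']
  · refine Finset.prod_congr rfl fun i _ => Finset.prod_congr rfl fun j hj => ?_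
    rw [Function.update_of_ne (Fin.succ_ne_zero i), Function.update_of_ne
      ((Fin.zero_le _).trans_lt (Finset.mem_Ioi.1 hj)).ne']

lemma eval_baseEntry_last (q : ℂ) (v : Fin (2 * n + 1) → ℂ) (y : ℂ) :
    eval (Function.update v (Fin.last (2 * n)) y) (baseEntry n q) =
      (∏ j : Fin (2 * n), ∏ i ∈ Finset.Iio j.castSucc, (q * v i - q⁻¹ * v j.castSucc)) *
        ∏ i ∈ Finset.Iio (Fin.last (2 * n)), (q * v i - q⁻¹ * y) := by
  rw [eval_baseEntry, Finset.prod_comm' (t' := Finset.univ) (s' := fun j => Finset.Iio j)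
    (by simp), Fin.prod_univ_castSucc]
  congr 1
  · refine Finset.prod_congr rfl fun j _ => Finset.prod_congr rfl fun i hi => ?_
    rw [Function.update_of_ne (Fin.castSucc_lt_last j).ne, Function.update_of_ne
      ((Finset.mem_Iio.1 hi).trans (Fin.castSucc_lt_last j)).ne]
  · refine Finset.prod_congr rfl fun i hi => ?_
    rw [Function.update_self, Function.update_of_ne (Finset.mem_Iio.1 hi).ne]

lemma eval_heckeT_last_baseBox (hq : q ≠ 0) {v : Fin (2 * n + 1) → ℂ} (hv : IsGeneric q v)
    (hq2 : q ^ 2 ≠ 1) :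
    eval v (heckeT n q (Fin.last (2 * n)) (baseBox n hq)).1 =
      eval v (baseEntry n q) * boundaryRatio q v (v (Fin.last (2 * n))) := by
  set L := Fin.last (2 * n) with hL
  have h0 := hv.1.1 L
  have h1 : 1 - v L ^ 2 ≠ 0 := sub_ne_zero.2 (hv.1.2.1 L).symm
  apply mul_left_cancel₀ h1
  rw [eval_heckeT_last q _ h0]
  change (q * v L ^ 2 - q⁻¹) * (v L ^ (2 * n) *
    eval (Function.update v L (v L)⁻¹) (baseEntry n q)) -
    (q - q⁻¹) * v L ^ 2 * eval v (baseEntry n q) = _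
  have hb := eval_baseEntry_last q v (v L)
  rw [Function.update_eq_self] at hb
  rw [hb, eval_baseEntry_last]
  generalize (∏ j : Fin (2 * n), ∏ i ∈ Finset.Iio j.castSucc,
    (q * v i - q⁻¹ * v j.castSucc)) = R
  have huniv : (Finset.univ : Finset (Fin (2 * n + 1))) = insert L (Finset.Iio L) := by
    ext x
    simp only [Finset.mem_univ, Finset.mem_insert, Finset.mem_Iio, true_iff]
    exact (Fin.le_last x).eq_or_lt
  have hLn : L ∉ Finset.Iio L := by simp
  rw [boundaryRatio, huniv, Finset.prod_insert hLn, Finset.prod_insert hLn]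
  have hprod : v L ^ (2 * n) * ∏ i ∈ Finset.Iio L, (q * v i - q⁻¹ * (v L)⁻¹) =
      ∏ i ∈ Finset.Iio L, (q * v L * v i - q⁻¹) := by
    have hc : (Finset.Iio L).card = 2 * n := by simp [hL]
    have h := Finset.pow_card_mul_prod (s := Finset.Iio L) (b := v L)
      (f := fun i => q * v i - q⁻¹ * (v L)⁻¹)
    rw [hc] at h
    rw [h]
    exact Finset.prod_congr rfl fun i _ => by field_simp
  have hD : ∏ i ∈ Finset.Iio L, (q * v i - q⁻¹ * v L) ≠ 0 :=
    Finset.prod_ne_zero_iff.2 fun i hi =>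
      sub_ne_zero.2 (hv.2 L i (Finset.mem_Iio.1 hi).ne')
  have hqq : q - q⁻¹ ≠ 0 := by
    intro e
    apply hq2
    rw [sub_eq_zero] at e
    nth_rewrite 1 [pow_two, e]
    exact inv_mul_cancel₀ hq
  have e1 : q * v L - q⁻¹ * v L = (q - q⁻¹) * v L := by ring
  have e2 : q * v L * v L - q⁻¹ = q * v L ^ 2 - q⁻¹ := by ring
  rw [← hprod, e1, e2]
  generalize ∏ i ∈ Finset.Iio L, (q * v i - q⁻¹ * (v L)⁻¹) = P
  generalize ∏ i ∈ Finset.Iio L, (q * v i - q⁻¹ * v L) = D at *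
  generalize q - q⁻¹ = p at *
  generalize q * v L ^ 2 - q⁻¹ = z at *
  field_simp

/-- The ratio to the base entry, which is an eigenvector of the bulk generators, is computed by
induction on the number of bulk generators that act. -/
lemma eval_lowering_baseBox (hq : q ≠ 0) (hq2 : q ^ 2 ≠ 1) (k : Fin (2 * n + 1)) :
    ∀ v : Fin (2 * n + 1) → ℂ, IsGeneric q v →
      eval v (lowering (2 * n) (bulkT n q) (lastT n q) k.val (baseBox n hq)).1 =
        -q * eval v (baseEntry n q) *
          tailSum q (boundaryRatio q v) (Finset.Ioi k) v (v k) := by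
  induction k using Fin.reverseInduction with
  | last =>
    intro v hv
    have hI : Finset.Ioi (Fin.last (2 * n)) = ∅ := by
      ext x; simp [Fin.le_last]
    rw [Fin.val_last, lowering_last, lastT, LinearMap.smul_apply, Submodule.coe_smul, smul_eval,
      eval_heckeT_last_baseBox hq hv hq2, hI]
    simp [tailSum, mul_assoc]
  | cast i ih =>
    intro v hv
    have hne : v i.succ - v i.castSucc ≠ 0 :=
      sub_ne_zero.2 (hv.1.2.2 _ _ (castSucc_ne_succ i)).1.symm
    apply mul_left_cancel₀ hne
    rw [Fin.val_castSucc, lowering_of_lt i.isLt, Module.End.mul_apply, bulkT_val,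
      eval_heckeT_castSucc]
    have e1 := ih v hv
    have e2 := ih _ (hv.comp_perm (Equiv.swap i.castSucc i.succ))
    rw [Fin.val_succ] at e1 e2
    rw [e1, e2, boundaryRatio_comp, Function.comp_apply, Equiv.swap_apply_right]
    have e3 : tailSum q (boundaryRatio q v) (Finset.Ioi i.succ)
        (v ∘ Equiv.swap i.castSucc i.succ) (v i.castSucc) =
        tailSum q (boundaryRatio q v) (Finset.Ioi i.succ) v (v i.castSucc) := by
      refine tailSum_congr fun l hl => ?_
      have hl := Finset.mem_Ioi.1 hl
      rw [Function.comp_apply, Equiv.swap_apply_of_ne_of_ne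
        (Fin.castSucc_lt_succ.trans hl).ne' hl.ne']
    have hI : Finset.Ioi i.castSucc = insert i.succ (Finset.Ioi i.succ) := by
      ext x
      simp only [Finset.mem_Ioi, Finset.mem_insert, Fin.lt_def, Fin.ext_iff, Fin.val_succ,
        Fin.val_castSucc]
      omega
    have e4 := tailSum_insert q (boundaryRatio q v) (s := Finset.Ioi i.succ) (v := v)
      (x := v i.castSucc) (b := i.succ) (by simp)
      (hv.1.2.2 _ _ (castSucc_ne_succ i)).1
      (fun l hl => (hv.1.2.2 _ _ (Fin.castSucc_lt_succ.trans (Finset.mem_Ioi.1 hl)).ne).1)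
      (fun l hl => (hv.1.2.2 _ _ (Finset.mem_Ioi.1 hl).ne).1) (hv.1.1 _)
    have e5 := congrArg (eval v) (linForm_mul_baseEntry q i)
    rw [map_mul, map_mul, eval_linForm, eval_linForm, eval_rename] at e5
    rw [e3, hI]
    linear_combination q * eval v (baseEntry n q) * e4 +
      q * tailSum q (boundaryRatio q v) (Finset.Ioi i.succ) v (v i.castSucc) * e5

/-- The lowering operator of the first site acts on the base entry as the affine reflection. -/
lemma lowering_zero_baseBox (hq : q ≠ 0) (hq2 : q ^ 2 ≠ 1) :
    lowering (2 * n) (bulkT n q) (lastT n q) 0 (baseBox n hq) =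
      invert n 0 (q ^ 3) (baseBox n hq) := by
  refine Subtype.ext (ext_of_isGeneric hq fun v hv h4 => ?_)
  have h0 := hv.1.1 0
  have h1 := eval_lowering_baseBox hq hq2 0 v hv
  rw [Fin.val_zero] at h1
  rw [h1, eval_invert (pow_ne_zero 3 hq) h0]
  change _ = (q ^ 3 * v 0) ^ (2 * n) *
    eval (Function.update v 0 (1 / ((q ^ 3) ^ 2 * v 0))) (baseEntry n q)
  have hb := eval_baseEntry_first q v (v 0)
  rw [Function.update_eq_self] at hb
  rw [hb, eval_baseEntry_first]
  generalize ∏ i : Fin (2 * n), ∏ j ∈ Finset.Ioi i.succ, (q * v i.succ - q⁻¹ * v j) = R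
  have hI : Finset.Ioi (0 : Fin (2 * n + 1)) = Finset.univ.erase 0 := by
    ext x
    simp
  have hcard : (Finset.univ.erase (0 : Fin (2 * n + 1))).card = 2 * n := by simp
  have hprod : (q ^ 3 * v 0) ^ (2 * n) *
      ∏ l ∈ Finset.univ.erase 0, (q * (1 / ((q ^ 3) ^ 2 * v 0)) - q⁻¹ * v l) =
      ∏ l ∈ Finset.univ.erase 0, (q⁻¹ ^ 2 - q ^ 2 * (v 0 * v l)) := by
    have h := Finset.pow_card_mul_prod (s := Finset.univ.erase (0 : Fin (2 * n + 1)))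
      (b := q ^ 3 * v 0) (f := fun l => q * (1 / ((q ^ 3) ^ 2 * v 0)) - q⁻¹ * v l)
    rw [hcard] at h
    rw [h]
    exact Finset.prod_congr rfl fun l _ => by field_simp
  have hqi : q ≠ q⁻¹ := by
    intro e
    apply hq2
    nth_rewrite 1 [pow_two, e]
    exact inv_mul_cancel₀ hq
  have h2 := tailSum_eq hq (S := Finset.univ) (m := n) (a := (0 : Fin (2 * n + 1))) (by simp)
    (Finset.mem_univ _) (v := v)
    (fun i _ l _ e => by
      by_contra hil
      exact (hv.1.2.2 i l hil).1 e)
    (fun l _ => hv.1.1 l) (fun l _ => hv.1.2.1 l)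
    (fun i _ l _ => by
      by_cases hil : i = l
      · subst hil
        exact fun e => hqi (mul_right_cancel₀ (hv.1.1 i) e)
      · exact hv.2 i l hil) h4
  rw [hI, ← mul_assoc ((q ^ 3 * v 0) ^ (2 * n)), hprod, ← h2]
  simp only [← boundaryRatio.eq_1]
  ring

lemma invert_heckeT_castSucc {c : ℂ} (hc : c ≠ 0) {i : Fin (2 * n)} (hi : i.val ≠ 0) (f : Box n) :
    invert n 0 c (heckeT n q i.castSucc f) = heckeT n q i.castSucc (invert n 0 c f) := by
  refine Subtype.ext (ext_of_isRegular fun v hv => ?_)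
  have h0 := hv.1 0
  have n1 : i.castSucc ≠ 0 := by
    intro e; have := congrArg Fin.val e; simp at this; exact hi (by simp [this])
  have n2 : i.succ ≠ 0 := Fin.succ_ne_zero i
  apply mul_left_cancel₀ (sub_ne_zero.2 (hv.2.2 _ _ (castSucc_ne_succ i)).1.symm)
  have h1 := eval_heckeT_castSucc q i f (Function.update v 0 (1 / (c ^ 2 * v 0)))
  have hs : Function.update v 0 (1 / (c ^ 2 * v 0)) ∘ Equiv.swap i.castSucc i.succ =
      Function.update (v ∘ Equiv.swap i.castSucc i.succ) 0 (1 / (c ^ 2 * v 0)) := by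
    funext x
    by_cases hx : x = 0
    · subst hx
      simp [Equiv.swap_apply_of_ne_of_ne n1.symm n2.symm]
    · have : Equiv.swap i.castSucc i.succ x ≠ 0 := by
        intro e
        rw [Equiv.swap_apply_eq_iff, Equiv.swap_apply_of_ne_of_ne n1.symm n2.symm] at e
        exact hx e
      simp [hx, this]
  rw [Function.update_of_ne n1, Function.update_of_ne n2, hs] at h1
  have hs0 : (v ∘ Equiv.swap i.castSucc i.succ) 0 = v 0 := by
    simp [Equiv.swap_apply_of_ne_of_ne n1.symm n2.symm]
  rw [eval_heckeT_castSucc, eval_invert hc h0, eval_invert hc h0,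
    eval_invert hc (v := v ∘ Equiv.swap i.castSucc i.succ) (by rw [hs0]; exact h0), hs0]
  linear_combination (c * v 0) ^ (2 * n) * h1

lemma invert_heckeT_last {c : ℂ} (hc : c ≠ 0) (hn : n ≠ 0) (f : Box n) :
    invert n 0 c (heckeT n q (Fin.last (2 * n)) f) =
      heckeT n q (Fin.last (2 * n)) (invert n 0 c f) := by
  refine Subtype.ext (ext_of_isRegular fun v hv => ?_)
  have h0 := hv.1 0
  have n1 : Fin.last (2 * n) ≠ 0 := by
    intro e; have := congrArg Fin.val e; simp at this; exact hn (by simp [this])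
  have hL := hv.1 (Fin.last (2 * n))
  apply mul_left_cancel₀ (sub_ne_zero.2 (hv.2.1 (Fin.last (2 * n))).symm)
  have h1 := eval_heckeT_last q f (v := Function.update v 0 (1 / (c ^ 2 * v 0)))
    (by rwa [Function.update_of_ne n1])
  rw [Function.update_of_ne n1, Function.update_comm n1.symm] at h1
  rw [eval_heckeT_last q _ hL, eval_invert hc h0, eval_invert hc h0,
    eval_invert hc (v := Function.update v (Fin.last (2 * n)) (v (Fin.last (2 * n)))⁻¹)
      (by rwa [Function.update_of_ne n1.symm]), Function.update_of_ne n1.symm]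
  linear_combination (c * v 0) ^ (2 * n) * h1

lemma invert_invert {c : ℂ} (hc : c ≠ 0) (i : Fin (2 * n + 1)) (f : Box n) :
    invert n i c (invert n i c f) = f := by
  refine Subtype.ext (ext_of_isRegular fun v hv => ?_)
  have h0 := hv.1 i
  rw [eval_invert hc h0, eval_invert hc (by simp [hc, h0])]
  have e : 1 / (c ^ 2 * Function.update v i (1 / (c ^ 2 * v i)) i) = v i := by
    rw [Function.update_self]; field_simp
  rw [e, Function.update_idem, Function.update_eq_self, Function.update_self, ← mul_assoc,
    ← mul_pow]
  have e2 : c * v i * (c * (1 / (c ^ 2 * v i))) = 1 := by field_simp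
  rw [e2, one_pow, one_mul]

lemma invert_lowering {c : ℂ} (hc : c ≠ 0) {k : ℕ} (hk : 1 ≤ k) (hk' : k ≤ 2 * n) (f : Box n) :
    invert n 0 c (lowering (2 * n) (bulkT n q) (lastT n q) k f) =
      lowering (2 * n) (bulkT n q) (lastT n q) k (invert n 0 c f) := by
  induction hk' using Nat.decreasingInduction with
  | self =>
    rw [lowering_last, lastT, LinearMap.smul_apply, LinearMap.smul_apply, map_smul,
      invert_heckeT_last hc (by omega)]
  | of_succ k hk' ih =>
    rw [lowering_of_lt (by omega), Module.End.mul_apply, Module.End.mul_apply,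
      bulkT_of_lt (by omega), invert_heckeT_castSucc hc (by simp; omega), ih (by omega)]

/-- Reversing the first spin amounts to the affine reflection. -/
lemma spinPoly_flipFirst (hq : q ≠ 0) (hq2 : q ^ 2 ≠ 1) (ε : Spin n) :
    spinPoly n q (baseBox n hq) (flipFirst ε) =
      invert n 0 (q ^ 3) (spinPoly n q (baseBox n hq) ε) := by
  have hc : q ^ 3 ≠ 0 := pow_ne_zero 3 hq
  have h0 : ∀ ε : Spin n, extSpin ε 0 = ε 0 := fun ε => extSpin_val ε 0
  have key : ∀ k, k ≤ 2 * n →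
      spinPrefix (2 * n) (bulkT n q) (lastT n q) (baseBox n hq) (extSpin (flipFirst ε)) (k + 1) =
      invert n 0 (q ^ 3)
        (spinPrefix (2 * n) (bulkT n q) (lastT n q) (baseBox n hq) (extSpin ε) (k + 1)) := by
    intro k
    induction k with
    | zero =>
      intro _
      rw [spinPrefix, spinPrefix, spinPrefix, spinPrefix, h0, h0, flipFirst, Function.update_self]
      cases ε 0
      · simp [lowering_zero_baseBox hq hq2, invert_invert hc]
      · simp [lowering_zero_baseBox hq hq2]
    | succ k ih =>
      intro hk
      have e : extSpin (flipFirst ε) (k + 1) = extSpin ε (k + 1) := by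
        have hk' : k + 1 < 2 * n + 1 := by omega
        have hne : (⟨k + 1, hk'⟩ : Fin (2 * n + 1)) ≠ 0 := by
          intro e; have := congrArg Fin.val e; simp at this
        rw [extSpin, extSpin, dif_pos hk', dif_pos hk', flipFirst, Function.update_of_ne hne]
      rw [spinPrefix, ih (by omega), e, spinPrefix.eq_def _ _ _ _ (extSpin ε) (k + 1 + 1)]
      simp only
      split_ifs
      · rfl
      · rw [invert_lowering hc (by omega) hk]
  exact key (2 * n) le_rfl

end Affine

end
end CqKZ

namespace CqKZ
open OpenLinkPattern MvPolynomial

noncomputable section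

/-! ### The invariant form on the spin chain -/

section Pairing

variable {n : ℕ} {M : Type} [AddCommGroup M] [Module ℂ M]

/-- The weights of the bilinear form on the spin chain for which the Temperley–Lieb generators
are self-adjoint. -/
def spinWeight (q : ℂ) (ε : Spin n) : ℂ := ∏ x, if ε x then 1 else q⁻¹ ^ 2

/-- The bilinear form on the spin chain for which the Temperley–Lieb generators are
self-adjoint. -/
def pairing (q : ℂ) (G : Spin n → ℂ) (H : Spin n → M) : M :=
  ∑ ε, spinWeight q ε • G ε • H ε

lemma spinWeight_comp (q : ℂ) (ε : Spin n) (e : Equiv.Perm (Fin (2 * n + 1))) :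
    spinWeight q (ε ∘ e) = spinWeight q ε :=
  Equiv.prod_comp e fun x => if ε x then 1 else q⁻¹ ^ 2

lemma pairing_bulkSpin {κ : ℂ} (hκ : κ ≠ 0) (q : ℂ) (i j : Fin (2 * n + 1)) (G : Spin n → ℂ)
    (H : Spin n → M) :
    pairing q (bulkSpin κ i j G) H = pairing q G (bulkSpin κ i j H) := by
  have hs : ∀ b, spinSign κ b * spinSign κ (!b) = -1 := by
    intro b; cases b <;> simp [spinSign, hκ]
  have e1 : ∀ (A : Spin n → ℂ) (B : Spin n → M) ε,
      spinWeight q ε • bulkSpin κ i j A ε • B ε =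
      (if ε i = ε j then (0 : M) else
        -(spinWeight q ε * spinSign κ (ε i) ^ 2) • A ε • B ε) +
      (if ε i = ε j then (0 : M) else spinWeight q ε • A (ε ∘ Equiv.swap i j) • B ε) := by
    intro A B ε
    rw [bulkSpin]
    split_ifs
    · simp
    · have := hs (ε i)
      simp only [smul_eq_mul, smul_smul, ← add_smul]
      congr 1
      linear_combination (-spinWeight q ε * A (ε ∘ Equiv.swap i j)) * this
  have e2 : ∀ ε, spinWeight q ε • G ε • bulkSpin κ i j H ε =
      (if ε i = ε j then (0 : M) else
        -(spinWeight q ε * spinSign κ (ε i) ^ 2) • G ε • H ε) +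
      (if ε i = ε j then (0 : M) else spinWeight q ε • G ε • H (ε ∘ Equiv.swap i j)) := by
    intro ε
    rw [bulkSpin]
    split_ifs
    · simp
    · have := hs (ε i)
      simp only [smul_add, smul_neg, smul_smul, neg_smul, this, neg_add, mul_one, neg_neg]
      match_scalars <;> ring
  rw [pairing, pairing, Finset.sum_congr rfl fun ε _ => e1 G H ε,
    Finset.sum_congr rfl fun ε _ => e2 ε, Finset.sum_add_distrib, Finset.sum_add_distrib]
  congr 1
  have hinv : Function.Involutive fun ε : Spin n => ε ∘ Equiv.swap i j := fun ε =>
    comp_swap_comp_swap ε i j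
  refine Fintype.sum_equiv hinv.toPerm _ _ fun ε => ?_
  simp only [Function.Involutive.coe_toPerm, Function.comp_apply, Equiv.swap_apply_left,
    Equiv.swap_apply_right, comp_swap_comp_swap, spinWeight_comp]
  simp only [eq_comm]

lemma spinWeight_update_last {q : ℂ} (hq : q ≠ 0) (ε : Spin n) :
    spinWeight q (Function.update ε (Fin.last (2 * n)) (!ε (Fin.last (2 * n)))) *
      (if ε (Fin.last (2 * n)) then q else q⁻¹) =
    spinWeight q ε * (if ε (Fin.last (2 * n)) then q⁻¹ else q) := by
  rw [spinWeight, spinWeight, ← Finset.mul_prod_erase _ _ (Finset.mem_univ (Fin.last (2 * n))),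
    ← Finset.mul_prod_erase _ (fun x => if ε x then 1 else q⁻¹ ^ 2)
      (Finset.mem_univ (Fin.last (2 * n))), Function.update_self,
    Finset.prod_congr rfl fun x hx => by
      rw [Function.update_of_ne (Finset.ne_of_mem_erase hx)]]
  cases ε (Fin.last (2 * n)) <;> simp <;> field_simp

lemma pairing_lastSpin {q : ℂ} (hq : q ≠ 0) (G : Spin n → ℂ) (H : Spin n → M) :
    pairing q (lastSpin q G) H = pairing q G (lastSpin q H) := by
  set L := Fin.last (2 * n) with hL
  set fl : Spin n → Spin n := fun ε => Function.update ε L (!ε L) with hfl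
  have e1 : ∀ (N : Type) [AddCommGroup N] [Module ℂ N] (A : Spin n → N) ε, lastSpin q A ε =
      -((if ε L then q else q⁻¹) • A ε + (if ε L then q⁻¹ else q) • A (fl ε)) := by
    intro N _ _ A ε
    have hu : Function.update ε L (ε L) = ε := Function.update_eq_self L ε
    rw [lastSpin, ← hL]
    simp only [hfl]
    cases h : ε L
    · rw [h] at hu
      rw [hu]; simp [add_comm]
    · rw [h] at hu
      rw [hu]; simp
  have hinv : Function.Involutive fl := by
    intro ε
    simp only [hfl, Function.update_self, Function.update_idem, Bool.not_not,
      Function.update_eq_self]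
  have e2 : ∑ ε, (spinWeight q ε * (if ε L then q⁻¹ else q)) • G (fl ε) • H ε =
      ∑ ε, (spinWeight q ε * (if ε L then q⁻¹ else q)) • G ε • H (fl ε) := by
    refine Fintype.sum_equiv hinv.toPerm _ _ fun ε => ?_
    simp only [Function.Involutive.coe_toPerm, hinv ε]
    congr 1
    have := spinWeight_update_last hq (fl ε)
    rw [← hL] at this
    have h2 : Function.update (fl ε) L (!fl ε L) = ε := hinv ε
    rw [h2] at this
    refine Eq.trans ?_ this
    congr 1
    simp only [hfl, Function.update_self]
    cases ε L <;> simp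
  rw [pairing, pairing]
  have e3 : ∀ ε, spinWeight q ε • lastSpin q G ε • H ε =
      -((spinWeight q ε * (if ε L then q else q⁻¹)) • G ε • H ε +
        (spinWeight q ε * (if ε L then q⁻¹ else q)) • G (fl ε) • H ε) := by
    intro ε
    rw [e1]
    simp only [smul_eq_mul, smul_smul, ← add_smul, ← neg_smul]
    congr 1
    ring
  have e4 : ∀ ε, spinWeight q ε • G ε • lastSpin q H ε =
      -((spinWeight q ε * (if ε L then q else q⁻¹)) • G ε • H ε +
        (spinWeight q ε * (if ε L then q⁻¹ else q)) • G ε • H (fl ε)) := by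
    intro ε
    rw [e1]
    simp only [smul_add, smul_neg, smul_smul]
    match_scalars <;> ring
  rw [Finset.sum_congr rfl fun ε _ => e3 ε, Finset.sum_congr rfl fun ε _ => e4 ε,
    Finset.sum_neg_distrib, Finset.sum_neg_distrib, Finset.sum_add_distrib,
    Finset.sum_add_distrib, e2]

lemma pairing_sum_left {ι : Type} (s : Finset ι) (q : ℂ) (a : ι → ℂ) (G : ι → Spin n → ℂ)
    (H : Spin n → M) :
    pairing q (fun ε => ∑ k ∈ s, a k * G k ε) H = ∑ k ∈ s, a k • pairing q (G k) H := by
  simp only [pairing, Finset.smul_sum, Finset.sum_smul]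
  rw [Finset.sum_comm]
  refine Finset.sum_congr rfl fun k _ => Finset.sum_congr rfl fun ε _ => ?_
  simp only [smul_smul]
  congr 1
  ring

lemma pairing_sum_right {ι : Type} (s : Finset ι) (q : ℂ) (a : ι → ℂ) (G : Spin n → ℂ)
    (H : ι → Spin n → M) :
    pairing q G (fun ε => ∑ k ∈ s, a k • H k ε) = ∑ k ∈ s, a k • pairing q G (H k) := by
  simp only [pairing, Finset.smul_sum]
  rw [Finset.sum_comm]
  refine Finset.sum_congr rfl fun k _ => Finset.sum_congr rfl fun ε _ => ?_
  simp only [smul_smul]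
  congr 1
  ring

end Pairing

section Generic

variable {n : ℕ} {κ : ℝ}

lemma conj_spinVec (κ : ℝ) (π : OpenLinkPattern (2 * n + 1)) (ε : Spin n) :
    star (spinVec (κ : ℂ) π ε) = spinVec (κ : ℂ) π ε := by
  have hs : ∀ b, star (spinSign (κ : ℂ) b) = spinSign (κ : ℂ) b := by
    intro b; cases b <;> simp [spinSign]
  rw [spinVec, star_prod]
  refine Finset.prod_congr rfl fun x _ => ?_
  rw [siteWeight]
  split_ifs <;> simp [hs]

/-- The Gram matrix of the spin vectors. -/
def gram (n : ℕ) (κ : ℂ) : Op n ℂ := fun π ρ => pairing (κ ^ 2) (spinVec κ π) (spinVec κ ρ)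

lemma spinWeight_real (κ : ℝ) (hκ : κ ≠ 0) (ε : Spin n) :
    ∃ d : ℝ, 0 < d ∧ spinWeight ((κ : ℂ) ^ 2) ε = d := by
  refine ⟨∏ x, if ε x then 1 else (κ ^ 2)⁻¹ ^ 2, Finset.prod_pos fun x _ => ?_, ?_⟩
  · split_ifs <;> positivity
  · rw [spinWeight]
    push_cast
    exact Finset.prod_congr rfl fun x _ => by split_ifs <;> simp

/-- The form is positive on the real span of the spin vectors. -/
lemma eq_zero_of_pairing_star {κ : ℝ} (hκ : κ ≠ 0) {G : Spin n → ℂ}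
    (h : pairing ((κ : ℂ) ^ 2) (fun ε => star (G ε)) G = 0) : G = 0 := by
  choose d hd hd' using spinWeight_real (n := n) κ hκ
  have h1 : ∀ ε, spinWeight ((κ : ℂ) ^ 2) ε • star (G ε) • G ε =
      ((d ε * Complex.normSq (G ε) : ℝ) : ℂ) := by
    intro ε
    rw [hd', smul_eq_mul, smul_eq_mul, mul_comm (star (G ε))]
    push_cast
    rw [← Complex.mul_conj]; rfl
  rw [pairing, Finset.sum_congr rfl fun ε _ => h1 ε, ← Complex.ofReal_sum,
    Complex.ofReal_eq_zero, Finset.sum_eq_zero_iff_of_nonneg fun ε _ =>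
      mul_nonneg (hd ε).le (Complex.normSq_nonneg _)] at h
  funext ε
  have := h ε (Finset.mem_univ ε)
  rcases mul_eq_zero.1 this with h2 | h2
  · exact absurd h2 (hd ε).ne'
  · exact Complex.normSq_eq_zero.1 h2

/-- The spin vectors are linearly independent and real, and the form is positive. -/
lemma gram_isUnit_det (hκ : κ ≠ 0) : IsUnit (gram n (κ : ℂ)).det := by
  have hκ' : (κ : ℂ) ≠ 0 := by exact_mod_cast hκ
  rw [isUnit_iff_ne_zero]
  intro hdet
  obtain ⟨x, hx, hx0⟩ := Matrix.exists_mulVec_eq_zero_iff.2 hdet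
  apply hx
  have h1 : (fun ε => ∑ π, x π * spinVec (κ : ℂ) π ε) = 0 := by
    apply eq_zero_of_pairing_star hκ
    have h2 : pairing ((κ : ℂ) ^ 2) (fun ε => star (∑ π, x π * spinVec (κ : ℂ) π ε))
        (fun ε => ∑ π, x π * spinVec (κ : ℂ) π ε) =
        ∑ π, star (x π) * (gram n (κ : ℂ)).mulVec x π := by
      have e1 : (fun ε => star (∑ π, x π * spinVec (κ : ℂ) π ε)) =
          fun ε => ∑ π, star (x π) * spinVec (κ : ℂ) π ε := by
        funext ε
        rw [star_sum]
        exact Finset.sum_congr rfl fun π _ => by rw [star_mul', conj_spinVec]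
      rw [e1, pairing_sum_left]
      refine Finset.sum_congr rfl fun π _ => ?_
      have e2 := pairing_sum_right Finset.univ ((κ : ℂ) ^ 2) x (spinVec (κ : ℂ) π)
        fun ρ => spinVec (κ : ℂ) ρ
      simp only [smul_eq_mul] at e2 ⊢
      rw [e2, Matrix.mulVec, dotProduct]
      congr 1
      exact Finset.sum_congr rfl fun ρ _ => mul_comm _ _
    rw [h2, hx0]
    simp
  refine eq_zero_of_sum_spinVec (n := n) hκ' fun ε => ?_
  have := congrFun h1 ε
  simp only [Pi.zero_apply] at this
  rw [← this]
  exact Finset.sum_congr rfl fun π _ => by rw [smul_eq_mul, mul_comm]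

/-- A matrix of scalars acting on a vector indexed by the patterns. -/
def matAct {M : Type} [AddCommGroup M] [Module ℂ M] (A : Op n ℂ)
    (Ψ : OpenLinkPattern (2 * n + 1) → M) (π : OpenLinkPattern (2 * n + 1)) : M :=
  ∑ ρ, A π ρ • Ψ ρ

section MatAct

variable {M : Type} [AddCommGroup M] [Module ℂ M]

lemma matAct_mul (A B : Op n ℂ) (Ψ : OpenLinkPattern (2 * n + 1) → M) :
    matAct (A * B) Ψ = matAct A (matAct B Ψ) := by
  funext π
  simp only [matAct, Matrix.mul_apply, Finset.sum_smul, Finset.smul_sum, smul_smul]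
  exact Finset.sum_comm

lemma matAct_one (Ψ : OpenLinkPattern (2 * n + 1) → M) : matAct 1 Ψ = Ψ := by
  funext π
  simp [matAct, Matrix.one_apply]

lemma map_matAct {N : Type} [AddCommGroup N] [Module ℂ N] (f : M →ₗ[ℂ] N) (A : Op n ℂ)
    (Ψ : OpenLinkPattern (2 * n + 1) → M) (π : OpenLinkPattern (2 * n + 1)) :
    f (matAct A Ψ π) = matAct A (fun ρ => f (Ψ ρ)) π := by
  simp [matAct]

end MatAct

/-- The Temperley–Lieb generators of the spin chain. -/
def spinE {M : Type} [AddCommGroup M] [Module ℂ M] (κ : ℂ) (i : Fin (2 * n + 1)) :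
    (Spin n → M) → Spin n → M :=
  Fin.lastCases (motive := fun _ => (Spin n → M) → Spin n → M) (lastSpin (κ ^ 2))
    (fun i => bulkSpin κ i.castSucc i.succ) i

section SpinE

variable {M : Type} [AddCommGroup M] [Module ℂ M]

lemma spinE_last (κ : ℂ) :
    spinE (M := M) κ (Fin.last (2 * n)) = lastSpin (κ ^ 2) := Fin.lastCases_last ..

lemma spinE_castSucc (κ : ℂ) (i : Fin (2 * n)) :
    spinE (M := M) κ i.castSucc = bulkSpin κ i.castSucc i.succ := Fin.lastCases_castSucc ..

lemma pairing_spinE {κ : ℂ} (hκ : κ ≠ 0) (i : Fin (2 * n + 1)) (G : Spin n → ℂ)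
    (H : Spin n → M) :
    pairing (κ ^ 2) (spinE κ i G) H = pairing (κ ^ 2) G (spinE κ i H) := by
  refine Fin.lastCases ?_ (fun i => ?_) i
  · rw [spinE_last, spinE_last, pairing_lastSpin (pow_ne_zero 2 hκ)]
  · rw [spinE_castSucc, spinE_castSucc, pairing_bulkSpin hκ]

lemma spinE_spinVec {κ : ℂ} (hκ : κ ≠ 0) (i : Fin (2 * n + 1)) (π : OpenLinkPattern (2 * n + 1)) :
    spinE κ i (spinVec κ π) =
      fun ε => ∑ σ, genC n (loopWeight (κ ^ 2)) i σ π * spinVec κ σ ε := by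
  funext ε
  refine Fin.lastCases ?_ (fun i => ?_) i
  · rw [spinE_last, lastSpin_spinVec hκ, genC_last, Finset.sum_eq_single π.cutLast]
    · simp [lastE]
    · intro σ _ hσ; simp [lastE, hσ]
    · simp
  · rw [spinE_castSucc, bulkSpin_spinVec hκ, genC_castSucc,
      Finset.sum_eq_single (π.join i.castSucc i.succ (by simp))]
    · simp [bulkE]
    · intro σ _ hσ; simp [bulkE, hσ]
    · simp

lemma spinE_sum {κ : ℂ} (i : Fin (2 * n + 1)) (G : OpenLinkPattern (2 * n + 1) → Spin n → ℂ)
    (Ψ : OpenLinkPattern (2 * n + 1) → M) :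
    spinE κ i (fun ε => ∑ π, G π ε • Ψ π) = fun ε => ∑ π, spinE κ i (G π) ε • Ψ π := by
  funext ε
  refine Fin.lastCases ?_ (fun i => ?_) i
  · simp only [spinE_last, lastSpin, Finset.smul_sum, ← Finset.sum_add_distrib,
      ← Finset.sum_neg_distrib]
    refine Finset.sum_congr rfl fun π _ => ?_
    simp only [smul_eq_mul]
    module
  · simp only [spinE_castSucc, bulkSpin]
    split_ifs
    · simp
    · simp only [Finset.smul_sum, ← Finset.sum_add_distrib, ← Finset.sum_neg_distrib]
      refine Finset.sum_congr rfl fun π _ => ?_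
      simp only [smul_eq_mul]
      module

end SpinE

lemma spinE_spinPoly {κ : ℂ} (hκ : κ ≠ 0) {f : Box n}
    (hf : ∀ i, i < 2 * n → bulkT n (κ ^ 2) i f = κ ^ 2 • f) (i : Fin (2 * n + 1)) (ε : Spin n) :
    heckeT n (κ ^ 2) i (spinPoly n (κ ^ 2) f ε) =
      κ ^ 2 • spinPoly n (κ ^ 2) f ε + spinE κ i (spinPoly n (κ ^ 2) f) ε := by
  refine Fin.lastCases ?_ (fun i => ?_) i
  · rw [spinE_last, heckeT_last_spinPoly (pow_ne_zero 2 hκ)]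
  · rw [spinE_castSucc, heckeT_spinPoly hκ hf]

/-- The equations of the `q`KZ system for the generators of the boundary Temperley–Lieb algebra,
with the denominators cleared. -/
def SolvesHecke (q : ℂ) (Ψ : OpenLinkPattern (2 * n + 1) → Box n) : Prop :=
  ∀ i σ, heckeT n q i (Ψ σ) = q • Ψ σ + matAct (genC n (loopWeight q) i) Ψ σ

/-- The coordinates, with respect to the spin vectors of the patterns, of the orthogonal projection
of a spin vector of polynomials to their span. -/
def projection (n : ℕ) (κ : ℂ) (F : Spin n → Box n) : OpenLinkPattern (2 * n + 1) → Box n :=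
  matAct (gram n κ)⁻¹ fun π => pairing (κ ^ 2) (spinVec κ π) F

/-- The generators are self-adjoint for the form restricted to the patterns. -/
lemma gram_mul_genC {κ : ℂ} (hκ : κ ≠ 0) (i : Fin (2 * n + 1)) :
    gram n κ * genC n (loopWeight (κ ^ 2)) i =
      (genC n (loopWeight (κ ^ 2)) i).transpose * gram n κ := by
  ext π ρ
  have h := pairing_spinE hκ i (spinVec κ π) (spinVec κ ρ)
  rw [spinE_spinVec hκ, spinE_spinVec hκ, pairing_sum_left] at h
  have h2 := pairing_sum_right Finset.univ (κ ^ 2)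
    (fun σ => genC n (loopWeight (κ ^ 2)) i σ ρ) (spinVec κ π) fun σ => spinVec κ σ
  simp only [smul_eq_mul] at h h2
  rw [h2] at h
  rw [Matrix.mul_apply, Matrix.mul_apply]
  simp only [Matrix.transpose_apply, gram]
  rw [h]
  exact Finset.sum_congr rfl fun σ _ => mul_comm _ _

/-- The orthogonal projection commutes with the self-adjoint Temperley–Lieb generators. -/
lemma projection_solvesHecke (hκ : κ ≠ 0) {f : Box n}
    (hf : ∀ i, i < 2 * n → bulkT n ((κ : ℂ) ^ 2) i f = (κ : ℂ) ^ 2 • f) :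
    SolvesHecke ((κ : ℂ) ^ 2) (projection n κ (spinPoly n ((κ : ℂ) ^ 2) f)) := by
  have hκ' : (κ : ℂ) ≠ 0 := by exact_mod_cast hκ
  intro i σ
  set F := spinPoly n ((κ : ℂ) ^ 2) f with hF
  set E := genC n (loopWeight ((κ : ℂ) ^ 2)) i with hE
  have h1 : ∀ π, heckeT n ((κ : ℂ) ^ 2) i (pairing ((κ : ℂ) ^ 2) (spinVec κ π) F) =
      (κ : ℂ) ^ 2 • pairing ((κ : ℂ) ^ 2) (spinVec κ π) F +
        matAct E.transpose (fun π => pairing ((κ : ℂ) ^ 2) (spinVec κ π) F) π := by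
    intro π
    have e1 : matAct E.transpose (fun π => pairing ((κ : ℂ) ^ 2) (spinVec κ π) F) π =
        pairing ((κ : ℂ) ^ 2) (spinE κ i (spinVec κ π)) F := by
      rw [spinE_spinVec hκ', pairing_sum_left]; rfl
    rw [e1, pairing_spinE hκ']
    simp only [pairing]
    rw [map_sum, Finset.smul_sum, ← Finset.sum_add_distrib]
    refine Finset.sum_congr rfl fun ε _ => ?_
    rw [map_smul, map_smul, hF, spinE_spinPoly hκ' hf]
    module
  have hcomm : E * (gram n (κ : ℂ))⁻¹ = (gram n (κ : ℂ))⁻¹ * E.transpose := by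
    have hu := gram_isUnit_det (n := n) hκ
    have h2 := gram_mul_genC (n := n) hκ' i
    rw [← hE] at h2
    calc E * (gram n (κ : ℂ))⁻¹
        = (gram n (κ : ℂ))⁻¹ * (gram n (κ : ℂ) * E) * (gram n (κ : ℂ))⁻¹ := by
          rw [Matrix.nonsing_inv_mul_cancel_left _ _ hu]
      _ = (gram n (κ : ℂ))⁻¹ * E.transpose := by
          rw [h2, Matrix.mul_assoc, Matrix.mul_assoc, Matrix.mul_nonsing_inv _ hu, Matrix.mul_one]
  rw [projection, map_matAct, ← matAct_mul, hcomm, matAct_mul]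
  simp only [h1]
  simp only [matAct, smul_add, Finset.sum_add_distrib, Finset.smul_sum]
  congr 1
  exact Finset.sum_congr rfl fun ρ _ => smul_comm _ _ _

lemma gram_projection (hκ : κ ≠ 0) (F : Spin n → Box n) (π : OpenLinkPattern (2 * n + 1)) :
    matAct (gram n (κ : ℂ)) (projection n κ F) π = pairing ((κ : ℂ) ^ 2) (spinVec κ π) F := by
  rw [projection, ← matAct_mul, Matrix.mul_nonsing_inv _ (gram_isUnit_det hκ), matAct_one]

end Generic

end
end CqKZ

namespace CqKZ
open OpenLinkPattern MvPolynomial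

noncomputable section

/-! ### Nonvanishing of the projection -/

section Nonvanishing

variable {n : ℕ}

/-- Evaluation at a point as a linear form on `Box n`. -/
def evalBox (v : Fin (2 * n + 1) → ℂ) : Box n →ₗ[ℂ] ℂ :=
  (aeval v).toLinearMap ∘ₗ (Box n).subtype

lemma evalBox_apply (v : Fin (2 * n + 1) → ℂ) (f : Box n) : evalBox v f = eval v f.1 := by
  simp [evalBox, aeval_eq_eval]

lemma map_spinE {M N : Type} [AddCommGroup M] [Module ℂ M] [AddCommGroup N] [Module ℂ N]
    (φ : M →ₗ[ℂ] N) (κ : ℂ) (i : Fin (2 * n + 1)) (G : Spin n → M) (ε : Spin n) :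
    φ (spinE κ i G ε) = spinE κ i (fun ε => φ (G ε)) ε := by
  refine Fin.lastCases ?_ (fun i => ?_) i
  · simp [spinE_last, lastSpin]
  · simp only [spinE_castSucc, bulkSpin]
    split_ifs <;> simp

lemma spinE_sub (κ a b : ℂ) (i : Fin (2 * n + 1)) (G H : Spin n → ℂ) (ε : Spin n) :
    a * spinE κ i G ε - b * spinE κ i H ε = spinE κ i (fun ε => a * G ε - b * H ε) ε := by
  refine Fin.lastCases ?_ (fun i => ?_) i
  · simp only [spinE_last, lastSpin, smul_eq_mul]
    ring
  · simp only [spinE_castSucc, bulkSpin, smul_eq_mul]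
    split_ifs <;> ring

lemma spinE_zero {M : Type} [AddCommGroup M] [Module ℂ M] (κ : ℂ) (i : Fin (2 * n + 1))
    (ε : Spin n) : spinE κ i (fun _ => (0 : M)) ε = 0 := by
  have := map_spinE (0 : M →ₗ[ℂ] M) κ i (fun _ => (0 : M)) ε
  simpa using this.symm

variable {κ : ℂ} {F : Spin n → Box n}

/-- If all components vanish at a point, they vanish at its images under the reflections, as long
as the `R`-matrices are regular. -/
lemma eval_swap_eq_zero
    (hF : ∀ i ε, heckeT n (κ ^ 2) i (F ε) = κ ^ 2 • F ε + spinE κ i F ε)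
    {v : Fin (2 * n + 1) → ℂ} (hv : ∀ ε, eval v (F ε).1 = 0) (i : Fin (2 * n))
    (hi : κ ^ 2 * v i.castSucc ≠ (κ ^ 2)⁻¹ * v i.succ) (ε : Spin n) :
    eval (v ∘ Equiv.swap i.castSucc i.succ) (F ε).1 = 0 := by
  have h1 := eval_heckeT_castSucc (κ ^ 2) i (F ε) v
  rw [hF, ← evalBox_apply, map_add, map_smul, map_spinE] at h1
  simp only [evalBox_apply, hv, smul_zero, zero_add, spinE_zero, mul_zero, sub_zero] at h1
  exact (mul_eq_zero.1 h1.symm).resolve_left (sub_ne_zero.2 hi)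

/-- If all components vanish at a point, they vanish at the point with the coordinate `j` inverted:
this coordinate is moved to the last place, inverted there, and moved back. -/
lemma eval_flip_eq_zero
    (hF : ∀ i ε, heckeT n (κ ^ 2) i (F ε) = κ ^ 2 • F ε + spinE κ i F ε)
    {j : Fin (2 * n + 1)} : ∀ {v : Fin (2 * n + 1) → ℂ}, (∀ ε, eval v (F ε).1 = 0) →
    (∀ l, j < l → κ ^ 2 * v j ≠ (κ ^ 2)⁻¹ * v l ∧ κ ^ 2 * v l ≠ (κ ^ 2)⁻¹ * (v j)⁻¹) →
    v j ≠ 0 → κ ^ 2 * v j ^ 2 ≠ (κ ^ 2)⁻¹ → ∀ ε,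
    eval (Function.update v j (v j)⁻¹) (F ε).1 = 0 := by
  induction j using Fin.reverseInduction with
  | last =>
    intro v hv _ h0 h1 ε
    have h2 := eval_heckeT_last (κ ^ 2) (F ε) h0
    rw [hF, ← evalBox_apply, map_add, map_smul, map_spinE] at h2
    simp only [evalBox_apply, hv, smul_zero, zero_add, spinE_zero, mul_zero, sub_zero] at h2
    refine (mul_eq_zero.1 ((mul_eq_zero.1 h2.symm).resolve_left ?_)).resolve_left ?_
    · exact sub_ne_zero.2 h1
    · exact pow_ne_zero _ h0
  | cast i ih =>
    intro v hv hl h0 h1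
    have hlt : i.castSucc < i.succ := Fin.castSucc_lt_succ
    have e1 := eval_swap_eq_zero hF hv i (hl _ hlt).1
    have hj : (v ∘ Equiv.swap i.castSucc i.succ) i.succ = v i.castSucc := by simp
    have e2 := ih e1 (fun l hl' => by
      have hs : (v ∘ Equiv.swap i.castSucc i.succ) l = v l := by
        rw [Function.comp_apply, Equiv.swap_apply_of_ne_of_ne (hlt.trans hl').ne' hl'.ne']
      rw [hj, hs]
      exact hl l (hlt.trans hl')) (by rwa [hj]) (by rwa [hj])
    have e3 := eval_swap_eq_zero hF e2 i (by
      rw [Function.update_of_ne hlt.ne, Function.update_self, hj]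
      simpa using (hl _ hlt).2)
    have hpt : Function.update v i.castSucc (v i.castSucc)⁻¹ =
        Function.update (v ∘ Equiv.swap i.castSucc i.succ) i.succ
          ((v ∘ Equiv.swap i.castSucc i.succ) i.succ)⁻¹ ∘ Equiv.swap i.castSucc i.succ := by
      rw [hj]
      funext x
      rw [Function.comp_apply]
      by_cases hx1 : x = i.castSucc
      · subst hx1; simp
      · by_cases hx2 : x = i.succ
        · subst hx2
          simp [hlt.ne, hlt.ne']
        · rw [Function.update_of_ne hx1, Equiv.swap_apply_of_ne_of_ne hx1 hx2,
            Function.update_of_ne hx2, Function.comp_apply, Equiv.swap_apply_of_ne_of_ne hx1 hx2]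
    rw [hpt]
    exact e3

/-- The point `(a₀, Q² a₀, a₁, Q² a₁, …, Q⁻¹)` with widely separated `a_k`, the second coordinates
of the first `m` pairs being inverted. -/
def pairPoint (n : ℕ) (Q : ℝ) (m : ℕ) (x : Fin (2 * n + 1)) : ℝ :=
  if x.val = 2 * n then Q⁻¹ else if x.val % 2 = 0 then 100 ^ (x.val / 2 + 1)
  else if x.val / 2 < m then (Q ^ 2 * 100 ^ (x.val / 2 + 1))⁻¹ else Q ^ 2 * 100 ^ (x.val / 2 + 1)

lemma pow_separated {k m : ℕ} (h : m < k) : (100 : ℝ) * 100 ^ (m + 1) ≤ 100 ^ (k + 1) := by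
  rw [← pow_succ']
  exact pow_le_pow_right₀ (by norm_num) (by omega)

lemma le_pow_hundred (k : ℕ) : (100 : ℝ) ≤ 100 ^ (k + 1) := by
  calc (100 : ℝ) = 100 ^ 1 := by norm_num
    _ ≤ _ := pow_le_pow_right₀ (by norm_num) (by omega)

/-- The `R`-matrices are regular when the second coordinate of the next pair is inverted. -/
lemma pairPoint_step {Q : ℝ} (h1 : 1 < Q) (h2 : Q < 2) {m : ℕ}
    (j : Fin (2 * n + 1)) (hj : j.val = 2 * m + 1) :
    (∀ l, j < l → Q * pairPoint n Q m j ≠ Q⁻¹ * pairPoint n Q m l ∧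
      Q * pairPoint n Q m l ≠ Q⁻¹ * (pairPoint n Q m j)⁻¹) ∧
    pairPoint n Q m j ≠ 0 ∧ Q * pairPoint n Q m j ^ 2 ≠ Q⁻¹ ∧
    pairPoint n Q (m + 1) = Function.update (pairPoint n Q m) j (pairPoint n Q m j)⁻¹ := by
  have hQ : 0 < Q := by linarith
  have hQi : Q⁻¹ < 1 := inv_lt_one_of_one_lt₀ h1
  have hQi0 : 0 < Q⁻¹ := inv_pos.2 hQ
  have hQ2 : 1 < Q ^ 2 := one_lt_pow₀ h1 two_ne_zero
  have hQ4 : Q ^ 2 < 4 := by nlinarith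
  have ha := le_pow_hundred m
  set a : ℝ := 100 ^ (m + 1) with hadef
  have hpj : pairPoint n Q m j = Q ^ 2 * a := by
    rw [pairPoint, if_neg (by omega), if_neg (by omega), if_neg (by omega),
      show j.val / 2 = m by omega]
  have hpj1 : 100 < Q ^ 2 * a := by nlinarith
  rw [hpj]
  -- the coordinates on the right of `j` are small or large
  have hl : ∀ l, j < l → pairPoint n Q m l = Q⁻¹ ∨ 100 * a ≤ pairPoint n Q m l := by
    intro l hjl
    have hjl : j.val < l.val := hjl
    have hl' := l.isLt
    rw [pairPoint]
    split_ifs with c1 c2 c3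
    · exact Or.inl rfl
    · exact Or.inr (pow_separated (by omega))
    · omega
    · right
      have h3 := pow_separated (show m < l.val / 2 by omega)
      have h4 := le_pow_hundred (l.val / 2)
      nlinarith
  refine ⟨fun l hjl => ?_, by positivity, ?_, ?_⟩
  · have hx : Q * Q⁻¹ = 1 := mul_inv_cancel₀ hQ.ne'
    have hinv : (Q ^ 2 * a)⁻¹ < 1 := inv_lt_one_of_one_lt₀ (by linarith)
    have hinv0 : 0 < (Q ^ 2 * a)⁻¹ := by positivity
    have h6 : Q⁻¹ * (Q ^ 2 * a)⁻¹ < 1 := by nlinarith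
    rcases hl l hjl with h3 | h3
    · rw [h3]
      constructor
      · refine ne_of_gt ?_
        have : Q⁻¹ * Q⁻¹ < 1 := by nlinarith
        nlinarith
      · rw [hx]; exact h6.ne'
    · constructor
      · intro e
        have h4 : Q * Q * (Q ^ 2 * a) = pairPoint n Q m l := by
          have := congrArg (Q * ·) e
          simp only [← mul_assoc, hx, one_mul] at this
          rw [← this]; ring
        have : Q * Q * (Q ^ 2 * a) < 16 * a := by
          have : Q ^ 2 * Q ^ 2 < 16 := by nlinarith
          nlinarith
        linarith
      · refine ne_of_gt (h6.trans ?_)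
        nlinarith
  · refine ne_of_gt ?_
    nlinarith
  · funext x
    by_cases hx : x = j
    · subst hx
      rw [Function.update_self, pairPoint, if_neg (by omega), if_neg (by omega),
        if_pos (by omega), show x.val / 2 = m by omega]
    · rw [Function.update_of_ne hx]
      have hx' : x.val ≠ j.val := fun e => hx (Fin.ext e)
      rw [pairPoint, pairPoint]
      split_ifs <;> first | rfl | omega

/-- When all the second coordinates are inverted, the base entry does not vanish. -/
lemma pairPoint_final {Q : ℝ} (h1 : 1 < Q) (h2 : Q < 2) {i j : Fin (2 * n + 1)} (hij : i < j) :
    Q * pairPoint n Q n i ≠ Q⁻¹ * pairPoint n Q n j := by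
  have hQ : 0 < Q := by linarith
  have hQi : Q⁻¹ < 1 := inv_lt_one_of_one_lt₀ h1
  have hQi0 : 0 < Q⁻¹ := inv_pos.2 hQ
  have hQ2 : 1 < Q ^ 2 := one_lt_pow₀ h1 two_ne_zero
  have hQ4 : Q ^ 2 < 4 := by nlinarith
  have hx : Q * Q⁻¹ = 1 := mul_inv_cancel₀ hQ.ne'
  have hij' : i.val < j.val := hij
  have hi := i.isLt
  have hj := j.isLt
  suffices h : Q ^ 2 * pairPoint n Q n i ≠ pairPoint n Q n j by
    intro e
    apply h
    have := congrArg (Q * ·) e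
    simp only [← mul_assoc, hx, one_mul] at this
    rw [← this]; ring
  have ha := le_pow_hundred (i.val / 2)
  have hb := le_pow_hundred (j.val / 2)
  have hbi : (Q ^ 2 * 100 ^ (j.val / 2 + 1))⁻¹ < 1 := inv_lt_one_of_one_lt₀ (by nlinarith)
  have e1 : Q ^ 2 * (Q ^ 2 * 100 ^ (i.val / 2 + 1))⁻¹ = (100 ^ (i.val / 2 + 1))⁻¹ := by
    field_simp
  have hai : ((100 : ℝ) ^ (i.val / 2 + 1))⁻¹ ≤ 100⁻¹ := inv_anti₀ (by norm_num) ha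
  by_cases ci : i.val % 2 = 0
  · have hpi : pairPoint n Q n i = 100 ^ (i.val / 2 + 1) := by
      rw [pairPoint, if_neg (by omega), if_pos ci]
    rw [hpi, pairPoint]
    split_ifs with c1 c2 c3
    · refine ne_of_gt ?_; nlinarith
    · have := pow_separated (show i.val / 2 < j.val / 2 by omega)
      refine ne_of_lt ?_; nlinarith
    · refine ne_of_gt ?_; nlinarith
    · omega
  · have hpi : pairPoint n Q n i = (Q ^ 2 * 100 ^ (i.val / 2 + 1))⁻¹ := by
      rw [pairPoint, if_neg (by omega), if_neg ci, if_pos (by omega)]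
    rw [hpi, e1, pairPoint]
    split_ifs with c1 c2 c3
    · refine ne_of_lt (hai.trans_lt ?_)
      rw [inv_lt_inv₀ (by norm_num) hQ]; linarith
    · refine ne_of_lt (hai.trans_lt ?_); norm_num; linarith
    · intro e
      have e' := inv_injective e
      have := pow_separated (show i.val / 2 < j.val / 2 by omega)
      nlinarith
    · omega

/-- The pattern with the arches `{0, 1}, {2, 3}, …`, the last point being open. -/
def pairedPattern (n : ℕ) : OpenLinkPattern (2 * n + 1) :=
  ⟨fun x => if h : x.val = 2 * n then x else if x.val % 2 = 0 then ⟨x.val + 1, by omega⟩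
    else ⟨x.val - 1, by omega⟩, by
    refine ⟨fun x => ?_, fun a c hac hca => ?_⟩
    · have := x.isLt
      apply Fin.ext
      dsimp only
      split_ifs <;> simp_all <;> omega
    · exfalso
      dsimp only at hca
      rw [Fin.lt_def] at hac hca
      have := a.isLt
      split_ifs at hca <;> simp at hca <;> omega⟩

lemma pairedPattern_even {i : Fin (2 * n)} (hi : i.val % 2 = 0) :
    (pairedPattern n).1 i.castSucc = i.succ := by
  have := i.isLt
  apply Fin.ext
  simp [pairedPattern, hi, this.ne]

lemma pairedPattern_last : (pairedPattern n).1 (Fin.last (2 * n)) = Fin.last (2 * n) := by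
  simp [pairedPattern]

lemma join_of_arch {r : ℕ} {π : OpenLinkPattern r} {i j : Fin r} (hij : j.val = i.val + 1)
    (h : π.1 i = j) : π.join i j hij = π := by
  have h' : π.1 j = i := by rw [← h, pattern_invol]
  refine Subtype.ext (funext fun x => ?_)
  by_cases h1 : x = i
  · rw [h1, join_left, h]
  by_cases h2 : x = j
  · rw [h2, join_right, h']
  refine join_other hij h1 h2 (fun e => h2 ?_) fun e => h1 ?_
  · rw [← h, ← e, pattern_invol]
  · rw [← h', ← e, pattern_invol]

/-- The common eigenvector equations satisfied by the spin vector of `pairedPattern`. -/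
def IsPaired (κ : ℂ) (G : Spin n → ℂ) : Prop :=
  ∀ i : Fin (2 * n + 1), i.val % 2 = 0 → ∀ ε, spinE κ i G ε = loopWeight (κ ^ 2) * G ε

lemma isPaired_spinVec (hκ : κ ≠ 0) : IsPaired κ (spinVec κ (pairedPattern n)) := by
  intro i hi ε
  induction i using Fin.lastCases with
  | last =>
    rw [spinE_last, lastSpin_spinVec hκ, if_pos pairedPattern_last,
      cutLast_of_open pairedPattern_last]
  | cast i =>
    rw [spinE_castSucc, bulkSpin_spinVec hκ, bulkWeight, if_pos (pairedPattern_even hi),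
      join_of_arch _ (pairedPattern_even hi)]

/-- The equations determine all components from the one with alternating spins. -/
lemma IsPaired.eq_zero (hκ : κ ≠ 0) (hβ : loopWeight (κ ^ 2) ≠ 0) {G : Spin n → ℂ}
    (hG : IsPaired κ G) (h0 : G (fun x => decide (x.val % 2 = 0)) = 0) : G = 0 := by
  have hL : ∀ ε, G ε = G (Function.update ε (Fin.last (2 * n)) true) := by
    intro ε
    have e1 := hG (Fin.last (2 * n)) (by simp)
    simp only [spinE_last, lastSpin] at e1
    have e2 := e1 (Function.update ε (Fin.last (2 * n)) true)
    simp only [Function.update_idem] at e2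
    exact mul_left_cancel₀ hβ ((e1 ε).symm.trans e2)
  have key : ∀ k, k ≤ n → ∀ ε : Spin n,
      (∀ x : Fin (2 * n + 1), 2 * k ≤ x.val → ε x = decide (x.val % 2 = 0)) → G ε = 0 := by
    intro k
    induction k with
    | zero =>
      intro _ ε hε
      rw [← h0]
      congr 1
      funext x
      exact hε x (Nat.zero_le _)
    | succ k ih =>
      intro hk ε hε
      set i : Fin (2 * n) := ⟨2 * k, by omega⟩ with hi
      have h1 : ∀ ε, _ := hG i.castSucc (by simp [hi])
      simp only [spinE_castSucc, bulkSpin] at h1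
      -- the case where the pair `i, i + 1` agrees with the reference configuration
      have h2 : ∀ ε : Spin n, (∀ x : Fin (2 * n + 1), 2 * (k + 1) ≤ x.val →
          ε x = decide (x.val % 2 = 0)) → ε i.castSucc = true → ε i.succ = false → G ε = 0 := by
        intro ε hε e1 e2
        refine ih (by omega) ε fun x hx => ?_
        by_cases c1 : x = i.castSucc
        · rw [c1, e1]; simp [hi]
        · by_cases c2 : x = i.succ
          · rw [c2, e2]; simp [hi]
          · refine hε x ?_
            have d1 : x.val ≠ 2 * k := fun e => c1 (Fin.ext e)
            have d2 : x.val ≠ 2 * k + 1 := fun e => c2 (Fin.ext e)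
            omega
      cases c1 : ε i.castSucc <;> cases c2 : ε i.succ
      · have h3 := h1 ε
        rw [if_pos (by rw [c1, c2])] at h3
        exact (mul_eq_zero.1 h3.symm).resolve_left hβ
      · -- exchanging the two spins leads to the reference configuration of the pair
        have h3 := h1 (ε ∘ Equiv.swap i.castSucc i.succ)
        have h4 : G (ε ∘ Equiv.swap i.castSucc i.succ) = 0 := by
          refine h2 _ (fun x hx => ?_) (by simp [c2]) (by simp [c1])
          have d1 : x ≠ i.castSucc := by
            rintro rfl
            have : 2 * (k + 1) ≤ 2 * k := hx
            omega
          have d2 : x ≠ i.succ := by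
            rintro rfl
            have : 2 * (k + 1) ≤ 2 * k + 1 := hx
            omega
          rw [Function.comp_apply, Equiv.swap_apply_of_ne_of_ne d1 d2]
          exact hε x hx
        rw [h4, comp_swap_comp_swap, if_neg (by simp [c1, c2])] at h3
        simp only [Function.comp_apply, Equiv.swap_apply_left, c2, spinSign, smul_eq_mul] at h3
        simpa [hκ] using h3
      · exact h2 ε hε c1 c2
      · have h3 := h1 ε
        rw [if_pos (by rw [c1, c2])] at h3
        exact (mul_eq_zero.1 h3.symm).resolve_left hβ
  funext ε
  rw [hL]
  refine key n le_rfl _ fun x hx => ?_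
  have : x = Fin.last (2 * n) := Fin.ext (by have := x.isLt; simp; omega)
  subst this
  simp

variable {κ : ℝ}

/-- If all components vanished at `pairPoint n Q 0`, they would vanish at `pairPoint n Q n`, where
the base entry does not. -/
lemma eval_pairPoint_ne_zero (h1 : 1 < κ ^ 2) (h2 : κ ^ 2 < 2)
    {F : Spin n → Box n}
    (hF : ∀ i ε, heckeT n ((κ : ℂ) ^ 2) i (F ε) = (κ : ℂ) ^ 2 • F ε + spinE (κ : ℂ) i F ε)
    (h0 : (F fun _ => true).1 = baseEntry n ((κ : ℂ) ^ 2)) :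
    ∃ ε, eval (fun x => (pairPoint n (κ ^ 2) 0 x : ℂ)) (F ε).1 ≠ 0 := by
  by_contra! hc
  have hv : ∀ m, m ≤ n → ∀ ε, eval (fun x => (pairPoint n (κ ^ 2) m x : ℂ)) (F ε).1 = 0 := by
    intro m
    induction m with
    | zero => exact fun _ => hc
    | succ m ih =>
      intro hm ε
      obtain ⟨s1, s2, s3, s4⟩ := pairPoint_step (n := n) h1 h2 (m := m) ⟨2 * m + 1, by omega⟩ rfl
      have := eval_flip_eq_zero hF (j := ⟨2 * m + 1, by omega⟩) (ih (by omega))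
        (fun l hl => ⟨by exact_mod_cast (s1 l hl).1, by exact_mod_cast (s1 l hl).2⟩)
        (by exact_mod_cast s2) (by exact_mod_cast s3) ε
      rw [s4]
      convert this using 3
      funext x
      by_cases hx : x = ⟨2 * m + 1, by omega⟩
      · subst hx; simp
      · simp [hx]
  have := hv n le_rfl fun _ => true
  rw [h0, eval_baseEntry, Finset.prod_eq_zero_iff] at this
  obtain ⟨i, -, hi⟩ := this
  obtain ⟨j, hj, hij⟩ := Finset.prod_eq_zero_iff.1 hi
  rw [sub_eq_zero] at hij
  exact pairPoint_final h1 h2 (Finset.mem_Ioi.1 hj) (by exact_mod_cast hij)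

/-- At this point the coefficients of the reflected terms vanish in the generators with an even
index, and so these act on the values by their eigenvalue `-q⁻¹`. -/
lemma isPaired_eval_pairPoint (h1 : 1 < κ ^ 2) {F : Spin n → Box n}
    (hF : ∀ i ε, heckeT n ((κ : ℂ) ^ 2) i (F ε) = (κ : ℂ) ^ 2 • F ε + spinE (κ : ℂ) i F ε) :
    IsPaired (κ : ℂ) fun ε => eval (fun x => (pairPoint n (κ ^ 2) 0 x : ℂ)) (F ε).1 := by
  intro i hi ε
  set v : Fin (2 * n + 1) → ℂ := fun x => (pairPoint n (κ ^ 2) 0 x : ℂ) with hv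
  set q : ℂ := (κ : ℂ) ^ 2 with hq
  have hq0 : q ≠ 0 := by
    rw [hq]; norm_cast; positivity
  have hq1 : q ^ 2 - 1 ≠ 0 := by
    rw [hq, sub_ne_zero]; norm_cast; nlinarith
  suffices h : eval v (heckeT n q i (F ε)).1 = -q⁻¹ * eval v (F ε).1 by
    have e1 := congrArg (evalBox v) (hF i ε)
    rw [map_add, map_smul, map_spinE, evalBox_apply, h] at e1
    simp only [evalBox_apply, smul_eq_mul] at e1
    rw [loopWeight]
    linear_combination -e1
  induction i using Fin.lastCases with
  | last =>
    have hl : v (Fin.last (2 * n)) = q⁻¹ := by simp [hv, pairPoint, hq]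
    have e1 := eval_heckeT_last q (F ε) (v := v) (by rw [hl]; exact inv_ne_zero hq0)
    rw [hl] at e1
    have e2 : q * q⁻¹ ^ 2 - q⁻¹ = 0 := by field_simp; simp
    rw [e2, zero_mul] at e1
    have e3 : (1 : ℂ) - q⁻¹ ^ 2 ≠ 0 := by
      intro h
      apply hq1
      field_simp at h
      simpa using h
    refine mul_left_cancel₀ e3 (e1.trans ?_)
    field_simp
    ring
  | cast i =>
    have hi' : i.val % 2 = 0 := hi
    have hlt := i.isLt
    have h3 : v i.castSucc ≠ 0 := by
      simp only [hv, pairPoint, Fin.val_castSucc, if_neg hlt.ne, if_pos hi']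
      norm_cast
      positivity
    have h4 : v i.succ = q ^ 2 * v i.castSucc := by
      simp only [hv, pairPoint, Fin.val_castSucc, if_neg hlt.ne, if_pos hi', Fin.val_succ]
      rw [if_neg (by omega), if_neg (by omega), if_neg (by omega),
        show (i.val + 1) / 2 = i.val / 2 by omega, hq]
      push_cast
      ring
    have e1 := eval_heckeT_castSucc q i (F ε) v
    rw [h4] at e1
    have e2 : q * v i.castSucc - q⁻¹ * (q ^ 2 * v i.castSucc) = 0 := by field_simp; simp
    rw [e2, zero_mul] at e1
    have e3 : q ^ 2 * v i.castSucc - v i.castSucc ≠ 0 := by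
      rw [show q ^ 2 * v i.castSucc - v i.castSucc = (q ^ 2 - 1) * v i.castSucc by ring]
      exact mul_ne_zero hq1 h3
    refine mul_left_cancel₀ e3 (e1.trans ?_)
    field_simp
    ring

/-- The spin vector of polynomials is not orthogonal to the spin vectors of the patterns: its value
at `pairPoint n Q 0` is a nonzero multiple of the spin vector of `pairedPattern n`. -/
lemma pairing_pairedPattern_ne_zero (hκ : κ ≠ 0) (h1 : 1 < κ ^ 2) (h2 : κ ^ 2 < 2)
    {F : Spin n → Box n}
    (hF : ∀ i ε, heckeT n ((κ : ℂ) ^ 2) i (F ε) = (κ : ℂ) ^ 2 • F ε + spinE (κ : ℂ) i F ε)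
    (h0 : (F fun _ => true).1 = baseEntry n ((κ : ℂ) ^ 2)) :
    pairing ((κ : ℂ) ^ 2) (spinVec (κ : ℂ) (pairedPattern n)) F ≠ 0 := by
  have hκ' : (κ : ℂ) ≠ 0 := by exact_mod_cast hκ
  set v : Fin (2 * n + 1) → ℂ := fun x => (pairPoint n (κ ^ 2) 0 x : ℂ) with hv
  set G : Spin n → ℂ := fun ε => eval v (F ε).1 with hG
  set S := spinVec (κ : ℂ) (pairedPattern n) with hS
  have hβ : loopWeight ((κ : ℂ) ^ 2) ≠ 0 := by
    rw [loopWeight, neg_ne_zero]; norm_cast; positivity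
  obtain ⟨ε₁, hε₁⟩ := eval_pairPoint_ne_zero h1 h2 hF h0
  have hGp := isPaired_eval_pairPoint h1 hF
  set ε₀ : Spin n := fun x => decide (x.val % 2 = 0) with hε₀
  have hG0 : G ε₀ ≠ 0 := fun h => hε₁ (congrFun (hGp.eq_zero hκ' hβ h) ε₁)
  have hSp := isPaired_spinVec (n := n) hκ'
  have hprop : (fun ε => G ε₀ * S ε - S ε₀ * G ε) = 0 := by
    refine IsPaired.eq_zero hκ' hβ (fun i hi ε => ?_) (by rw [hε₀]; ring)
    have e1 := hSp i hi ε
    have e2 := hGp i hi ε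
    rw [← spinE_sub, e1, e2]
    ring
  intro h
  have e1 := congrArg (evalBox v) h
  rw [map_zero, pairing, map_sum] at e1
  simp only [map_smul, evalBox_apply] at e1
  have e2 : S = 0 := by
    refine eq_zero_of_pairing_star hκ ?_
    simp only [hS, conj_spinVec]
    have e3 : G ε₀ * pairing ((κ : ℂ) ^ 2) S S = S ε₀ * 0 := by
      rw [← e1, pairing, Finset.mul_sum, Finset.mul_sum]
      refine Finset.sum_congr rfl fun ε _ => ?_
      have := congrFun hprop ε
      simp only [Pi.zero_apply, hG] at this
      simp only [smul_eq_mul, hG]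
      linear_combination (spinWeight ((κ : ℂ) ^ 2) ε * S ε) * this
    rw [mul_zero] at e3
    exact (mul_eq_zero.1 e3).resolve_left hG0
  exact spinVec_closings_ne_zero hκ' (pairedPattern n) (congrFun e2 _)

end Nonvanishing

end
end CqKZ

namespace CqKZ
open OpenLinkPattern MvPolynomial

noncomputable section

/-! ### Triangularity and the solution for generic parameters -/

section Triangular

variable {n : ℕ} {M : Type} [AddCommGroup M] [Module ℂ M]

/-- The result of a bulk generator has a closed arch. -/
lemma genC_allOpen (β : ℂ) (i : Fin (2 * n)) (ρ : OpenLinkPattern (2 * n + 1)) :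
    genC n β i.castSucc (allOpen (2 * n + 1)) ρ = 0 := by
  rw [genC_castSucc, bulkE, if_neg]
  intro h
  have h1 := congrArg (fun p => p.1 i.castSucc) h
  simp only [join_left] at h1
  exact castSucc_ne_succ i h1

lemma SolvesHecke.sub {q : ℂ} {Φ Ψ : OpenLinkPattern (2 * n + 1) → Box n} (hΦ : SolvesHecke q Φ)
    (hΨ : SolvesHecke q Ψ) : SolvesHecke q (Φ - Ψ) := by
  intro i σ
  simp only [Pi.sub_apply, map_sub, hΦ i σ, hΨ i σ, matAct, smul_sub, Finset.sum_sub_distrib]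
  abel

lemma SolvesHecke.smul {q : ℂ} {Φ : OpenLinkPattern (2 * n + 1) → Box n} (hΦ : SolvesHecke q Φ)
    (c : ℂ) : SolvesHecke q (c • Φ) := by
  intro i σ
  simp only [Pi.smul_apply, map_smul, hΦ i σ, matAct, smul_add, Finset.smul_sum]
  rw [smul_comm]
  congr 1
  exact Finset.sum_congr rfl fun ρ _ => smul_comm _ _ _

/-- A matrix entry `1` below which all others vanish lets a component be solved for. -/
lemma matAct_eq_of_triangular {A : Op n ℂ} {σ π : OpenLinkPattern (2 * n + 1)} (h1 : A σ π = 1)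
    (Ψ : OpenLinkPattern (2 * n + 1) → M) :
    matAct A Ψ σ = Ψ π + ∑ ρ with ρ ≠ π, A σ ρ • Ψ ρ := by
  rw [matAct, ← Finset.add_sum_erase _ _ (Finset.mem_univ π), h1, one_smul]
  congr 1
  exact Finset.sum_congr (by ext; simp) fun _ _ => rfl

/-- A solution is determined by its base entry. -/
lemma SolvesHecke.eq_zero {q : ℂ} {Φ : OpenLinkPattern (2 * n + 1) → Box n}
    (hΦ : SolvesHecke q Φ) (h0 : Φ (allOpen (2 * n + 1)) = 0) : Φ = 0 := by
  have key : ∀ m π, downArea (closings π) = m → Φ π = 0 := by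
    intro m
    induction m using Nat.strong_induction_on with
    | _ m ih =>
      rintro π rfl
      by_cases hπ : π = allOpen (2 * n + 1)
      · rw [hπ, h0]
      obtain ⟨i, σ, hσ, h⟩ := exists_predecessor hπ
      obtain ⟨h1, h2⟩ := h (loopWeight q)
      have h3 := hΦ i σ
      rw [matAct_eq_of_triangular h1, ih _ hσ σ rfl, map_zero, smul_zero, zero_add,
        Finset.sum_eq_zero, add_zero] at h3
      · exact h3.symm
      · intro ρ hρ
        by_cases h4 : genC n (loopWeight q) i σ ρ = 0
        · rw [h4, zero_smul]
        · rw [ih _ (h2 ρ h4 (Finset.mem_filter.1 hρ).2) ρ rfl, smul_zero]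
  exact funext fun π => key _ π rfl

/-- The common eigenvectors of the bulk Hecke generators are multiples of the base entry. -/
lemma exists_eq_smul_baseBox {q : ℂ} (hq : q ≠ 0) (hq2 : q ^ 2 ≠ -1) {f : Box n}
    (hf : ∀ i : Fin (2 * n), heckeT n q i.castSucc f = q • f) : ∃ c : ℂ, f = c • baseBox n hq := by
  obtain ⟨g, hg⟩ := baseEntry_dvd hq hq2 fun i => (heckeT_eq_smul_iff i f).1 (hf i)
  by_cases hg0 : g = 0
  · exact ⟨0, Subtype.ext (by rw [hg, hg0]; simp)⟩
  have hdeg : ∀ k, g.degreeOf k = 0 := by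
    intro k
    have h1 := degreeOf_le_of_mem_box f k
    rw [hg, degreeOf_mul_eq (baseEntry_ne_zero hq) hg0, baseEntry_degreeOf hq] at h1
    omega
  have hC : g = C (coeff 0 g) := by
    ext s
    rw [coeff_C]
    split_ifs with hs
    · rw [hs]
    · by_contra hne
      apply hs
      ext k
      have := monomial_le_degreeOf k (mem_support_iff.2 hne)
      rw [hdeg] at this
      simpa using (Nat.le_zero.1 this).symm
  refine ⟨coeff 0 g, Subtype.ext ?_⟩
  rw [hg, Submodule.coe_smul, smul_eq_C_mul, ← hC]
  exact mul_comm _ _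

/-- No bulk generator produces the pattern with all arches open, so the base entry of a solution is
a common eigenvector. -/
lemma SolvesHecke.exists_allOpen {q : ℂ} (hq : q ≠ 0) (hq2 : q ^ 2 ≠ -1)
    {Φ : OpenLinkPattern (2 * n + 1) → Box n} (hΦ : SolvesHecke q Φ) :
    ∃ c : ℂ, Φ (allOpen (2 * n + 1)) = c • baseBox n hq := by
  refine exists_eq_smul_baseBox hq hq2 fun i => ?_
  rw [hΦ, matAct, Finset.sum_eq_zero fun ρ _ => by rw [genC_allOpen, zero_smul], add_zero]

end Triangular

section GenericSolution

variable {n : ℕ} {κ : ℂ}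

lemma spinPoly_up (q : ℂ) (f : Box n) : spinPoly n q f (fun _ => true) = f := by
  have h : ∀ k, spinPrefix (2 * n) (bulkT n q) (lastT n q) f
      (extSpin (fun _ : Fin (2 * n + 1) => true)) k = f := by
    intro k
    induction k with
    | zero => rfl
    | succ k ih => rw [spinPrefix, if_pos (by simp [extSpin]), ih]
  exact h _

lemma spinPoly_smul (q c : ℂ) (f : Box n) (ε : Spin n) :
    spinPoly n q (c • f) ε = c • spinPoly n q f ε := by
  have h : ∀ k, spinPrefix (2 * n) (bulkT n q) (lastT n q) (c • f) (extSpin ε) k =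
      c • spinPrefix (2 * n) (bulkT n q) (lastT n q) f (extSpin ε) k := by
    intro k
    induction k with
    | zero => rfl
    | succ k ih =>
      rw [spinPrefix, spinPrefix, ih, map_smul]
      split_ifs <;> rfl
  exact h _

lemma spinVec_up {π : OpenLinkPattern (2 * n + 1)} (hπ : π ≠ allOpen (2 * n + 1)) :
    spinVec κ π (fun _ => true) = 0 := by
  obtain ⟨x, hx⟩ : ∃ x, π.1 x < x := by
    by_contra! h
    exact hπ (allOpen_of_no_closing fun x => not_lt.2 (h x))
  refine Finset.prod_eq_zero (Finset.mem_univ (π.1 x)) ?_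
  rw [siteWeight_left (pattern_invol π x) hx, if_pos rfl]

/-- The spin vector of a solution is generated from its component with all spins up. -/
lemma SolvesHecke.sum_spinVec (hκ : κ ≠ 0) {Ψ : OpenLinkPattern (2 * n + 1) → Box n}
    (hΨ : SolvesHecke (κ ^ 2) Ψ) (ε : Spin n) :
    ∑ π, spinVec κ π ε • Ψ π = spinVec κ (allOpen (2 * n + 1)) (fun _ => true) •
      spinPoly n (κ ^ 2) (Ψ (allOpen (2 * n + 1))) ε := by
  set G : Spin n → Box n := fun ε => ∑ π, spinVec κ π ε • Ψ π with hG
  have h1 : ∀ i ε, heckeT n (κ ^ 2) i (G ε) = κ ^ 2 • G ε + spinE κ i G ε := by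
    intro i ε
    rw [hG, spinE_sum]
    simp only [map_sum, map_smul, hΨ i, smul_add, Finset.sum_add_distrib, Finset.smul_sum,
      spinE_spinVec hκ, Finset.sum_smul, matAct]
    congr 1
    · exact Finset.sum_congr rfl fun π _ => smul_comm _ _ _
    · rw [Finset.sum_comm]
      refine Finset.sum_congr rfl fun π _ => Finset.sum_congr rfl fun σ _ => ?_
      rw [smul_smul]
      exact congrArg (· • Ψ π) (mul_comm _ _)
  have h2 := eq_spinPoly hκ (G := G)
    (fun i ε => by rw [h1, spinE_castSucc]) (fun ε => by rw [h1, spinE_last])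
  have h3 : G (fun _ => true) = spinVec κ (allOpen (2 * n + 1)) (fun _ => true) •
      Ψ (allOpen (2 * n + 1)) := by
    rw [hG]
    refine Finset.sum_eq_single _ (fun π _ hπ => ?_) (by simp)
    rw [spinVec_up hπ, zero_smul]
  rw [h3] at h2
  rw [← spinPoly_smul]
  exact congrFun h2 ε

/-- The affinization relation follows from the other equations. -/
lemma SolvesHecke.invert_first (hκ : κ ≠ 0) (hκ1 : (κ ^ 2) ^ 2 ≠ 1)
    {Ψ : OpenLinkPattern (2 * n + 1) → Box n}
    (hΨ : SolvesHecke (κ ^ 2) Ψ)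
    (h0 : Ψ (allOpen (2 * n + 1)) = baseBox n (pow_ne_zero 2 hκ))
    (σ : OpenLinkPattern (2 * n + 1)) :
    invert n 0 ((κ ^ 2) ^ 3) (Ψ σ) = matAct (sOp n ℂ) Ψ σ := by
  suffices h : (fun σ => invert n 0 ((κ ^ 2) ^ 3) (Ψ σ) - matAct (sOp n ℂ) Ψ σ) = 0 from
    sub_eq_zero.1 (congrFun h σ)
  refine eq_zero_of_sum_spinVec (n := n) hκ fun ε => ?_
  have h1 : ∑ π, spinVec κ π ε • matAct (sOp n ℂ) Ψ π =
      ∑ π, spinVec κ π (flipFirst ε) • Ψ π := by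
    simp only [matAct, Finset.smul_sum, smul_smul]
    rw [Finset.sum_comm]
    refine Finset.sum_congr rfl fun π _ => ?_
    rw [← Finset.sum_smul]
    congr 1
    rw [spinVec_flipFirst]
    simp only [sOp]
    split_ifs
    · simp
    · simp [mul_sub, Finset.sum_sub_distrib]
  simp only [smul_sub, Finset.sum_sub_distrib]
  rw [h1, hΨ.sum_spinVec hκ, h0, spinPoly_flipFirst _ hκ1, ← map_smul, ← h0, ← hΨ.sum_spinVec hκ,
    map_sum]
  simp only [map_smul, sub_self]

/-- The projection of the spin vector is nonzero, so its base entry, by which it is determined, can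
be normalised. -/
lemma exists_generic_solution {κ : ℝ} (hκ : κ ≠ 0) (h1 : 1 < κ ^ 2) (h2 : κ ^ 2 < 2)
    (hq : (κ : ℂ) ^ 2 ≠ 0) :
    ∃ Ψ : OpenLinkPattern (2 * n + 1) → Box n, SolvesHecke ((κ : ℂ) ^ 2) Ψ ∧
      Ψ (allOpen (2 * n + 1)) = baseBox n hq ∧
      ∀ σ, invert n 0 (((κ : ℂ) ^ 2) ^ 3) (Ψ σ) = matAct (sOp n ℂ) Ψ σ := by
  have hκ' : (κ : ℂ) ≠ 0 := by exact_mod_cast hκ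
  have hq2 : ((κ : ℂ) ^ 2) ^ 2 ≠ -1 := by
    norm_cast
    intro h
    have := sq_nonneg (κ ^ 2)
    have h3 : ((κ ^ 2) ^ 2 : ℝ) = -1 := by exact_mod_cast h
    linarith
  have hq1 : ((κ : ℂ) ^ 2) ^ 2 ≠ 1 := by
    norm_cast
    nlinarith
  set F := spinPoly n ((κ : ℂ) ^ 2) (baseBox n hq) with hF
  have hb := bulkT_baseBox (n := n) hq
  have hΨ0 := projection_solvesHecke (n := n) hκ hb
  set Ψ0 := projection n κ F with hdef
  obtain ⟨c, hc⟩ := hΨ0.exists_allOpen hq hq2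
  have hc0 : c ≠ 0 := by
    rintro rfl
    rw [zero_smul] at hc
    have h3 := gram_projection hκ F (pairedPattern n)
    rw [← hdef, hΨ0.eq_zero hc] at h3
    refine pairing_pairedPattern_ne_zero hκ h1 h2 (fun i ε => spinE_spinPoly hκ' hb i ε)
      (congrArg Subtype.val (spinPoly_up _ _)) (h3.symm.trans ?_)
    simp [matAct]
  have hΨ := hΨ0.smul c⁻¹
  have h0 : (c⁻¹ • Ψ0) (allOpen (2 * n + 1)) = baseBox n hq := by
    rw [Pi.smul_apply, hc, inv_smul_smul₀ hc0]
  exact ⟨_, hΨ, h0, hΨ.invert_first hκ' hq1 h0⟩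

end GenericSolution

end
end CqKZ

namespace CqKZ
open OpenLinkPattern MvPolynomial

noncomputable section

/-! ### Laurent families -/

section Laurent

variable {M N : Type} [AddCommGroup M] [Module ℂ M] [AddCommGroup N] [Module ℂ N]

/-- A family of vectors depending on `q ≠ 0` as a Laurent polynomial. -/
def IsLaurent (f : ℂˣ → M) : Prop :=
  f ∈ Submodule.span ℂ {f : ℂˣ → M | ∃ (k : ℤ) (m : M), f = fun u => ((u ^ k : ℂˣ) : ℂ) • m}

lemma isLaurent_zpow_smul (k : ℤ) (m : M) : IsLaurent fun u => ((u ^ k : ℂˣ) : ℂ) • m :=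
  Submodule.subset_span ⟨k, m, rfl⟩

lemma isLaurent_const (m : M) : IsLaurent fun _ => m := by
  simpa using isLaurent_zpow_smul 0 m

lemma isLaurent_val : IsLaurent fun u : ℂˣ => (u : ℂ) := by
  simpa using isLaurent_zpow_smul 1 (1 : ℂ)

lemma isLaurent_inv : IsLaurent fun u : ℂˣ => (u : ℂ)⁻¹ := by
  simpa using isLaurent_zpow_smul (-1) (1 : ℂ)

namespace IsLaurent

lemma induction {P : (ℂˣ → M) → Prop} {f : ℂˣ → M} (hf : IsLaurent f)
    (h : ∀ (k : ℤ) (m : M), P fun u => ((u ^ k : ℂˣ) : ℂ) • m) (h0 : P 0)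
    (ha : ∀ f g, P f → P g → P (f + g)) : P f := by
  refine Submodule.span_induction (p := fun f _ => ∀ c : ℂ, P (c • f)) ?_ (fun c => ?_)
    (fun f g _ _ hf hg c => ?_) (fun a f _ hf c => ?_) hf 1 |> fun h => by rwa [one_smul] at h
  · rintro _ ⟨k, m, rfl⟩ c
    convert h k (c • m) using 1
    funext u
    exact smul_comm c _ m
  · rwa [smul_zero]
  · rw [smul_add]; exact ha _ _ (hf c) (hg c)
  · rw [smul_smul]; exact hf _

variable {f g : ℂˣ → M}

lemma add (hf : IsLaurent f) (hg : IsLaurent g) : IsLaurent fun u => f u + g u :=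
  Submodule.add_mem _ hf hg

lemma sub (hf : IsLaurent f) (hg : IsLaurent g) : IsLaurent fun u => f u - g u :=
  Submodule.sub_mem _ hf hg

lemma sum {ι : Type} (s : Finset ι) {F : ι → ℂˣ → M} (h : ∀ k ∈ s, IsLaurent (F k)) :
    IsLaurent fun u => ∑ k ∈ s, F k u := by
  have e : (fun u => ∑ k ∈ s, F k u) = ∑ k ∈ s, F k := by
    funext u
    simp
  rw [e]
  exact Submodule.sum_mem _ h

lemma map (hf : IsLaurent f) (L : M →ₗ[ℂ] N) : IsLaurent fun u => L (f u) := by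
  refine hf.induction (P := fun f => IsLaurent fun u => L (f u)) (fun k m => ?_) ?_
    fun f g hf hg => ?_
  · simpa using isLaurent_zpow_smul k (L m)
  · simpa using isLaurent_const (0 : N)
  · simpa using hf.add hg

/-- A family of linear maps whose values on fixed vectors are Laurent families preserves Laurent
families. -/
lemma map_family (hf : IsLaurent f) {L : ℂˣ → M →ₗ[ℂ] N} (hL : ∀ m, IsLaurent fun u => L u m) :
    IsLaurent fun u => L u (f u) := by
  refine hf.induction (P := fun f => IsLaurent fun u => L u (f u)) (fun k m => ?_) ?_
    fun f g hf hg => ?_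
  · simp only [map_smul]
    refine (hL m).induction (P := fun g => IsLaurent fun u => ((u ^ k : ℂˣ) : ℂ) • g u)
      (fun l m => ?_) ?_ fun f g hf hg => ?_
    · convert isLaurent_zpow_smul (k + l) m using 2 with u
      rw [smul_smul, zpow_add, Units.val_mul]
    · simpa using isLaurent_const (0 : N)
    · simpa using hf.add hg
  · simpa using isLaurent_const (0 : N)
  · simpa using hf.add hg

lemma smul {a : ℂˣ → ℂ} (ha : IsLaurent a) (hf : IsLaurent f) : IsLaurent fun u => a u • f u :=
  hf.map_family (L := fun u => a u • LinearMap.id) fun m => ha.map (LinearMap.toSpanSingleton ℂ M m)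

lemma mul {A : Type} [CommRing A] [Algebra ℂ A] {f g : ℂˣ → A} (hf : IsLaurent f)
    (hg : IsLaurent g) : IsLaurent fun u => f u * g u :=
  hg.map_family (L := fun u => LinearMap.mulLeft ℂ (f u)) fun m => hf.map (LinearMap.mulRight ℂ m)

lemma prod {A ι : Type} [CommRing A] [Algebra ℂ A] (s : Finset ι) {F : ι → ℂˣ → A}
    (h : ∀ k ∈ s, IsLaurent (F k)) : IsLaurent fun u => ∏ k ∈ s, F k u := by
  classical
  induction s using Finset.induction_on with
  | empty => simpa using isLaurent_const (1 : A)
  | insert a s ha ih =>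
    simp only [Finset.prod_insert ha]
    exact (h a (Finset.mem_insert_self a s)).mul
      (ih fun k hk => h k (Finset.mem_insert_of_mem hk))

lemma of_subtype {S : Submodule ℂ M} {f : ℂˣ → S} (hf : IsLaurent fun u => (f u : M)) :
    IsLaurent f := by
  obtain ⟨L, hL⟩ := S.subtype.exists_leftInverse_of_injective S.ker_subtype
  convert hf.map L using 1
  funext u
  exact (LinearMap.congr_fun hL (f u)).symm

lemma exists_polynomial {a : ℂˣ → ℂ} (ha : IsLaurent a) :
    ∃ (k : ℕ) (p : Polynomial ℂ), ∀ u : ℂˣ, (u : ℂ) ^ k * a u = p.eval (u : ℂ) := by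
  refine ha.induction (P := fun a => ∃ (k : ℕ) (p : Polynomial ℂ), ∀ u : ℂˣ,
    (u : ℂ) ^ k * a u = p.eval (u : ℂ)) (fun k m => ?_) ⟨0, 0, by simp⟩ ?_
  · obtain ⟨k, rfl | rfl⟩ := k.eq_nat_or_neg
    · exact ⟨0, Polynomial.C m * Polynomial.X ^ k, fun u => by simp; ring⟩
    · exact ⟨k, Polynomial.C m, fun u => by simp⟩
  · rintro f g ⟨k, p, hp⟩ ⟨l, r, hr⟩
    refine ⟨k + l, Polynomial.X ^ l * p + Polynomial.X ^ k * r, fun u => ?_⟩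
    rw [Polynomial.eval_add, Polynomial.eval_mul, Polynomial.eval_mul, ← hp, ← hr, Pi.add_apply,
      Polynomial.eval_pow, Polynomial.eval_pow, Polynomial.eval_X]
    ring

/-- A Laurent family is determined by its values on an infinite set. -/
lemma eq_zero (hf : IsLaurent f) {S : Set ℂˣ} (hS : S.Infinite) (h : ∀ u ∈ S, f u = 0) (u : ℂˣ) :
    f u = 0 := by
  rw [← Module.forall_dual_apply_eq_zero_iff ℂ]
  intro φ
  obtain ⟨k, p, hp⟩ := (hf.map φ).exists_polynomial
  have hp0 : p = 0 := by
    refine Polynomial.eq_zero_of_infinite_isRoot p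
      ((hS.image (Units.val_injective.injOn)).mono ?_)
    rintro _ ⟨v, hv, rfl⟩
    rw [Set.mem_ofPred_eq, Polynomial.IsRoot, ← hp, h v hv, map_zero, mul_zero]
  have := hp u
  rw [hp0, Polynomial.eval_zero] at this
  exact (mul_eq_zero.1 this).resolve_left (pow_ne_zero _ u.ne_zero)

end IsLaurent

end Laurent

/-! ### The solution for all nonzero parameters -/

section Family

variable {n : ℕ}

lemma isLaurent_loopWeight : IsLaurent fun u : ℂˣ => loopWeight (u : ℂ) := by
  convert (isLaurent_const (0 : ℂ)).sub (isLaurent_val.add isLaurent_inv) using 2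
  rw [loopWeight, zero_sub]

lemma isLaurent_genC (i : Fin (2 * n + 1)) (σ ρ : OpenLinkPattern (2 * n + 1)) :
    IsLaurent fun u : ℂˣ => genC n (loopWeight (u : ℂ)) i σ ρ := by
  refine Fin.lastCases ?_ (fun i => ?_) i
  · simp only [genC_last, lastE]
    split_ifs
    exacts [isLaurent_loopWeight, isLaurent_const _, isLaurent_const _]
  · simp only [genC_castSucc, bulkE, bulkWeight]
    split_ifs
    exacts [isLaurent_loopWeight, isLaurent_loopWeight, isLaurent_const _, isLaurent_const _,
      isLaurent_const _]

lemma IsLaurent.heckeT {f : ℂˣ → Box n} (hf : IsLaurent f) (i : Fin (2 * n + 1)) :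
    IsLaurent fun u => heckeT n u i (f u) :=
  hf.map_family fun m => (isLaurent_val.smul (isLaurent_const (difference n i m))).sub
    (isLaurent_inv.smul (isLaurent_const (difference n i m + reflect n i m)))

lemma isLaurent_baseBox : IsLaurent fun u : ℂˣ => baseBox n u.ne_zero := by
  refine IsLaurent.of_subtype ?_
  change IsLaurent fun u : ℂˣ => baseEntry n u
  unfold baseEntry
  refine IsLaurent.prod _ fun i _ => IsLaurent.prod _ fun j _ => ?_
  simp only [← smul_eq_C_mul]
  exact (isLaurent_val.smul (isLaurent_const _)).sub (isLaurent_inv.smul (isLaurent_const _))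

lemma IsLaurent.invert {f : ℂˣ → Box n} (hf : IsLaurent f) (i : Fin (2 * n + 1)) (k : ℕ) :
    IsLaurent fun u => invert n i ((u : ℂ) ^ k) (f u) := by
  refine hf.map_family fun m => IsLaurent.of_subtype ?_
  change IsLaurent fun u : ℂˣ => inversion (2 * n) i ((u : ℂ) ^ k) m.1
  rw [m.1.as_sum]
  simp only [map_sum, inversion_monomial]
  refine IsLaurent.sum _ fun s _ => ?_
  refine IsLaurent.map ?_ (monomial (s.update i (2 * n - s i)))
  have h : IsLaurent fun u : ℂˣ => (((u : ℂ) ^ k) ^ (2 * n) * (((u : ℂ) ^ k) ^ (2 * s i))⁻¹) := by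
    convert isLaurent_zpow_smul (k * (2 * n) - k * (2 * s i) : ℤ) (1 : ℂ) using 2 with u
    rw [smul_eq_mul, mul_one, zpow_sub, Units.val_mul]
    push_cast
    simp only [← pow_mul]
    norm_cast
  exact (isLaurent_const (coeff s m.1)).mul h

/-- The parameters for which the solution is constructed by projection from the spin chain. -/
def genericSet : Set ℂˣ := {u | ∃ κ : ℝ, κ ≠ 0 ∧ 1 < κ ^ 2 ∧ κ ^ 2 < 2 ∧ (u : ℂ) = (κ : ℂ) ^ 2}

lemma genericSet_infinite : genericSet.Infinite := by
  have h : ∀ x : Set.Ioo (1 : ℝ) 2, ((x : ℝ) : ℂ) ≠ 0 := fun x => by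
    have := x.2.1
    exact_mod_cast (by linarith : (x : ℝ) ≠ 0)
  have hinj : Function.Injective fun x : Set.Ioo (1 : ℝ) 2 => Units.mk0 ((x : ℝ) : ℂ) (h x) := by
    intro x y hxy
    have := congrArg Units.val hxy
    simpa [Subtype.ext_iff] using this
  have : Infinite (Set.Ioo (1 : ℝ) 2) := (Set.Ioo_infinite (by norm_num)).to_subtype
  refine (Set.infinite_range_of_injective hinj).mono ?_
  rintro _ ⟨x, rfl⟩
  have h1 := x.2.1
  have hs : √(x : ℝ) ^ 2 = x := Real.sq_sqrt (by linarith)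
  refine ⟨√x, ?_, by rwa [hs], by rw [hs]; exact x.2.2, ?_⟩
  · exact (Real.sqrt_pos.2 (by linarith)).ne'
  · rw [← Complex.ofReal_pow, hs]; rfl

/-- The solutions for `1 < q < 2` are restrictions of Laurent families, by triangularity, and the
equations extend to all nonzero parameters. -/
theorem exists_solution (n : ℕ) :
    ∃ Ψ : ℂˣ → OpenLinkPattern (2 * n + 1) → Box n, (∀ π, IsLaurent fun u => Ψ u π) ∧
      ∀ u : ℂˣ, SolvesHecke (u : ℂ) (Ψ u) ∧
      Ψ u (allOpen (2 * n + 1)) = baseBox n u.ne_zero ∧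
      ∀ σ, invert n 0 ((u : ℂ) ^ 3) (Ψ u σ) = matAct (sOp n ℂ) (Ψ u) σ := by
  have hgen : ∀ u : ℂˣ, ∃ Ψ : OpenLinkPattern (2 * n + 1) → Box n, u ∈ genericSet →
      SolvesHecke (u : ℂ) Ψ ∧ Ψ (allOpen (2 * n + 1)) = baseBox n u.ne_zero ∧
      ∀ σ, invert n 0 ((u : ℂ) ^ 3) (Ψ σ) = matAct (sOp n ℂ) Ψ σ := by
    intro u
    by_cases hu : u ∈ genericSet
    · obtain ⟨κ, h0, h1, h2, h3⟩ := hu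
      obtain ⟨v, v', hv, hv'⟩ := u
      simp only at h3
      subst h3
      obtain ⟨Ψ, h⟩ := exists_generic_solution (n := n) h0 h1 h2 (left_ne_zero_of_mul_eq_one hv)
      exact ⟨Ψ, fun _ => h⟩
    · exact ⟨0, fun h => absurd h hu⟩
  choose G hG using hgen
  have key : ∀ m π, downArea (closings π) = m →
      ∃ P : ℂˣ → Box n, IsLaurent P ∧ ∀ u ∈ genericSet, P u = G u π := by
    intro m
    induction m using Nat.strong_induction_on with
    | _ m ih =>
      rintro π rfl
      by_cases hπ : π = allOpen (2 * n + 1)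
      · subst hπ
        exact ⟨_, isLaurent_baseBox, fun u hu => (hG u hu).2.1.symm⟩
      obtain ⟨i, σ, hσ, h⟩ := exists_predecessor hπ
      have ih' : ∀ ρ, ∃ P : ℂˣ → Box n, IsLaurent P ∧
          (downArea (closings ρ) < downArea (closings π) → ∀ u ∈ genericSet, P u = G u ρ) := by
        intro ρ
        by_cases hρ : downArea (closings ρ) < downArea (closings π)
        · obtain ⟨P, h1, h2⟩ := ih _ hρ ρ rfl
          exact ⟨P, h1, fun _ => h2⟩
        · exact ⟨_, isLaurent_const 0, fun h => absurd h hρ⟩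
      choose Q hQ1 hQ2 using ih'
      refine ⟨fun u => heckeT n u i (Q σ u) - (u : ℂ) • Q σ u -
        ∑ ρ with ρ ≠ π, genC n (loopWeight (u : ℂ)) i σ ρ • Q ρ u, ?_, fun u hu => ?_⟩
      · exact (((hQ1 σ).heckeT i).sub (isLaurent_val.smul (hQ1 σ))).sub
          (IsLaurent.sum _ fun ρ _ => (isLaurent_genC i σ ρ).smul (hQ1 ρ))
      · obtain ⟨h1, h2⟩ := h (loopWeight u)
        have h3 := (hG u hu).1 i σ
        rw [matAct_eq_of_triangular h1] at h3
        have h4 : ∑ ρ with ρ ≠ π, genC n (loopWeight (u : ℂ)) i σ ρ • Q ρ u =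
            ∑ ρ with ρ ≠ π, genC n (loopWeight (u : ℂ)) i σ ρ • G u ρ := by
          refine Finset.sum_congr rfl fun ρ hρ => ?_
          by_cases h5 : genC n (loopWeight (u : ℂ)) i σ ρ = 0
          · rw [h5, zero_smul, zero_smul]
          · rw [hQ2 ρ (h2 ρ h5 (Finset.mem_filter.1 hρ).2) u hu]
        beta_reduce
        rw [h4, hQ2 σ hσ u hu, h3]
        abel
  choose P hP1 hP2 using fun π => key _ π rfl
  -- identities between Laurent families hold for all parameters if they hold for generic ones
  have hext : ∀ f g : ℂˣ → Box n, IsLaurent f → IsLaurent g → (∀ u ∈ genericSet, f u = g u) →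
      ∀ u, f u = g u := fun f g hf hg h u =>
    sub_eq_zero.1 ((hf.sub hg).eq_zero genericSet_infinite
      (fun v hv => sub_eq_zero.2 (h v hv)) u)
  refine ⟨fun u π => P π u, hP1, fun u => ⟨fun i σ => ?_, ?_, fun σ => ?_⟩⟩
  · refine hext (fun u => heckeT n u i (P σ u)) (fun u => (u : ℂ) • P σ u +
      matAct (genC n (loopWeight (u : ℂ)) i) (fun π => P π u) σ) ((hP1 σ).heckeT i)
      ((isLaurent_val.smul (hP1 σ)).add
        (IsLaurent.sum _ fun ρ _ => (isLaurent_genC i σ ρ).smul (hP1 ρ))) (fun u hu => ?_) u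
    have := (hG u hu).1 i σ
    rw [show (fun π => P π u) = G u from funext fun π => hP2 π u hu, hP2 σ u hu]
    exact this
  · exact hext _ _ (hP1 _) isLaurent_baseBox
      (fun u hu => (hP2 _ u hu).trans (hG u hu).2.1) u
  · refine hext (fun u => invert n 0 ((u : ℂ) ^ 3) (P σ u)) (fun u =>
      matAct (sOp n ℂ) (fun π => P π u) σ) ((hP1 σ).invert 0 3)
      (IsLaurent.sum _ fun ρ _ => (isLaurent_const _).smul (hP1 ρ)) (fun u hu => ?_) u
    rw [show (fun π => P π u) = G u from funext fun π => hP2 π u hu, hP2 σ u hu]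
    exact (hG u hu).2.2 σ

end Family

end
end CqKZ

namespace CqKZ
open OpenLinkPattern MvPolynomial

noncomputable section

/-! ### The equations over the field of rational functions -/

section Translation

variable {n : ℕ} {q : ℂ}

lemma aeval_w (f : MvPolynomial (Fin (2 * n + 1)) ℂ) :
    aeval (w n) f = algebraMap (MvPolynomial (Fin (2 * n + 1)) ℂ) (RatFun n) f := by
  have : aeval (w n) = IsScalarTower.toAlgHom ℂ (MvPolynomial (Fin (2 * n + 1)) ℂ) (RatFun n) := by
    apply algHom_ext
    intro i
    rw [aeval_X]
    rfl
  rw [this]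
  rfl

lemma aeval_w_injective : Function.Injective (aeval (R := ℂ) (w n)) := by
  intro f g h
  rw [aeval_w, aeval_w] at h
  exact IsFractionRing.injective _ _ h

lemma w_ne_zero (i : Fin (2 * n + 1)) : w n i ≠ 0 := by
  rw [← aeval_X (R := ℂ) (w n) i]
  exact fun h => X_ne_zero i (aeval_w_injective (h.trans (map_zero _).symm))

lemma const_ne_zero (hq : q ≠ 0) : const n q ≠ 0 := by
  rw [const]
  exact (map_ne_zero _).2 hq

lemma const_inv : (const n q)⁻¹ = const n q⁻¹ := (map_inv₀ _ q).symm

lemma loopWeight_const : loopWeight (const n q) = algebraMap ℂ (RatFun n) (loopWeight q) := by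
  rw [loopWeight, loopWeight, const_inv, map_neg, map_add]
  rfl

lemma bulkE_const (i : Fin (2 * n)) (σ ρ : OpenLinkPattern (2 * n + 1)) :
    bulkE n (loopWeight (const n q)) i σ ρ =
      algebraMap ℂ (RatFun n) (bulkE n (loopWeight q) i σ ρ) := by
  simp only [bulkE, bulkWeight, loopWeight_const]
  split_ifs
  exacts [rfl, rfl, (map_ofNat _ 2).symm, (map_one _).symm, (map_zero _).symm]

lemma gen_eq (i : Fin (2 * n + 1)) (σ ρ : OpenLinkPattern (2 * n + 1)) :
    gen n q i σ ρ = algebraMap ℂ (RatFun n) (genC n (loopWeight q) i σ ρ) := by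
  refine Fin.lastCases ?_ (fun i => ?_) i
  · rw [gen, Fin.lastCases_last, genC_last, lastE, lastE, loopWeight_const]
    split_ifs <;> simp
  · rw [gen, Fin.lastCases_castSucc, genC_castSucc, bulkE_const]

lemma sOp_eq (σ ρ : OpenLinkPattern (2 * n + 1)) :
    sOp n (RatFun n) σ ρ = algebraMap ℂ (RatFun n) (sOp n ℂ σ ρ) := by
  simp only [sOp]
  split_ifs <;> simp

lemma arg_last : arg n (Fin.last (2 * n)) = 1 / w n (Fin.last (2 * n)) ^ 2 :=
  Fin.lastCases_last ..

lemma arg_castSucc (i : Fin (2 * n)) : arg n i.castSucc = w n i.succ / w n i.castSucc :=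
  Fin.lastCases_castSucc ..

lemma reflectedPoint_last : reflectedPoint n (Fin.last (2 * n)) =
    Function.update (w n) (Fin.last (2 * n)) (1 / w n (Fin.last (2 * n))) :=
  Fin.lastCases_last ..

lemma reflectedPoint_castSucc (i : Fin (2 * n)) :
    reflectedPoint n i.castSucc = w n ∘ Equiv.swap i.castSucc i.succ :=
  Fin.lastCases_castSucc ..

lemma prefactor_last (m : ℕ) :
    prefactor n m (Fin.last (2 * n)) = (w n (Fin.last (2 * n)) ^ m)⁻¹ :=
  Fin.lastCases_last ..

lemma prefactor_castSucc (m : ℕ) (i : Fin (2 * n)) : prefactor n m i.castSucc = 1 :=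
  Fin.lastCases_castSucc ..

lemma prefactor_ne_zero (m : ℕ) (i : Fin (2 * n + 1)) : prefactor n m i ≠ 0 := by
  refine Fin.lastCases ?_ (fun i => ?_) i
  · rw [prefactor_last]
    exact inv_ne_zero (pow_ne_zero _ (w_ne_zero _))
  · rw [prefactor_castSucc]
    exact one_ne_zero

lemma aeval_linForm {K : Type} [Field K] [Algebra ℂ K] (v : Fin (2 * n + 1) → K)
    (i j : Fin (2 * n + 1)) : aeval v (linForm q i j) =
      algebraMap ℂ K q * v i - (algebraMap ℂ K q)⁻¹ * v j := by
  simp [linForm]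

lemma denominator_ne_zero (hq : q ≠ 0) (i : Fin (2 * n + 1)) :
    const n q - (const n q)⁻¹ * arg n i ≠ 0 := by
  refine Fin.lastCases ?_ (fun i => ?_) i
  · intro h
    rw [arg_last] at h
    have h0 := w_ne_zero (Fin.last (2 * n))
    have h1 : aeval (w n) (C q * X (Fin.last (2 * n)) ^ 2 - C q⁻¹ :
        MvPolynomial (Fin (2 * n + 1)) ℂ) = 0 := by
      have e : const n q * w n (Fin.last (2 * n)) ^ 2 - (const n q)⁻¹ = 0 := by
        have := congrArg (· * w n (Fin.last (2 * n)) ^ 2) h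
        simp only [zero_mul] at this
        rw [← this, sub_mul, mul_assoc (const n q)⁻¹, one_div,
          inv_mul_cancel₀ (pow_ne_zero 2 h0), mul_one]
      rw [const_inv] at e
      simpa [const] using e
    have h2 := aeval_w_injective (h1.trans (map_zero _).symm)
    have h3 := congrArg (eval 0) h2
    simp [hq] at h3
  · intro h
    rw [arg_castSucc] at h
    have h0 := w_ne_zero i.castSucc
    refine linForm_ne_zero hq (castSucc_ne_succ i)
      (aeval_w_injective (Eq.trans ?_ (map_zero _).symm))
    rw [aeval_linForm]
    have := congrArg (· * w n i.castSucc) h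
    simp only [zero_mul, sub_mul] at this
    rw [mul_assoc (const n q)⁻¹, div_mul_cancel₀ _ h0] at this
    exact this

lemma arg_sub_one_ne_zero (i : Fin (2 * n + 1)) : arg n i - 1 ≠ 0 := by
  rw [sub_ne_zero]
  refine Fin.lastCases ?_ (fun i => ?_) i
  · intro h
    rw [arg_last, div_eq_one_iff_eq (pow_ne_zero 2 (w_ne_zero _))] at h
    refine one_sub_X_sq_ne_zero (Fin.last (2 * n))
      (aeval_w_injective (Eq.trans ?_ (map_zero _).symm))
    simp [← h]
  · intro h
    rw [arg_castSucc, div_eq_one_iff_eq (w_ne_zero _)] at h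
    refine X_sub_X_ne_zero (castSucc_ne_succ i) (aeval_w_injective (Eq.trans ?_ (map_zero _).symm))
    simp [← h]

/-- The relation between a bulk reflection and the Hecke generator, at an arbitrary point. -/
lemma aeval_comp_swap {K : Type} [Field K] [Algebra ℂ K] (i : Fin (2 * n)) (f : Box n)
    (v : Fin (2 * n + 1) → K) :
    (algebraMap ℂ K q * v i.castSucc - (algebraMap ℂ K q)⁻¹ * v i.succ) *
      aeval (v ∘ Equiv.swap i.castSucc i.succ) f.1 =
    (algebraMap ℂ K q * v i.succ - (algebraMap ℂ K q)⁻¹ * v i.castSucc) * aeval v f.1 +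
      (v i.succ - v i.castSucc) * aeval v (heckeT n q i.castSucc f - q • f).1 := by
  have h1 := congrArg (aeval v) (heckeT_castSucc q i f)
  have h2 : aeval v (reflect n i.castSucc f).1 =
      aeval (v ∘ Equiv.swap i.castSucc i.succ) f.1 := by
    simp only [reflect, Fin.lastCases_castSucc, coe_exchange, aeval_rename]
  simp only [map_mul, map_sub, aeval_X, h2, aeval_C, map_inv₀] at h1
  rw [Submodule.coe_sub, Submodule.coe_smul, map_sub, map_smul, Algebra.smul_def]
  linear_combination -h1

/-- The relation between the reflection of a single polynomial and the Hecke generator. -/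
lemma aeval_reflectedPoint (i : Fin (2 * n + 1)) (f : Box n) :
    (const n q - (const n q)⁻¹ * arg n i) *
      ((prefactor n (2 * n) i)⁻¹ * aeval (reflectedPoint n i) f.1) =
    (const n q * arg n i - (const n q)⁻¹) * aeval (w n) f.1 +
      (arg n i - 1) * aeval (w n) (heckeT n q i f - q • f).1 := by
  refine Fin.lastCases ?_ (fun i => ?_) i
  · have h0 := w_ne_zero (Fin.last (2 * n))
    have h1 := congrArg (aeval (w n)) (heckeT_last q f)
    have h2 := aeval_invert one_ne_zero h0 f
    rw [map_one, one_pow, one_mul] at h2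
    have h3 : reflect n (Fin.last (2 * n)) = invert n (Fin.last (2 * n)) 1 :=
      Fin.lastCases_last ..
    simp only [map_mul, map_sub, map_pow, map_one, aeval_X, h3, h2, aeval_C, map_inv₀] at h1
    rw [arg_last, reflectedPoint_last, prefactor_last, inv_inv,
      Submodule.coe_sub, Submodule.coe_smul, map_sub, map_smul, Algebra.smul_def]
    change (const n q - (const n q)⁻¹ * _) * _ = _ + _ * (_ - const n q * _)
    rw [show algebraMap ℂ (RatFun n) q = const n q from rfl] at h1
    set c := w n (Fin.last (2 * n))
    have h4 : c ^ 2 * (1 / c ^ 2) = 1 := mul_one_div_cancel (pow_ne_zero 2 h0)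
    refine mul_left_cancel₀ (pow_ne_zero 2 h0) ?_
    generalize (1 / c ^ 2) = x at h4 ⊢
    linear_combination -h1 + (-(const n q)⁻¹ * (c ^ (2 * n) * aeval (Function.update (w n)
      (Fin.last (2 * n)) (1 / c)) f.1) - aeval (w n) (heckeT n q (Fin.last (2 * n)) f).1) * h4
  · have h0 := w_ne_zero i.castSucc
    have h1 := aeval_comp_swap (q := q) i f (w n)
    rw [arg_castSucc, reflectedPoint_castSucc, prefactor_castSucc, inv_one, one_mul]
    rw [show algebraMap ℂ (RatFun n) q = const n q from rfl] at h1
    have h4 : w n i.castSucc * (w n i.succ / w n i.castSucc) = w n i.succ := mul_div_cancel₀ _ h0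
    refine mul_left_cancel₀ h0 ?_
    rw [← h4] at h1
    generalize (w n i.succ / w n i.castSucc) = x at h1 ⊢
    linear_combination h1

/-- The components of the vector on the left hand side of the reflection equations. -/
lemma RMat_mulVec (Φ : PolyVec n) (v : Fin (2 * n + 1) → RatFun n) (e : Op n (RatFun n))
    (x : RatFun n) (σ : OpenLinkPattern (2 * n + 1)) :
    (RMat (const n q) e x).mulVec (evalAt Φ v) σ =
      (const n q - (const n q)⁻¹ * x)⁻¹ * ((const n q * x - (const n q)⁻¹) * evalAt Φ v σ +
        (x - 1) * e.mulVec (evalAt Φ v) σ) := by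
  rw [RMat, Matrix.smul_mulVec, Matrix.add_mulVec, Matrix.smul_mulVec, Matrix.smul_mulVec,
    Matrix.one_mulVec]
  rfl

lemma mulVec_algebraMap (Φ : PolyVec n) (v : Fin (2 * n + 1) → RatFun n) {e : Op n (RatFun n)}
    {A : Op n ℂ} (he : ∀ σ ρ, e σ ρ = algebraMap ℂ (RatFun n) (A σ ρ))
    (σ : OpenLinkPattern (2 * n + 1)) :
    e.mulVec (evalAt Φ v) σ = aeval v (matAct A Φ σ) := by
  rw [Matrix.mulVec, dotProduct, matAct, map_sum]
  refine Finset.sum_congr rfl fun ρ _ => ?_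
  rw [he, map_smul, Algebra.smul_def, evalAt]

/-- A reflection equation with the denominators cleared. -/
lemma reflection_iff (hq : q ≠ 0) (Φ : PolyVec n) (m : ℕ) (i : Fin (2 * n + 1)) :
    (prefactor n m i • (RMat (const n q) (gen n q i) (arg n i)).mulVec (evalAt Φ (w n)) =
      evalAt Φ (reflectedPoint n i)) ↔
    ∀ σ, (const n q - (const n q)⁻¹ * arg n i) *
      ((prefactor n m i)⁻¹ * aeval (reflectedPoint n i) (Φ σ)) =
    (const n q * arg n i - (const n q)⁻¹) * aeval (w n) (Φ σ) +
      (arg n i - 1) * aeval (w n) (matAct (genC n (loopWeight q) i) Φ σ) := by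
  rw [funext_iff]
  refine forall_congr' fun σ => ?_
  rw [Pi.smul_apply, RMat_mulVec, mulVec_algebraMap Φ (w n) (gen_eq i), smul_eq_mul]
  have h1 := denominator_ne_zero hq i
  have h2 := prefactor_ne_zero m i
  simp only [evalAt]
  generalize const n q - (const n q)⁻¹ * arg n i = d at h1 ⊢
  generalize prefactor n m i = p at h2 ⊢
  constructor
  · intro h
    rw [← h, inv_mul_cancel_left₀ h2, mul_inv_cancel_left₀ h1]
  · intro h
    rw [← h, inv_mul_cancel_left₀ h1, mul_inv_cancel_left₀ h2]

/-- A vector of elements of `Box n` as a vector of polynomials. -/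
def toPolyVec (Ψ : OpenLinkPattern (2 * n + 1) → Box n) : PolyVec n := fun π => (Ψ π).1

lemma matAct_toPolyVec (A : Op n ℂ) (Ψ : OpenLinkPattern (2 * n + 1) → Box n)
    (σ : OpenLinkPattern (2 * n + 1)) : matAct A (toPolyVec Ψ) σ = (matAct A Ψ σ).1 :=
  (map_matAct (Box n).subtype A Ψ σ).symm

/-- With `m = 2 n` the reflection equations are the equations for the Hecke generators. -/
lemma reflection_iff_solvesHecke (hq : q ≠ 0) (Ψ : OpenLinkPattern (2 * n + 1) → Box n) :
    (∀ i, prefactor n (2 * n) i • (RMat (const n q) (gen n q i) (arg n i)).mulVec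
        (evalAt (toPolyVec Ψ) (w n)) = evalAt (toPolyVec Ψ) (reflectedPoint n i)) ↔
      SolvesHecke q Ψ := by
  refine forall_congr' fun i => (reflection_iff hq _ _ i).trans (forall_congr' fun σ => ?_)
  rw [matAct_toPolyVec]
  change _ * (_ * aeval _ (Ψ σ).1) = _ ↔ _
  rw [aeval_reflectedPoint]
  change _ + _ = _ * aeval (w n) (Ψ σ).1 + _ ↔ _
  rw [add_right_inj,
    mul_right_inj' (arg_sub_one_ne_zero i), aeval_w_injective.eq_iff, ← Subtype.ext_iff,
    sub_eq_iff_eq_add']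

end Translation

end
end CqKZ

namespace CqKZ
open OpenLinkPattern MvPolynomial

noncomputable section

/-! ### Verification of the system -/

section Verification

variable {n : ℕ} {q : ℂ} {Ψ : OpenLinkPattern (2 * n + 1) → Box n}

lemma degIn_le (i : Fin (2 * n + 1)) : degIn i (toPolyVec Ψ) ≤ 2 * n :=
  Finset.sup_le fun π _ => degreeOf_le_of_mem_box (Ψ π) i

lemma degIn_eq (hq : q ≠ 0) (h0 : Ψ (allOpen (2 * n + 1)) = baseBox n hq)
    (i : Fin (2 * n + 1)) : degIn i (toPolyVec Ψ) = 2 * n := by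
  refine le_antisymm (degIn_le i) ?_
  rw [← baseEntry_degreeOf hq i]
  have h : toPolyVec Ψ (allOpen (2 * n + 1)) = baseEntry n q := congrArg Subtype.val h0
  rw [← h]
  exact Finset.le_sup (f := fun π => (toPolyVec Ψ π).degreeOf i) (Finset.mem_univ _)

/-- The relation for `s` at an arbitrary point. -/
lemma sOp_mulVec_invert (hq : q ≠ 0)
    (hs : ∀ σ, invert n 0 (q ^ 3) (Ψ σ) = matAct (sOp n ℂ) Ψ σ)
    {v : Fin (2 * n + 1) → RatFun n} (hv : v 0 ≠ 0) :
    (sOp n (RatFun n)).mulVec (evalAt (toPolyVec Ψ) v) =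
      (const n q ^ 3 * v 0) ^ (2 * n) •
        evalAt (toPolyVec Ψ) (Function.update v 0 (1 / (const n q ^ 6 * v 0))) := by
  funext σ
  rw [mulVec_algebraMap _ _ sOp_eq, matAct_toPolyVec, ← hs, aeval_invert (pow_ne_zero 3 hq) hv,
    map_pow, ← pow_mul]
  rfl

lemma affineReflection (hq : q ≠ 0) (h0 : Ψ (allOpen (2 * n + 1)) = baseBox n hq)
    (hs : ∀ σ, invert n 0 (q ^ 3) (Ψ σ) = matAct (sOp n ℂ) Ψ σ) :
    AffineReflection q (toPolyVec Ψ) := by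
  rw [AffineReflection, sOp_mulVec_invert hq hs (w_ne_zero 0), degIn_eq hq h0,
    inv_smul_smul₀ (pow_ne_zero _ (mul_ne_zero (pow_ne_zero 3 (const_ne_zero hq)) (w_ne_zero 0)))]

lemma cutFirst_open (π : OpenLinkPattern (2 * n + 1)) : π.cutFirst.1 0 = 0 :=
  cutFun_self (p := π.1) (a := 0)

lemma sOp_mul_sOp : sOp n (RatFun n) * sOp n (RatFun n) = 1 := by
  ext σ π
  rw [Matrix.mul_apply, Matrix.one_apply]
  by_cases h : π.1 0 = 0
  · simp [sOp, h]
  · have h1 : ∀ ρ, sOp n (RatFun n) σ ρ * sOp n (RatFun n) ρ π =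
        (if ρ = π.cutFirst then sOp n (RatFun n) σ ρ else 0) -
          if ρ = π then sOp n (RatFun n) σ ρ else 0 := by
      intro ρ
      rw [show sOp n (RatFun n) ρ π = (if ρ = π.cutFirst then 1 else 0) - if ρ = π then 1 else 0
        from if_neg h, mul_sub, mul_ite, mul_ite, mul_one, mul_zero]
    rw [Finset.sum_congr rfl fun ρ _ => h1 ρ, Finset.sum_sub_distrib, Finset.sum_ite_eq',
      Finset.sum_ite_eq', if_pos (Finset.mem_univ _), if_pos (Finset.mem_univ _)]
    simp only [sOp]
    rw [if_pos (cutFirst_open π), if_neg h]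
    ring

/-- The bulk reflection equations at an arbitrary point. -/
lemma RMat_mulVec_of_solvesHecke (h : SolvesHecke q Ψ) (i : Fin (2 * n))
    {v : Fin (2 * n + 1) → RatFun n} (hv : v i.castSucc ≠ 0)
    (hd : const n q - (const n q)⁻¹ * (v i.succ / v i.castSucc) ≠ 0) :
    (RMat (const n q) (bulkE n (loopWeight (const n q)) i) (v i.succ / v i.castSucc)).mulVec
        (evalAt (toPolyVec Ψ) v) =
      evalAt (toPolyVec Ψ) (v ∘ Equiv.swap i.castSucc i.succ) := by
  funext σ
  have h1 := aeval_comp_swap (q := q) i (Ψ σ) v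
  rw [h, add_sub_cancel_left] at h1
  rw [RMat_mulVec, mulVec_algebraMap _ v (bulkE_const i), matAct_toPolyVec,
    inv_mul_eq_iff_eq_mul₀ hd]
  change _ * aeval v (Ψ σ).1 + _ = _ * aeval _ (Ψ σ).1
  rw [← genC_castSucc]
  rw [show algebraMap ℂ (RatFun n) q = const n q from rfl] at h1
  have h4 : v i.castSucc * (v i.succ / v i.castSucc) = v i.succ := mul_div_cancel₀ _ hv
  refine mul_left_cancel₀ hv ?_
  rw [← h4] at h1
  generalize (v i.succ / v i.castSucc) = x at h1 ⊢
  linear_combination -h1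

lemma affine_denominator_ne_zero (hq : q ≠ 0) (i : Fin (2 * n)) :
    const n q - (const n q)⁻¹ * (const n q ^ 6 * w n i.castSucc * w n i.succ) ≠ 0 := by
  intro h
  have h1 : aeval (w n) (C q - C (q⁻¹ * q ^ 6) * X i.castSucc * X i.succ :
      MvPolynomial (Fin (2 * n + 1)) ℂ) = 0 := by
    rw [const_inv] at h
    rw [← h]
    simp only [const, map_sub, map_mul, aeval_C, aeval_X, map_pow]
    ring
  have h2 := aeval_w_injective (h1.trans (map_zero _).symm)
  have h3 := congrArg (eval 0) h2
  simp [hq] at h3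

/-- The affine equation is the first bulk equation conjugated by the affine reflection. -/
lemma affine_equation (hq : q ≠ 0) (h : SolvesHecke q Ψ)
    (hs : ∀ σ, invert n 0 (q ^ 3) (Ψ σ) = matAct (sOp n ℂ) Ψ σ) (i : Fin (2 * n))
    (hi : i.val = 0) :
    ((const n q ^ 6 * w n i.castSucc * w n i.succ) ^ (2 * n))⁻¹ •
        (RMat (const n q) (extraE n q i)
          (const n q ^ 6 * w n i.castSucc * w n i.succ)).mulVec (evalAt (toPolyVec Ψ) (w n)) =
      evalAt (toPolyVec Ψ) (Function.update
        (Function.update (w n) i.castSucc (1 / (const n q ^ 6 * w n i.succ)))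
        i.succ (1 / (const n q ^ 6 * w n i.castSucc))) := by
  have hQ := const_ne_zero (n := n) hq
  have ha := w_ne_zero i.castSucc
  have hb := w_ne_zero i.succ
  have hne := castSucc_ne_succ i
  have hi0 : i.castSucc = 0 := Fin.ext hi
  set s := sOp n (RatFun n) with hsdef
  set Q := const n q with hQdef
  set a := w n i.castSucc with hadef
  set b := w n i.succ with hbdef
  -- reflect the first point, exchange the first two, and reflect the first point again
  set v₁ := Function.update (w n) i.castSucc (1 / (Q ^ 6 * a)) with hv₁
  set v₂ := v₁ ∘ Equiv.swap i.castSucc i.succ with hv₂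
  have e1 : s.mulVec (evalAt (toPolyVec Ψ) (w n)) =
      (Q ^ 3 * a) ^ (2 * n) • evalAt (toPolyVec Ψ) v₁ := by
    have := sOp_mulVec_invert hq hs (w_ne_zero 0)
    rwa [← hi0] at this
  have h11 : v₁ i.castSucc = 1 / (Q ^ 6 * a) := Function.update_self ..
  have h12 : v₁ i.succ = b := Function.update_of_ne hne.symm ..
  have hx : v₁ i.succ / v₁ i.castSucc = Q ^ 6 * a * b := by
    rw [h11, h12]
    field_simp
  have e2 := RMat_mulVec_of_solvesHecke h i (v := v₁)
    (by rw [h11]; exact one_div_ne_zero (mul_ne_zero (pow_ne_zero 6 hQ) ha))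
    (by rw [hx]; exact affine_denominator_ne_zero hq i)
  rw [hx] at e2
  have h21 : v₂ i.castSucc = b := by simp [hv₂, h12]
  have h22 : v₂ i.succ = 1 / (Q ^ 6 * a) := by simp [hv₂, h11]
  have e3 : s.mulVec (evalAt (toPolyVec Ψ) v₂) = (Q ^ 3 * b) ^ (2 * n) • evalAt (toPolyVec Ψ)
      (Function.update (Function.update (w n) i.castSucc (1 / (Q ^ 6 * b)))
        i.succ (1 / (Q ^ 6 * a))) := by
    have := sOp_mulVec_invert hq hs (v := v₂) (by rw [← hi0, h21]; exact hb)
    rw [← hi0, h21] at this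
    rw [this]
    congr 2
    funext x
    by_cases h1 : x = i.castSucc
    · subst h1
      rw [Function.update_self, Function.update_of_ne hne, Function.update_self]
    · rw [Function.update_of_ne h1]
      by_cases h2 : x = i.succ
      · subst h2
        rw [h22, Function.update_self]
      · rw [Function.update_of_ne h2, Function.update_of_ne h1, hv₂, Function.comp_apply,
          Equiv.swap_apply_of_ne_of_ne h1 h2, hv₁, Function.update_of_ne h1]
  have hR : RMat Q (extraE n q i) (Q ^ 6 * a * b) =
      s * RMat Q (bulkE n (loopWeight Q) i) (Q ^ 6 * a * b) * s := by
    rw [RMat, RMat, extraE, ← hsdef]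
    simp only [Matrix.mul_smul, Matrix.smul_mul, Matrix.mul_add, Matrix.add_mul, Matrix.mul_one]
    rw [hsdef, sOp_mul_sOp]
  rw [hR, ← Matrix.mulVec_mulVec, ← Matrix.mulVec_mulVec, e1, Matrix.mulVec_smul, e2,
    Matrix.mulVec_smul, e3, smul_smul, smul_smul]
  have hc : ((Q ^ 6 * a * b) ^ (2 * n))⁻¹ * (Q ^ 3 * a) ^ (2 * n) * (Q ^ 3 * b) ^ (2 * n) = 1 := by
    rw [mul_assoc, ← mul_pow, show Q ^ 3 * a * (Q ^ 3 * b) = Q ^ 6 * a * b by ring,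
      inv_mul_cancel₀ (pow_ne_zero _ (mul_ne_zero (mul_ne_zero (pow_ne_zero 6 hQ) ha) hb))]
  rw [hc, one_smul]

lemma isSolution (hq : q ≠ 0) (h : SolvesHecke q Ψ)
    (h0 : Ψ (allOpen (2 * n + 1)) = baseBox n hq)
    (hs : ∀ σ, invert n 0 (q ^ 3) (Ψ σ) = matAct (sOp n ℂ) Ψ σ) :
    IsSolution q (toPolyVec Ψ) where
  reflection := by
    rw [degIn_eq hq h0]
    exact (reflection_iff_solvesHecke hq Ψ).2 h
  affine := by
    rw [degIn_eq hq h0]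
    exact affine_equation hq h hs

/-- The equation for the Hecke generator `i` in the row `σ`, solved for the entry `π`. -/
lemma entryFromEarlier (hq : q ≠ 0) (h : SolvesHecke q Ψ)
    (h0 : Ψ (allOpen (2 * n + 1)) = baseBox n hq) {i : Fin (2 * n + 1)}
    {σ π : OpenLinkPattern (2 * n + 1)}
    (h1 : genC n (loopWeight q) i σ π = 1)
    (h2 : ∀ ρ, genC n (loopWeight q) i σ ρ ≠ 0 → ρ ≠ π →
      downArea (closings ρ) < downArea (closings π)) :
    EntryFromEarlier q (toPolyVec Ψ) rank i σ π := by
  rw [EntryFromEarlier, degIn_eq hq h0]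
  have e1 := aeval_reflectedPoint (q := q) i (Ψ σ)
  rw [h, add_sub_cancel_left] at e1
  have e2 : ∑ ρ with rank ρ < rank π, gen n q i σ ρ * evalAt (toPolyVec Ψ) (w n) ρ =
      aeval (w n) (∑ ρ with ρ ≠ π, genC n (loopWeight q) i σ ρ • Ψ ρ : Box n).1 := by
    rw [AddSubmonoidClass.coe_finsetSum, map_sum]
    have e3 : ∀ ρ, gen n q i σ ρ * evalAt (toPolyVec Ψ) (w n) ρ =
        aeval (w n) (genC n (loopWeight q) i σ ρ • Ψ ρ : Box n).1 := by
      intro ρ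
      rw [gen_eq, Submodule.coe_smul, map_smul, Algebra.smul_def]
      rfl
    rw [Finset.sum_congr rfl fun ρ _ => e3 ρ]
    refine Finset.sum_subset (fun ρ hρ => ?_) fun ρ hρ hρ' => ?_
    · rw [Finset.mem_filter] at hρ ⊢
      exact ⟨hρ.1, fun e => hρ.2.ne (by rw [e])⟩
    · by_cases h3 : genC n (loopWeight q) i σ ρ = 0
      · rw [h3, zero_smul]
        simp
      · exact absurd (rank_lt (h2 ρ h3 (Finset.mem_filter.1 hρ).2))
          fun h4 => hρ' (Finset.mem_filter.2 ⟨Finset.mem_univ _, h4⟩)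
  rw [e2]
  change _ = (_ * (_ * aeval _ (Ψ σ).1) - _ * aeval _ (Ψ σ).1) / _ - _
  rw [e1, add_sub_cancel_left, mul_div_cancel_left₀ _ (arg_sub_one_ne_zero i),
    matAct_eq_of_triangular h1, Submodule.coe_add, map_add, add_sub_cancel_right]
  rfl

end Verification

/-! ### Minimality and uniqueness -/

section Minimality

variable {n : ℕ} {q : ℂ} {Φ : PolyVec n}

/-- The bulk reflection equations as identities between polynomials. -/
lemma IsSolution.linForm_mul (hq : q ≠ 0) (h : IsSolution q Φ) (i : Fin (2 * n))
    (σ : OpenLinkPattern (2 * n + 1)) :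
    linForm q i.castSucc i.succ * rename (Equiv.swap i.castSucc i.succ) (Φ σ) =
      linForm q i.succ i.castSucc * Φ σ +
        (X i.succ - X i.castSucc) * matAct (genC n (loopWeight q) i.castSucc) Φ σ := by
  have h1 := (reflection_iff hq _ _ _).1 (h.reflection i.castSucc) σ
  rw [arg_castSucc, reflectedPoint_castSucc, prefactor_castSucc, inv_one, one_mul,
    ← aeval_rename] at h1
  have h0 := w_ne_zero i.castSucc
  have h4 : w n i.castSucc * (w n i.succ / w n i.castSucc) = w n i.succ := mul_div_cancel₀ _ h0
  refine aeval_w_injective ?_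
  simp only [map_mul, map_add, map_sub, aeval_X, aeval_linForm]
  rw [show algebraMap ℂ (RatFun n) q = const n q from rfl]
  rw [← h4]
  generalize (w n i.succ / w n i.castSucc) = x at h1 ⊢
  linear_combination w n i.castSucc * h1

lemma IsSolution.baseEntry_dvd (hq : q ≠ 0) (hq2 : q ^ 2 ≠ -1) (h : IsSolution q Φ) :
    baseEntry n q ∣ Φ (allOpen (2 * n + 1)) := by
  refine CqKZ.baseEntry_dvd hq hq2 fun i => ?_
  rw [h.linForm_mul hq, matAct, Finset.sum_eq_zero fun ρ _ => by rw [genC_allOpen, zero_smul],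
    mul_zero, add_zero]

/-- A solution of any degree is determined by its base entry. -/
lemma IsSolution.eq_zero (hq : q ≠ 0) (h : IsSolution q Φ) (h0 : Φ (allOpen (2 * n + 1)) = 0) :
    Φ = 0 := by
  have key : ∀ m π, downArea (closings π) = m → Φ π = 0 := by
    intro m
    induction m using Nat.strong_induction_on with
    | _ m ih =>
      rintro π rfl
      by_cases hπ : π = allOpen (2 * n + 1)
      · rw [hπ, h0]
      obtain ⟨i, σ, hσ, hi⟩ := exists_predecessor hπ
      obtain ⟨h1, h2⟩ := hi (loopWeight q)
      have h3 := (reflection_iff hq _ _ _).1 (h.reflection i) σ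
      rw [matAct_eq_of_triangular h1, ih _ hσ σ rfl, map_zero, map_zero, mul_zero, mul_zero,
        mul_zero, zero_add, Finset.sum_eq_zero, add_zero] at h3
      · refine aeval_w_injective (Eq.trans ?_ (map_zero _).symm)
        exact (mul_eq_zero.1 h3.symm).resolve_left (arg_sub_one_ne_zero i)
      · intro ρ hρ
        by_cases h4 : genC n (loopWeight q) i σ ρ = 0
        · rw [h4, zero_smul]
        · rw [ih _ (h2 ρ h4 (Finset.mem_filter.1 hρ).2) ρ rfl, smul_zero]
  exact funext fun π => key _ π rfl

lemma IsSolution.minimal (hq : q ≠ 0) (hq2 : q ^ 2 ≠ -1) (h : IsSolution q Φ) (hΦ : Φ ≠ 0) :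
    (∀ i, 2 * n ≤ degIn i Φ) ∧ n * (2 * n + 1) ≤ (Φ (allOpen (2 * n + 1))).totalDegree := by
  obtain ⟨g, hg⟩ := h.baseEntry_dvd hq hq2
  have hb := baseEntry_ne_zero (n := n) hq
  have hg0 : g ≠ 0 := by
    rintro rfl
    exact hΦ (h.eq_zero hq (by rw [hg, mul_zero]))
  constructor
  · intro i
    refine le_trans ?_ (Finset.le_sup (f := fun π => (Φ π).degreeOf i)
      (Finset.mem_univ (allOpen (2 * n + 1))))
    simp only [hg]
    rw [degreeOf_mul_eq hb hg0, baseEntry_degreeOf hq]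
    exact Nat.le_add_right _ _
  · rw [hg, totalDegree_mul_of_isDomain hb hg0, baseEntry_totalDegree hq]
    exact Nat.le_add_right _ _

/-- A bound for the degree in the last variable is a bound for the degree in all of them. -/
lemma IsSolution.mem_box (hq : q ≠ 0) (h : IsSolution q Φ)
    (hd : degIn (Fin.last (2 * n)) Φ ≤ 2 * n) (π : OpenLinkPattern (2 * n + 1)) :
    Φ π ∈ Box n := by
  rw [mem_restrictDegree_iff_degreeOf]
  intro i
  induction i using Fin.reverseInduction generalizing π with
  | last => exact (Finset.le_sup (f := fun π => (Φ π).degreeOf (Fin.last (2 * n)))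
      (Finset.mem_univ π)).trans hd
  | cast i ih =>
    by_cases h0 : Φ π = 0
    · simp [h0]
    have hne := castSucc_ne_succ i
    have h1 := congrArg (degreeOf i.succ) (h.linForm_mul hq i π)
    have hr : rename (Equiv.swap i.castSucc i.succ) (Φ π) ≠ 0 := by
      rw [Ne, map_eq_zero_iff _ (rename_injective _ (Equiv.injective _))]
      exact h0
    rw [degreeOf_mul_eq (linForm_ne_zero hq hne) hr, degreeOf_linForm hq hne, if_pos (Or.inr rfl),
      degreeOf_rename_equiv, Equiv.symm_swap, Equiv.swap_apply_right] at h1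
    have h2 : degreeOf i.succ (linForm q i.succ i.castSucc * Φ π) ≤ 1 + 2 * n := by
      refine (degreeOf_mul_le _ _ _).trans (Nat.add_le_add ?_ (ih π))
      rw [degreeOf_linForm hq hne.symm, if_pos (Or.inl rfl)]
    have h3 : degreeOf i.succ ((X i.succ - X i.castSucc) *
        matAct (genC n (loopWeight q) i.castSucc) Φ π) ≤ 1 + 2 * n := by
      refine (degreeOf_mul_le _ _ _).trans (Nat.add_le_add ?_ ?_)
      · refine (degreeOf_sub_le _ _ _).trans (max_le ?_ ?_)
        · rw [degreeOf_X_self]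
        · rw [degreeOf_X_of_ne hne.symm]; exact Nat.zero_le _
      · refine (degreeOf_sum_le _ _ _).trans (Finset.sup_le fun ρ _ => ?_)
        rw [smul_eq_C_mul]
        exact (degreeOf_C_mul_le _ _ _).trans (ih ρ)
    have h4 := (degreeOf_add_le i.succ _ _).trans (max_le h2 h3)
    omega

/-- A solution in `Box n` is a solution for the Hecke generators, with base entry a multiple of
`baseBox`, which determines it. -/
lemma IsSolution.exists_eq_smul (hq : q ≠ 0) (hq2 : q ^ 2 ≠ -1) (h : IsSolution q Φ)
    (hd : degIn (Fin.last (2 * n)) Φ ≤ 2 * n) {Ψ : OpenLinkPattern (2 * n + 1) → Box n}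
    (hΨ : SolvesHecke q Ψ) (h0 : Ψ (allOpen (2 * n + 1)) = baseBox n hq) :
    ∃ c : ℂ, Φ = c • toPolyVec Ψ := by
  by_cases hΦ : Φ = 0
  · exact ⟨0, by rw [hΦ, zero_smul]⟩
  have hm : degIn (Fin.last (2 * n)) Φ = 2 * n := hd.antisymm ((h.minimal hq hq2 hΦ).1 _)
  set Φ' : OpenLinkPattern (2 * n + 1) → Box n := fun π => ⟨Φ π, h.mem_box hq hd π⟩
  have h1 : SolvesHecke q Φ' := by
    refine (reflection_iff_solvesHecke hq Φ').1 fun i => ?_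
    have := h.reflection i
    rwa [hm] at this
  obtain ⟨c, hc⟩ := h1.exists_allOpen hq hq2
  refine ⟨c, ?_⟩
  have h2 := (h1.sub (hΨ.smul c)).eq_zero (by
    rw [Pi.sub_apply, Pi.smul_apply, hc, h0, sub_self])
  funext π
  exact congrArg Subtype.val (sub_eq_zero.1 (congrFun h2 π))

end Minimality

end
end CqKZ

namespace CqKZ
open OpenLinkPattern MvPolynomial

noncomputable section

/-! ### The rational limit -/

section Expansion

open Asymptotics

variable {I : Type}

/-- A function of `h` depending on parameters has an asymptotic expansion in powers of `h` at `0`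
in which the coefficient of `h ^ k` is a homogeneous polynomial of degree `k` in the parameters. -/
def HasHomogeneousExpansion (g : (I → ℂ) → ℂ → ℂ) : Prop :=
  ∃ a : PowerSeries (MvPolynomial I ℂ), (∀ k, (PowerSeries.coeff k a).IsHomogeneous k) ∧
    ∀ (x : I → ℂ) (K : ℕ), (fun h : ℂ => g x h -
      ∑ k ∈ Finset.range K, eval x (PowerSeries.coeff k a) * h ^ k) =O[𝓝 0] fun h => h ^ K

lemma sum_range_eq_eval_trunc (a : PowerSeries (MvPolynomial I ℂ)) (x : I → ℂ) (K : ℕ) (h : ℂ) :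
    ∑ k ∈ Finset.range K, eval x (PowerSeries.coeff k a) * h ^ k =
      (PowerSeries.trunc K (PowerSeries.map (eval x) a)).eval h := by
  have := PowerSeries.eval₂_trunc_eq_sum_range h (RingHom.id ℂ) K (PowerSeries.map (eval x) a)
  rw [Polynomial.eval, this]
  simp

lemma eval_isBigO_one (p : Polynomial ℂ) : (fun h => p.eval h) =O[𝓝 (0 : ℂ)] fun _ => (1 : ℂ) :=
  p.continuous.continuousAt.isBigO_one ℂ

lemma eval_isBigO_pow {p : Polynomial ℂ} {K : ℕ} (hp : ∀ d < K, p.coeff d = 0) :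
    (fun h => p.eval h) =O[𝓝 (0 : ℂ)] fun h => h ^ K := by
  obtain ⟨r, rfl⟩ := Polynomial.X_pow_dvd_iff.2 hp
  simp only [Polynomial.eval_mul, Polynomial.eval_pow, Polynomial.eval_X]
  simpa using (isBigO_refl (fun h : ℂ => h ^ K) (𝓝 0)).mul (eval_isBigO_one r)

lemma pow_isBigO_one (K : ℕ) : (fun h : ℂ => h ^ K) =O[𝓝 (0 : ℂ)] fun _ => (1 : ℂ) :=
  (continuous_pow K).continuousAt.isBigO_one ℂ

namespace HasHomogeneousExpansion

variable {g g' : (I → ℂ) → ℂ → ℂ}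

lemma add (hg : HasHomogeneousExpansion g) (hg' : HasHomogeneousExpansion g') :
    HasHomogeneousExpansion fun x h => g x h + g' x h := by
  obtain ⟨a, ha, ha'⟩ := hg
  obtain ⟨b, hb, hb'⟩ := hg'
  refine ⟨a + b, fun k => ?_, fun x K => ?_⟩
  · rw [map_add]; exact (ha k).add (hb k)
  · refine ((ha' x K).add (hb' x K)).congr_left fun h => ?_
    simp only [map_add, add_mul, Finset.sum_add_distrib]
    ring

lemma mul (hg : HasHomogeneousExpansion g) (hg' : HasHomogeneousExpansion g') :
    HasHomogeneousExpansion fun x h => g x h * g' x h := by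
  obtain ⟨a, ha, ha'⟩ := hg
  obtain ⟨b, hb, hb'⟩ := hg'
  refine ⟨a * b, fun k => ?_, fun x K => ?_⟩
  · rw [PowerSeries.coeff_mul]
    refine IsHomogeneous.sum _ _ _ fun p hp => ?_
    rw [← Finset.HasAntidiagonal.mem_antidiagonal.1 hp]
    exact (ha p.1).mul (hb p.2)
  · have h1 := ha' x K
    have h2 := hb' x K
    simp only [sum_range_eq_eval_trunc] at h1 h2 ⊢
    rw [map_mul]
    generalize PowerSeries.map (eval x) a = α at h1 ⊢
    generalize PowerSeries.map (eval x) b = β at h2 ⊢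
    have h3 : ∀ d < K, (PowerSeries.trunc K α * PowerSeries.trunc K β -
        PowerSeries.trunc K (α * β)).coeff d = 0 := by
      intro d hd
      rw [Polynomial.coeff_sub, sub_eq_zero, PowerSeries.coeff_trunc, if_pos hd,
        PowerSeries.coeff_mul_eq_coeff_trunc_mul_trunc _ _ hd]
      rw [← Polynomial.coe_mul, Polynomial.coeff_coe]
    have h4 : (fun h => g' x h) =O[𝓝 0] fun _ => (1 : ℂ) := by
      refine ((h2.trans (pow_isBigO_one K)).add
        (eval_isBigO_one (PowerSeries.trunc K β))).congr_left fun h => ?_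
      ring
    have h5 := (h1.mul h4).add (((eval_isBigO_one (PowerSeries.trunc K α)).mul h2).congr_right
      fun h => (by rw [one_mul, mul_one] : (1 : ℂ) * h ^ K = h ^ K * 1))
    refine ((h5.congr_right fun h => mul_one _).add (eval_isBigO_pow h3)).congr_left fun h => ?_
    rw [Polynomial.eval_sub, Polynomial.eval_mul]
    ring

/-- The coefficients of the expansion are `(-ℓ) ^ k / k!`. -/
lemma exp {ℓ : MvPolynomial I ℂ} (hℓ : ℓ.IsHomogeneous 1) :
    HasHomogeneousExpansion fun x h => Complex.exp (-h * eval x ℓ) := by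
  refine ⟨PowerSeries.mk fun k => C ((-1) ^ k / (k.factorial : ℂ)) * ℓ ^ k, fun k => ?_,
    fun x K => ?_⟩
  · rw [PowerSeries.coeff_mk]
    simpa using (hℓ.pow k).C_mul ((-1) ^ k / (k.factorial : ℂ))
  · have h1 := Complex.exp_sub_sum_range_isBigO_pow K
    have h2 : Filter.Tendsto (fun h : ℂ => -h * eval x ℓ) (𝓝 0) (𝓝 0) := by
      have : Continuous fun h : ℂ => -h * eval x ℓ := by fun_prop
      simpa using this.tendsto 0
    have h3 := h1.comp_tendsto h2
    refine (h3.congr_left fun h => ?_).trans ?_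
    · simp only [Function.comp_apply, PowerSeries.coeff_mk, map_mul, eval_C, map_pow]
      congr 1
      refine Finset.sum_congr rfl fun k _ => ?_
      rw [show -h * eval x ℓ = (-1) * h * eval x ℓ by ring, mul_pow, mul_pow]
      ring
    · refine IsBigO.of_bound (‖eval x ℓ‖ ^ K) (Filter.Eventually.of_forall fun h => ?_)
      simp [mul_pow, mul_comm]

lemma const (c : ℂ) : HasHomogeneousExpansion fun (_ : I → ℂ) _ => c := by
  refine ⟨PowerSeries.C (C c), fun k => ?_, fun x K => ?_⟩
  · rw [PowerSeries.coeff_C]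
    split_ifs with hk
    · rw [hk]; exact isHomogeneous_C _ _
    · exact isHomogeneous_zero _ _ _
  · rcases K with _ | K
    · simpa using isBigO_const_const c (one_ne_zero (α := ℂ)) (𝓝 (0 : ℂ))
    · refine IsBigO.congr_left (isBigO_zero _ _) fun h => ?_
      rw [Finset.sum_range_succ', Finset.sum_eq_zero fun k _ => by simp]
      simp

end HasHomogeneousExpansion

/-- If the coefficients of lower order vanish, then the coefficient of `h ^ N` is a limit. -/
lemma tendsto_div_pow {g : ℂ → ℂ} {a : ℕ → ℂ} {N : ℕ}
    (hg : (fun h => g h - ∑ k ∈ Finset.range (N + 1), a k * h ^ k) =O[𝓝 0] fun h => h ^ (N + 1))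
    (ha : ∀ k < N, a k = 0) : Filter.Tendsto (fun h => g h / h ^ N) (𝓝[≠] 0) (𝓝 (a N)) := by
  have h1 : (fun h => g h - a N * h ^ N) =O[𝓝 0] fun h => h ^ (N + 1) := by
    refine hg.congr_left fun h => ?_
    rw [Finset.sum_range_succ, Finset.sum_eq_zero fun k hk => by
      rw [ha k (Finset.mem_range.1 hk), zero_mul], zero_add]
  have h2 : (fun h => (g h - a N * h ^ N) * (h ^ N)⁻¹) =O[𝓝[≠] 0] fun h => h := by
    refine ((h1.mono nhdsWithin_le_nhds).mul (isBigO_refl (fun h : ℂ => (h ^ N)⁻¹) _)).congr'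
      Filter.EventuallyEq.rfl ?_
    filter_upwards [self_mem_nhdsWithin] with h hh
    rw [pow_succ', mul_inv_cancel_right₀ (pow_ne_zero N hh)]
  have h3 : Filter.Tendsto (fun h => (g h - a N * h ^ N) * (h ^ N)⁻¹) (𝓝[≠] 0) (𝓝 0) :=
    h2.trans_tendsto (Filter.tendsto_id.mono_left nhdsWithin_le_nhds)
  have h4 := h3.add (tendsto_const_nhds (x := a N))
  rw [zero_add] at h4
  refine h4.congr' ?_
  filter_upwards [self_mem_nhdsWithin] with h hh
  have := pow_ne_zero N (show h ≠ 0 from hh)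
  field_simp
  ring

/-- A function of order `N` has no coefficients of order less than `N`. -/
lemma coeff_eq_zero_of_isBigO {g : ℂ → ℂ} {a : ℕ → ℂ} {N : ℕ}
    (hg : ∀ K, (fun h => g h - ∑ k ∈ Finset.range K, a k * h ^ k) =O[𝓝 0] fun h => h ^ K)
    (hN : g =O[𝓝[≠] 0] fun h => h ^ N) : ∀ k < N, a k = 0 := by
  intro k
  induction k using Nat.strong_induction_on with
  | _ k ih =>
    intro hk
    refine tendsto_nhds_unique (tendsto_div_pow (hg (k + 1)) fun j hj => ih j hj (hj.trans hk)) ?_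
    have h1 : (fun h => g h / h ^ k) =O[𝓝[≠] 0] fun h => h := by
      have h2 : (fun h : ℂ => h ^ N) =O[𝓝[≠] 0] fun h => h ^ (k + 1) := by
        have := (eval_isBigO_pow (p := Polynomial.X ^ N) (K := k + 1) fun d hd => by
          rw [Polynomial.coeff_X_pow, if_neg (by omega)]).mono
            (nhdsWithin_le_nhds (s := {(0 : ℂ)}ᶜ))
        simpa using this
      refine ((hN.trans h2).mul (isBigO_refl (fun h : ℂ => (h ^ k)⁻¹) _)).congr'
        (Filter.Eventually.of_forall fun h => (div_eq_mul_inv _ _).symm) ?_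
      filter_upwards [self_mem_nhdsWithin] with h hh
      rw [pow_succ', mul_inv_cancel_right₀ (pow_ne_zero k hh)]
    exact h1.trans_tendsto (Filter.tendsto_id.mono_left nhdsWithin_le_nhds)

/-- A function whose order is at least `N` outside the zero locus of a polynomial has order at
least `N` everywhere, and its leading coefficient is a polynomial. -/
lemma HasHomogeneousExpansion.exists_limit {g : (I → ℂ) → ℂ → ℂ} (hg : HasHomogeneousExpansion g)
    {p : MvPolynomial I ℂ} (hp : p ≠ 0) {N : ℕ}
    (hN : ∀ x, eval x p ≠ 0 → g x =O[𝓝[≠] 0] fun h => h ^ N) :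
    (∀ x, g x =O[𝓝[≠] 0] fun h => h ^ N) ∧ ∃ P : MvPolynomial I ℂ, P.IsHomogeneous N ∧
      ∀ x, Filter.Tendsto (fun h => g x h / h ^ N) (𝓝[≠] 0) (𝓝 (eval x P)) := by
  obtain ⟨a, ha, ha'⟩ := hg
  have h0 : ∀ k < N, PowerSeries.coeff k a = 0 := by
    intro k hk
    refine (mul_eq_zero.1 (?_ : p * PowerSeries.coeff k a = 0)).resolve_left hp
    refine MvPolynomial.funext fun x => ?_
    rw [map_mul, map_zero]
    by_cases hx : eval x p = 0
    · rw [hx, zero_mul]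
    · rw [coeff_eq_zero_of_isBigO (ha' x) (hN x hx) k hk, mul_zero]
  refine ⟨fun x => ?_, PowerSeries.coeff N a, ha N, fun x =>
    tendsto_div_pow (a := fun k => eval x (PowerSeries.coeff k a)) (ha' x (N + 1)) fun k hk => by
      simp [h0 k hk]⟩
  refine ((ha' x N).mono nhdsWithin_le_nhds).congr_left fun h => ?_
  rw [Finset.sum_eq_zero fun k hk => by rw [h0 k (Finset.mem_range.1 hk), map_zero, zero_mul],
    sub_zero]

end Expansion

end
end CqKZ

namespace CqKZ
open OpenLinkPattern MvPolynomial

noncomputable section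

section RationalLimit

open Asymptotics Filter

lemma tendsto_exp_sub_exp_div (a b : ℂ) :
    Tendsto (fun h : ℂ => (Complex.exp (-h * a) - Complex.exp (-h * b)) / h) (𝓝[≠] 0)
      (𝓝 (b - a)) := by
  have h1 : ∀ c : ℂ, HasDerivAt (fun h : ℂ => Complex.exp (-h * c)) (-c) 0 := by
    intro c
    have := ((hasDerivAt_id (0 : ℂ)).neg.mul_const c).cexp
    simpa using this
  have h2 := ((h1 a).sub (h1 b)).tendsto_slope_zero
  simp only [Pi.sub_apply, zero_add, neg_zero, zero_mul, Complex.exp_zero, sub_self, sub_zero,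
    smul_eq_mul] at h2
  rw [show -a - -b = b - a by ring] at h2
  exact h2.congr fun h => (div_eq_inv_mul _ _).symm

lemma isBigO_of_tendsto_div {d : ℂ → ℂ} {c : ℂ} {N : ℕ}
    (hd : Tendsto (fun h => d h / h ^ N) (𝓝[≠] 0) (𝓝 c)) : d =O[𝓝[≠] 0] fun h => h ^ N := by
  refine isBigO_of_div_tendsto_nhds ?_ c hd
  filter_upwards [self_mem_nhdsWithin] with h hh h0
  exact absurd h0 (pow_ne_zero N hh)

lemma exp_sub_exp_isBigO (a b : ℂ) :
    (fun h : ℂ => Complex.exp (-h * a) - Complex.exp (-h * b)) =O[𝓝[≠] 0] fun h => h ^ 1 :=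
  isBigO_of_tendsto_div (by simpa using tendsto_exp_sub_exp_div a b)

/-- Division by a function with a simple zero lowers the order by one. -/
lemma isBigO_pow_of_exp_sub_exp_mul {E : ℂ → ℂ} {a b : ℂ} {N : ℕ} (hab : b - a ≠ 0)
    (h : (fun h => (Complex.exp (-h * a) - Complex.exp (-h * b)) * E h) =O[𝓝[≠] 0]
      fun h => h ^ (N + 1)) : E =O[𝓝[≠] 0] fun h => h ^ N := by
  have h1 := tendsto_exp_sub_exp_div a b
  have h2 : (fun h : ℂ => (h / (Complex.exp (-h * a) - Complex.exp (-h * b)))) =O[𝓝[≠] 0]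
      fun _ => (1 : ℂ) := by
    have := (h1.inv₀ hab).isBigO_one ℂ
    simpa [inv_div] using this
  have h3 := ((h2.mul h).mul (isBigO_refl (fun h : ℂ => h⁻¹) _))
  refine h3.congr' ?_ ?_
  · filter_upwards [self_mem_nhdsWithin, h1.eventually_ne hab] with h hh hd
    have hh : h ≠ 0 := hh
    have hd' : Complex.exp (-h * a) - Complex.exp (-h * b) ≠ 0 := fun e => hd (by rw [e, zero_div])
    generalize Complex.exp (-h * a) - Complex.exp (-h * b) = d at hd' ⊢
    field_simp
  · filter_upwards [self_mem_nhdsWithin] with h hh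
    rw [one_mul, pow_succ, mul_inv_cancel_right₀ (show h ≠ 0 from hh)]

variable {n : ℕ}

/-- The value of `q` in the rational limit, `A` being the coordinate `none` of `x`. -/
def limitUnit (x : Option (Fin (2 * n + 1)) → ℂ) (h : ℂ) : ℂˣ :=
  Units.mk0 (-Complex.exp (-h * x none / 2)) (neg_ne_zero.2 (Complex.exp_ne_zero _))

/-- The spectral parameters in the rational limit. -/
def limitPoint (x : Option (Fin (2 * n + 1)) → ℂ) (h : ℂ) (i : Fin (2 * n + 1)) : ℂ :=
  Complex.exp (-h * x (some i))

lemma limitUnit_val (x : Option (Fin (2 * n + 1)) → ℂ) (h : ℂ) :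
    (limitUnit x h : ℂ) = -Complex.exp (-h * (x none / 2)) := by
  rw [limitUnit, Units.val_mk0, mul_div_assoc]

lemma limitUnit_inv (x : Option (Fin (2 * n + 1)) → ℂ) (h : ℂ) :
    (limitUnit x h : ℂ)⁻¹ = -Complex.exp (-h * (-(x none / 2))) := by
  rw [limitUnit_val, inv_neg, ← Complex.exp_neg]
  congr 2
  ring

lemma IsLaurent.hasHomogeneousExpansion {f : ℂˣ → Box n} (hf : IsLaurent f) :
    HasHomogeneousExpansion fun x h => eval (limitPoint x h) (f (limitUnit x h)).1 := by
  let P : (ℂˣ → Box n) → Prop := fun f => HasHomogeneousExpansion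
    fun (x : Option (Fin (2 * n + 1)) → ℂ) h => eval (limitPoint x h) (f (limitUnit x h)).1
  suffices h : P f from h
  refine hf.induction (P := P) (fun k m => ?_) ?_ fun f g (hf : HasHomogeneousExpansion _)
    (hg : HasHomogeneousExpansion _) => ?_ <;> change HasHomogeneousExpansion _
  · have h1 : HasHomogeneousExpansion fun (x : Option (Fin (2 * n + 1)) → ℂ) h =>
        ((limitUnit x h ^ k : ℂˣ) : ℂ) := by
      have := (HasHomogeneousExpansion.const (I := Option (Fin (2 * n + 1))) ((-1 : ℂ) ^ k)).mul
        (HasHomogeneousExpansion.exp (ℓ := C ((k : ℂ) / 2) * X (none : Option (Fin (2 * n + 1))))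
          ((isHomogeneous_X ℂ none).C_mul _))
      convert this using 3 with x h
      rw [Units.val_zpow_eq_zpow_val, limitUnit_val, neg_eq_neg_one_mul, mul_zpow,
        ← Complex.exp_int_mul]
      congr 2
      simp only [map_mul, eval_C, eval_X]
      ring
    have h2 : ∀ p : MvPolynomial (Fin (2 * n + 1)) ℂ, HasHomogeneousExpansion
        fun (x : Option (Fin (2 * n + 1)) → ℂ) h => eval (limitPoint x h) p := by
      intro p
      induction p using MvPolynomial.induction_on with
      | C c => simpa using HasHomogeneousExpansion.const c
      | add p r hp hr => simpa using hp.add hr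
      | mul_X p i hp =>
        have := hp.mul (HasHomogeneousExpansion.exp (isHomogeneous_X ℂ (some i)))
        simpa [limitPoint] using this
    simpa using h1.mul (h2 m.1)
  · simpa using HasHomogeneousExpansion.const (I := Option (Fin (2 * n + 1))) 0
  · simpa using hf.add hg

lemma eval_linForm_limit (x : Option (Fin (2 * n + 1)) → ℂ) (h : ℂ) (i j : Fin (2 * n + 1)) :
    (limitUnit x h : ℂ) * limitPoint x h i - (limitUnit x h : ℂ)⁻¹ * limitPoint x h j =
      Complex.exp (-h * (x (some j) - x none / 2)) -
        Complex.exp (-h * (x (some i) + x none / 2)) := by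
  have e1 : Complex.exp (-h * (x (some j) - x none / 2)) =
      Complex.exp (-h * (-(x none / 2))) * Complex.exp (-h * x (some j)) := by
    rw [← Complex.exp_add]; congr 1; ring
  have e2 : Complex.exp (-h * (x (some i) + x none / 2)) =
      Complex.exp (-h * (x none / 2)) * Complex.exp (-h * x (some i)) := by
    rw [← Complex.exp_add]; congr 1; ring
  rw [e1, e2, limitUnit_inv, limitUnit_val, limitPoint, limitPoint]
  ring

lemma tendsto_baseEntry (x : Option (Fin (2 * n + 1)) → ℂ) :
    Tendsto (fun h => eval (limitPoint x h) (baseEntry n (limitUnit x h)) / h ^ (n * (2 * n + 1)))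
      (𝓝[≠] 0) (𝓝 (eval x (∏ i : Fin (2 * n + 1), ∏ j ∈ Finset.Ioi i,
        (X none + X (some i) - X (some j))))) := by
  have h1 : ∀ p ∈ pairs n, Tendsto (fun h => eval (limitPoint x h) (linForm (limitUnit x h) p.1 p.2)
      / h) (𝓝[≠] 0) (𝓝 (x none + x (some p.1) - x (some p.2))) := by
    intro p _
    have := tendsto_exp_sub_exp_div (x (some p.2) - x none / 2) (x (some p.1) + x none / 2)
    convert this using 2 with h
    · rw [eval_linForm, eval_linForm_limit]
    · ring
  convert tendsto_finsetProd (pairs n) h1 using 2 with h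
  · rw [baseEntry_eq, map_prod, Finset.prod_div_distrib, Finset.prod_const, card_pairs]
  · rw [← prod_pairs fun i j => (X none + X (some i) - X (some j) :
      MvPolynomial (Option (Fin (2 * n + 1))) ℂ)]
    simp

lemma genC_isBigO_one (x : Option (Fin (2 * n + 1)) → ℂ) (i : Fin (2 * n + 1))
    (σ ρ : OpenLinkPattern (2 * n + 1)) :
    (fun h => genC n (loopWeight (limitUnit x h : ℂ)) i σ ρ) =O[𝓝[≠] 0] fun _ => (1 : ℂ) := by
  have h1 : (fun h => loopWeight (limitUnit x h : ℂ)) =O[𝓝[≠] 0] fun _ => (1 : ℂ) := by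
    have : Continuous fun h => loopWeight (limitUnit x h : ℂ) := by
      have e : ∀ h, loopWeight (limitUnit x h : ℂ) =
          Complex.exp (-h * (x none / 2)) + Complex.exp (-h * (-(x none / 2))) := fun h => by
        rw [loopWeight, limitUnit_inv, limitUnit_val]; ring
      simp only [e]
      fun_prop
    exact (this.continuousAt.isBigO_one ℂ).mono nhdsWithin_le_nhds
  have h2 : ∀ c : ℂ, (fun _ : ℂ => c) =O[𝓝[≠] 0] fun _ => (1 : ℂ) := fun c =>
    isBigO_const_const c one_ne_zero _
  refine Fin.lastCases ?_ (fun i => ?_) i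
  · simp only [genC_last, lastE]
    split_ifs
    exacts [h1, h2 _, h2 _]
  · simp only [genC_castSucc, bulkE, bulkWeight]
    split_ifs
    exacts [h1, h1, h2 _, h2 _, h2 _]

variable {Ψ : ℂˣ → OpenLinkPattern (2 * n + 1) → Box n}

/-- If a component has order `N`, then the corresponding component of the action of a generator has
order `N`, away from the fixed points of the reflection. -/
lemma isBigO_matAct (hS : ∀ u : ℂˣ, SolvesHecke (u : ℂ) (Ψ u)) {N : ℕ}
    {σ : OpenLinkPattern (2 * n + 1)}
    (hσ : ∀ x, (fun h => eval (limitPoint x h) (Ψ (limitUnit x h) σ).1) =O[𝓝[≠] 0]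
      fun h => h ^ N) (i : Fin (2 * n + 1)) :
    ∃ p : MvPolynomial (Option (Fin (2 * n + 1))) ℂ, p ≠ 0 ∧ ∀ x, eval x p ≠ 0 →
      (fun h => eval (limitPoint x h) (matAct (genC n (loopWeight (limitUnit x h : ℂ)) i)
        (Ψ (limitUnit x h)) σ).1) =O[𝓝[≠] 0] fun h => h ^ N := by
  have hmul : ∀ {f g : ℂ → ℂ}, f =O[𝓝[≠] 0] (fun h => h ^ 1) → g =O[𝓝[≠] 0] (fun h => h ^ N) →
      (fun h => f h * g h) =O[𝓝[≠] 0] fun h => h ^ (N + 1) := fun hf hg =>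
    (hf.mul hg).congr_right fun h => by rw [← pow_add, add_comm]
  have hE : ∀ (x : Option (Fin (2 * n + 1)) → ℂ) h i,
      matAct (genC n (loopWeight (limitUnit x h : ℂ)) i) (Ψ (limitUnit x h)) σ =
      heckeT n (limitUnit x h) i (Ψ (limitUnit x h) σ) -
        (limitUnit x h : ℂ) • Ψ (limitUnit x h) σ := fun x h i => by
    rw [hS, add_sub_cancel_left]
  induction i using Fin.lastCases with
  | last =>
    set L := Fin.last (2 * n)
    refine ⟨X (some L), X_ne_zero _, fun x hx => ?_⟩
    rw [eval_X] at hx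
    set y := Function.update x (some L) (-x (some L)) with hy
    have hu : ∀ h, limitUnit y h = limitUnit x h := fun h => by
      apply Units.ext
      rw [limitUnit_val, limitUnit_val, hy, Function.update_of_ne (Option.some_ne_none L).symm]
    have hv : ∀ h, limitPoint y h = Function.update (limitPoint x h) L (limitPoint x h L)⁻¹ := by
      intro h
      funext k
      by_cases hk : k = L
      · subst hk
        rw [Function.update_self, limitPoint, limitPoint, hy, Function.update_self,
          ← Complex.exp_neg]
        congr 1
        ring
      · rw [Function.update_of_ne hk, limitPoint, limitPoint, hy,
          Function.update_of_ne fun e => hk (Option.some_injective _ e)]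
    have hb : (fun h => limitPoint x h L ^ (2 * n)) =O[𝓝[≠] 0] fun _ => (1 : ℂ) := by
      have : Continuous fun h => limitPoint x h L ^ (2 * n) := by
        unfold limitPoint
        fun_prop
      exact (this.continuousAt.isBigO_one ℂ).mono nhdsWithin_le_nhds
    refine isBigO_pow_of_exp_sub_exp_mul (a := 0) (b := 2 * x (some L))
      (by simpa using hx) ?_
    have h1 := hmul (exp_sub_exp_isBigO (-(x none / 2)) (2 * x (some L) + x none / 2))
      ((hb.mul (hσ y)).congr_right fun h => one_mul _)
    have h2 := hmul (exp_sub_exp_isBigO (2 * x (some L) - x none / 2) (x none / 2)) (hσ x)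
    refine (h1.sub h2).congr_left fun h => ?_
    have h3 := eval_heckeT_last (limitUnit x h : ℂ) (Ψ (limitUnit x h) σ)
      (v := limitPoint x h) (Complex.exp_ne_zero _)
    rw [hE, hu, hv, Submodule.coe_sub, Submodule.coe_smul, map_sub, smul_eval]
    have e0 : limitPoint x h L ^ 2 = Complex.exp (-h * (2 * x (some L))) := by
      rw [limitPoint, ← Complex.exp_nat_mul]
      congr 1
      push_cast
      ring
    have e1 : Complex.exp (-h * (2 * x (some L) + x none / 2)) =
        -(limitUnit x h : ℂ) * limitPoint x h L ^ 2 := by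
      rw [e0, limitUnit_val, neg_neg, ← Complex.exp_add]
      congr 1
      ring
    have e2 : Complex.exp (-h * (2 * x (some L) - x none / 2)) =
        -(limitUnit x h : ℂ)⁻¹ * limitPoint x h L ^ 2 := by
      rw [e0, limitUnit_inv, neg_neg, ← Complex.exp_add]
      congr 1
      ring
    have e3 : Complex.exp (-h * (x none / 2)) = -(limitUnit x h : ℂ) := by
      rw [limitUnit_val, neg_neg]
    have e4 : Complex.exp (-h * (-(x none / 2))) = -(limitUnit x h : ℂ)⁻¹ := by
      rw [limitUnit_inv, neg_neg]
    rw [e1, e2, e3, e4, ← e0, mul_zero, Complex.exp_zero]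
    linear_combination -h3
  | cast i =>
    refine ⟨X (some i.castSucc) - X (some i.succ), X_sub_X_ne_zero fun e =>
      castSucc_ne_succ i (Option.some_injective _ e).symm, fun x hx => ?_⟩
    rw [map_sub, eval_X, eval_X] at hx
    set y : Option (Fin (2 * n + 1)) → ℂ := fun o => x (o.map (Equiv.swap i.castSucc i.succ))
      with hy
    have hu : ∀ h, limitUnit y h = limitUnit x h := fun h => rfl
    have hv : ∀ h, limitPoint y h = limitPoint x h ∘ Equiv.swap i.castSucc i.succ := fun h => rfl
    refine isBigO_pow_of_exp_sub_exp_mul (a := x (some i.succ)) (b := x (some i.castSucc)) hx ?_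
    have h1 := hmul (exp_sub_exp_isBigO (x (some i.succ) - x none / 2)
      (x (some i.castSucc) + x none / 2)) (hσ y)
    have h2 := hmul (exp_sub_exp_isBigO (x (some i.castSucc) - x none / 2)
      (x (some i.succ) + x none / 2)) (hσ x)
    refine (h1.sub h2).congr_left fun h => ?_
    have h3 := aeval_comp_swap (q := (limitUnit x h : ℂ)) i (Ψ (limitUnit x h) σ) (limitPoint x h)
    simp only [aeval_eq_eval, Algebra.algebraMap_self, RingHom.id_apply] at h3
    rw [eval_linForm_limit, eval_linForm_limit] at h3
    rw [hu, hv, hE]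
    change _ = (limitPoint x h i.succ - limitPoint x h i.castSucc) * _
    linear_combination h3

/-- All components have the order of the base entry, by induction along the triangular order; at
each step the order is extended from a dense set of parameters to all of them. -/
theorem exists_rational_limit (hL : ∀ π, IsLaurent fun u => Ψ u π)
    (hS : ∀ u : ℂˣ, SolvesHecke (u : ℂ) (Ψ u))
    (h0 : ∀ u : ℂˣ, Ψ u (allOpen (2 * n + 1)) = baseBox n u.ne_zero) :
    ∃ P : OpenLinkPattern (2 * n + 1) → MvPolynomial (Option (Fin (2 * n + 1))) ℂ,
      P (allOpen (2 * n + 1)) = ∏ i : Fin (2 * n + 1), ∏ j ∈ Finset.Ioi i,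
        (X none + X (some i) - X (some j)) ∧
      ∀ π, (P π).IsHomogeneous (n * (2 * n + 1)) ∧ ∀ x, Tendsto (fun h =>
        eval (limitPoint x h) (Ψ (limitUnit x h) π).1 / h ^ (n * (2 * n + 1))) (𝓝[≠] 0)
          (𝓝 (eval x (P π))) := by
  have hbase : ∀ x h, eval (limitPoint x h) (Ψ (limitUnit x h) (allOpen (2 * n + 1))).1 =
      eval (limitPoint x h) (baseEntry n (limitUnit x h)) := fun x h => by rw [h0]; rfl
  have key : ∀ m π, downArea (closings π) = m → ∀ x,
      (fun h => eval (limitPoint x h) (Ψ (limitUnit x h) π).1) =O[𝓝[≠] 0]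
        fun h => h ^ (n * (2 * n + 1)) := by
    intro m
    induction m using Nat.strong_induction_on with
    | _ m ih =>
      rintro π rfl
      by_cases hπ : π = allOpen (2 * n + 1)
      · subst hπ
        intro x
        simp only [hbase]
        exact isBigO_of_tendsto_div (tendsto_baseEntry x)
      obtain ⟨i, σ, hσ, hi⟩ := exists_predecessor hπ
      obtain ⟨p, hp, hp'⟩ := isBigO_matAct hS (ih _ hσ σ rfl) i
      refine ((hL π).hasHomogeneousExpansion.exists_limit hp fun x hx => ?_).1
      have h1 : (fun h => ∑ ρ with ρ ≠ π, genC n (loopWeight (limitUnit x h : ℂ)) i σ ρ *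
          eval (limitPoint x h) (Ψ (limitUnit x h) ρ).1) =O[𝓝[≠] 0]
          fun h => h ^ (n * (2 * n + 1)) := by
        refine IsBigO.fun_sum fun ρ hρ => ?_
        by_cases h2 : downArea (closings ρ) < downArea (closings π)
        · exact ((genC_isBigO_one x i σ ρ).mul (ih _ h2 ρ rfl x)).congr_right fun h => one_mul _
        · refine (isBigO_zero _ _).congr_left fun h => ?_
          rw [not_not.1 fun h3 => h2 ((hi _).2 ρ h3 (Finset.mem_filter.1 hρ).2), zero_mul]
      refine ((hp' x hx).sub h1).congr_left fun h => ?_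
      rw [matAct_eq_of_triangular (hi _).1, Submodule.coe_add, map_add,
        AddSubmonoidClass.coe_finsetSum, map_sum]
      simp only [Submodule.coe_smul, smul_eval, add_sub_cancel_right]
  have hlim : ∀ π, ∃ P : MvPolynomial (Option (Fin (2 * n + 1))) ℂ,
      P.IsHomogeneous (n * (2 * n + 1)) ∧ ∀ x, Tendsto (fun h =>
        eval (limitPoint x h) (Ψ (limitUnit x h) π).1 / h ^ (n * (2 * n + 1))) (𝓝[≠] 0)
          (𝓝 (eval x P)) := fun π =>
    ((hL π).hasHomogeneousExpansion.exists_limit one_ne_zero fun x _ => key _ π rfl x).2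
  choose P hP using hlim
  refine ⟨P, MvPolynomial.funext fun x => ?_, hP⟩
  refine tendsto_nhds_unique ((hP (allOpen (2 * n + 1))).2 x) ?_
  simp only [hbase]
  exact tendsto_baseEntry x

end RationalLimit

end
end CqKZ

theorem mainTheorem3 (n : ℕ) :
    ∃ Ψ : ℂ → CqKZ.PolyVec n,
      -- for every nonzero q, a polynomial solution with the stated degrees and base entry
      (∀ q : ℂ, q ≠ 0 →
        CqKZ.IsSolution q (Ψ q) ∧
        CqKZ.AffineReflection q (Ψ q) ∧
        (∀ i, CqKZ.degIn i (Ψ q) = 2 * n) ∧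
        Ψ q (OpenLinkPattern.allOpen (2 * n + 1)) = CqKZ.baseEntry n q ∧
        (Ψ q (OpenLinkPattern.allOpen (2 * n + 1))).IsHomogeneous (n * (2 * n + 1)) ∧
        (Ψ q (OpenLinkPattern.allOpen (2 * n + 1))).totalDegree = n * (2 * n + 1)) ∧
      -- the other entries are obtained from the base entry in a triangular way
      (∃ ord : OpenLinkPattern (2 * n + 1) → ℕ,
        Function.Injective ord ∧
        ord (OpenLinkPattern.allOpen (2 * n + 1)) = 0 ∧
        ∀ π, π ≠ OpenLinkPattern.allOpen (2 * n + 1) →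
          ∃ i σ, ord σ < ord π ∧
            ∀ q : ℂ, q ≠ 0 → CqKZ.EntryFromEarlier q (Ψ q) ord i σ π) ∧
      -- minimality of the degrees, and uniqueness up to a scalar
      (∀ q : ℂ, q ≠ 0 → q ^ 2 ≠ -1 → ∀ Φ : CqKZ.PolyVec n, CqKZ.IsSolution q Φ →
        (Φ ≠ 0 →
          (∀ i, 2 * n ≤ CqKZ.degIn i Φ) ∧
          n * (2 * n + 1) ≤ (Φ (OpenLinkPattern.allOpen (2 * n + 1))).totalDegree) ∧
        (CqKZ.degIn (Fin.last (2 * n)) Φ ≤ 2 * n → ∃ c : ℂ, Φ = c • Ψ q)) ∧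
      -- in the rational limit every entry has degree n (2 n + 1) in z_1, ..., z_r, A
      (∃ P : OpenLinkPattern (2 * n + 1) → MvPolynomial (Option (Fin (2 * n + 1))) ℂ,
        P (OpenLinkPattern.allOpen (2 * n + 1)) =
          ∏ i : Fin (2 * n + 1), ∏ j ∈ Finset.Ioi i,
            (MvPolynomial.X none + MvPolynomial.X (some i) - MvPolynomial.X (some j)) ∧
        ∀ π, (P π).IsHomogeneous (n * (2 * n + 1)) ∧
          ∀ (A : ℂ) (z : Fin (2 * n + 1) → ℂ),
            Filter.Tendsto
              (fun h : ℂ =>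
                MvPolynomial.eval (fun i => Complex.exp (-h * z i))
                  (Ψ (-Complex.exp (-h * A / 2)) π) / h ^ (n * (2 * n + 1)))
              (𝓝[≠] 0) (𝓝 (MvPolynomial.eval (fun o => o.elim A z) (P π)))) := by
  obtain ⟨Ψ, hL, hΨ⟩ := CqKZ.exists_solution n
  have hval : ∀ (q : ℂ) (hq : q ≠ 0),
      (if h : q ≠ 0 then CqKZ.toPolyVec (Ψ (Units.mk0 q h)) else 0) =
        CqKZ.toPolyVec (Ψ (Units.mk0 q hq)) := fun q hq => dif_pos hq
  refine ⟨fun q => if h : q ≠ 0 then CqKZ.toPolyVec (Ψ (Units.mk0 q h)) else 0,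
    fun q hq => ?_, ⟨CqKZ.rank, CqKZ.rank_injective, CqKZ.rank_allOpen, fun π hπ => ?_⟩,
    fun q hq hq2 Φ hΦ => ⟨fun h => hΦ.minimal hq hq2 h, fun hd => ?_⟩, ?_⟩
  · obtain ⟨h1, h2, h3⟩ := hΨ (Units.mk0 q hq)
    have h4 : CqKZ.toPolyVec (Ψ (Units.mk0 q hq)) (OpenLinkPattern.allOpen (2 * n + 1)) =
        CqKZ.baseEntry n q := congrArg Subtype.val h2
    simp only [hval q hq, h4]
    exact ⟨CqKZ.isSolution hq h1 h2 h3, CqKZ.affineReflection hq h2 h3, CqKZ.degIn_eq hq h2,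
      trivial, CqKZ.baseEntry_isHomogeneous q, CqKZ.baseEntry_totalDegree hq⟩
  · obtain ⟨i, σ, hσ, h⟩ := CqKZ.exists_predecessor hπ
    refine ⟨i, σ, CqKZ.rank_lt hσ, fun q hq => ?_⟩
    simp only [hval q hq]
    exact CqKZ.entryFromEarlier hq (hΨ (Units.mk0 q hq)).1 (hΨ (Units.mk0 q hq)).2.1
      (h (CqKZ.loopWeight q)).1 (h (CqKZ.loopWeight q)).2
  · simp only [hval q hq]
    exact hΦ.exists_eq_smul hq hq2 hd (hΨ (Units.mk0 q hq)).1 (hΨ (Units.mk0 q hq)).2.1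
  · obtain ⟨P, hP, hP'⟩ :=
      CqKZ.exists_rational_limit hL (fun u => (hΨ u).1) fun u => (hΨ u).2.1
    refine ⟨P, hP, fun π => ⟨(hP' π).1, fun A z => ?_⟩⟩
    refine ((hP' π).2 fun o => o.elim A z).congr fun h => ?_
    beta_reduce
    rw [hval _ (neg_ne_zero.2 (Complex.exp_ne_zero _))]
    rfl
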